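/- \textbf{Setting.} Let $\mathcal H=\mathbb C^n$ and let $H:[0,1]\to M_n(\mathbb C)$ be a $C^\infty$ family of Hermitian matrices; for an annealing time $\tau>0$ the system Hamiltonian is $H_S(t)=H(t/\tau)$, $t\in[0,\tau]$. Let $E_1(s)\ge\dots\ge E_n(s)$ be the eigenvalues of $H(s)$ with multiplicity. Assume that the degeneracies of the levels and of the Bohr frequencies do not change: for all indices $i,j,i',j'$, whether $E_i(s)=E_j(s)$, and whether $E_j(s)-E_i(s)=E_{j'}(s)-E_{i'}(s)$, does not depend on $s\in[0,1]$. The system is coupled by $g\sum_\alpha A_\alpha\otimes B_\alpha$ (a finite sum, $g\in\mathbb R$, $A_\alpha\in M_n(\mathbb C)$) to a bath with self-adjoint coupling operators $B_\alpha=B_\alpha^*$, in a state $\langle\cdot\rangle$ that is stationary under the bath dynamics $b\mapsto b(t)$. Let $G_{\alpha\beta}(t)=g^2\langle B_\alpha(t)B_\beta(0)\rangle$, so that $g^2\langle B_\alpha(t)B_\beta(s)\rangle=G_{\alpha\beta}(t-s)$. Assume that the functions $G_{\alpha\beta}$ are continuous and integrable on $\mathbb R$, and that the rates $$\gamma_{\alpha\beta}(\omega)=\int_{\mathbb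 R}e^{i\omega t}G_{\alpha\beta}(t)\,dt$$ are $C^\infty$ on $\mathbb R\setminus\{0\}$. Put $S_{\alpha\beta}(\omega)=\mathrm{p.v.}\!\int_{\mathbb R}\frac{\gamma_{\alpha\beta}(\omega')}{\omega-\omega'}\,d\omega'$. For a Hermitian $K$ with spectral projections $\Pi_E$, let $A_\alpha(\omega)=\sum_{E'-E=\omega}\Pi_EA_\alpha\Pi_{E'}$, so that $e^{itK}A_\alpha e^{-itK}=\sum_\omega e^{-it\omega}A_\alpha(\omega)$, the sum being over the distinct Bohr frequencies $\omega=E'-E$ of $K$. The Davies generator of $K$ is $$\mathcal L[K]X=-i[K+H_{LS},X]+\sum_{\alpha,\beta,\omega}\gamma_{\alpha\beta}(\omega)\Big(A_\beta(\omega)XA_\alpha(\omega)^\dagger-\tfrac12\{A_\alpha(\omega)^\dagger A_\beta(\omega),X\}\Big),\qquad H_{LS}=\sum_{\alpha,\beta,\omega}S_{\alpha\beta}(\omega)A_\alpha(\omega)^\dagger A_\beta(\omega).$$ Write $\mathcal L(s)=\mathcal L[H(s)]$ and $\mathcal L_\tau(t)=\mathcal L(t/\tau)=\mathcal L[H_S(t)]$.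 Derivatives at the end points of an interval are one-sided. A steady state of $\mathcal L(s)$ is a density matrix $\sigma$ with $\mathcal L(s)\sigma=0$. \textbf{Proposition.} Let $k\ge0$ and suppose that $\partial_t^{j}H_S(t)|_{t=\tau}=0$ for $j=1,\dots,k$ (equivalently, $H^{(j)}(1)=0$). (a) For every $\tau>0$, the generator $\mathcal L_\tau(t)$, each jump operator $A_\alpha(\omega_{ij}(t))$ along a Bohr frequency $\omega_{ij}(t)=E_j(t/\tau)-E_i(t/\tau)$, and the Lamb shift $H_{LS}(t)$ are $C^\infty$ on $[0,\tau]$, and their $t$-derivatives of orders $1,\dots,k$ vanish at $t=\tau$. (b) Suppose moreover that $\mathcal L(s)$ has a unique steady state for every $s\in[0,1]$. Then the ($\tau$-independent) family $\mathcal L(s)$, $s\in[0,1]$, is $C^{k+2}$; each $\mathcal L(s)$ preserves hermiticity and generates a trace preserving evolution; the eigenvalue $0$ is separated from the rest of the spectrum of $\mathcal L(s)$ by a gap uniform in $s$; the equations $\mathcal L(s)\sigma=0$, $\mathrm{Tr}\,\sigma=1$ have a unique solution; $\|e^{r\mathcal L(s)}X\|_1\le\|X\|_1$ for all $r\ge0$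 and all $X$; and $\mathcal L^{(j)}(1)=0$ for $j=1,\dots,k$. Furthermore there is a constant $C_k$, independent of $\tau$, such that for every $\tau>0$, if $\sigma_\tau(t)$ is the steady state of $\mathcal L_\tau(t)$ and $\rho_\tau$ solves $\partial_t\rho_\tau(t)=\mathcal L_\tau(t)\rho_\tau(t)$ on $[0,\tau]$ with $\rho_\tau(0)=\sigma_\tau(0)$, then $$\|\rho_\tau(\tau)-\sigma_\tau(\tau)\|_1\le\frac{C_k}{\tau^{k+1}},$$ where $\|X\|_1=\mathrm{Tr}\sqrt{X^\dagger X}$. -/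

import Mathlib

open MeasureTheory Filter Topology Set
open scoped Matrix ComplexOrder
/- A norm on matrices (the operator norm of `ℂⁿ`), used only for its topology: differentiability and
exponentials. The estimates are stated in the trace norm, `traceNorm`. -/
open scoped Matrix.Norms.L2Operator

namespace Davies

noncomputable section

/-! ### Trace norm and steady states -/

section Superoperators

variable {n : Type*} [Fintype n] [DecidableEq n]

/-- The trace norm `Tr √(Xᴴ X)`, i.e. the sum of the square roots of the eigenvalues of `Xᴴ X`. -/
def traceNorm (X : Matrix n n ℂ) : ℝ :=
  ∑ i, Real.sqrt ((Matrix.isHermitian_conjTranspose_mul_self X).eigenvalues i)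

/-- `σ` is a steady state of `L`: a density matrix annihilated by `L`. -/
def IsSteadyState (L : Matrix n n ℂ →L[ℂ] Matrix n n ℂ) (σ : Matrix n n ℂ) : Prop :=
  σ.PosSemidef ∧ σ.trace = 1 ∧ L σ = 0

/-- The hypotheses of the boundary cancellation theorem of order `k` for a family of generators
`L s`, where `s = t / τ ∈ [0, 1]` is the rescaled time. (A family that does not depend on `τ`;
derivatives at the end points of `[0, 1]` are one-sided.) -/
structure BoundaryCancellationHypotheses (k : ℕ)
    (L : ℝ → (Matrix n n ℂ →L[ℂ] Matrix n n ℂ)) : Prop where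
  /-- `L` is `k + 2` times continuously differentiable. -/
  contDiff : ContDiffOn ℝ ((k + 2 : ℕ) : ℕ∞) L (Icc 0 1)
  /-- Each `L s` generates a trace preserving evolution. -/
  trace_preserving : ∀ s ∈ Icc (0 : ℝ) 1, ∀ X, (L s X).trace = 0
  /-- Each `L s` preserves hermiticity. -/
  hermitian_preserving : ∀ s ∈ Icc (0 : ℝ) 1, ∀ X, L s Xᴴ = (L s X)ᴴ
  /-- The eigenvalue `0` is separated from the rest of the spectrum, uniformly in `s`. -/
  gap : ∃ Δ : ℝ, 0 < Δ ∧ ∀ s ∈ Icc (0 : ℝ) 1, ∀ z ∈ spectrum ℂ (L s), z ≠ 0 → Δ ≤ ‖z‖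
  /-- Unique steady state: the solution of `L s σ = 0`, `Tr σ = 1` is unique. -/
  unique_steady : ∀ s ∈ Icc (0 : ℝ) 1, ∃! σ : Matrix n n ℂ, L s σ = 0 ∧ σ.trace = 1
  /-- Each `L s` generates a contraction semigroup for the trace norm. -/
  contraction : ∀ s ∈ Icc (0 : ℝ) 1, ∀ r : ℝ, 0 ≤ r → ∀ X,
    traceNorm (NormedSpace.exp (r • L s) X) ≤ traceNorm X
  /-- The derivatives of orders `1, …, k` vanish at the final time. -/
  deriv_eq_zero : ∀ j : ℕ, 1 ≤ j → j ≤ k → iteratedDerivWithin j L (Icc 0 1) 1 = 0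

end Superoperators

/-! ### The bath -/

/-- A bath in a stationary state: a `*`-algebra `𝒜` of bath observables (for example, operators on
a bath Hilbert space) with a state `⟨·⟩`, a one-parameter group of `*`-automorphisms as Heisenberg
dynamics (for example, `b ↦ exp (i t H_B) b exp (-i t H_B)`) that leaves the state invariant,
and self-adjoint coupling operators `B α`. -/
structure Bath (ι 𝒜 : Type*) [Ring 𝒜] [StarRing 𝒜] [Algebra ℂ 𝒜] where
  /-- The state `⟨·⟩` -/
  state : 𝒜 →ₗ[ℂ] ℂ
  state_one : state 1 = 1
  state_nonneg : ∀ a, 0 ≤ state (star a * a)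
  /-- The Heisenberg time evolution -/
  evol : ℝ → 𝒜 ≃⋆ₐ[ℂ] 𝒜
  evol_add : ∀ s t a, evol (s + t) a = evol s (evol t a)
  state_evol : ∀ t a, state (evol t a) = state a
  /-- The coupling operators -/
  B : ι → 𝒜
  isSelfAdjoint_B : ∀ α, IsSelfAdjoint (B α)

namespace Bath

variable {ι 𝒜 : Type*} [Ring 𝒜] [StarRing 𝒜] [Algebra ℂ 𝒜] (bath : Bath ι 𝒜) (g : ℝ)

/-- The bath correlation function `G_{αβ}(t, s) = g² ⟨B_α(t) B_β(s)⟩`. -/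
def corr₂ (α β : ι) (t s : ℝ) : ℂ :=
  (g : ℂ) ^ 2 * bath.state (bath.evol t (bath.B α) * bath.evol s (bath.B β))

/-- The bath correlation function as a function of the time difference, `G_{αβ}(t)`. -/
def corr (α β : ι) (t : ℝ) : ℂ := bath.corr₂ g α β t 0

/-- By stationarity `G_{αβ}(t, s) = G_{αβ}(t - s)`. -/
theorem corr₂_eq_corr (α β : ι) (t s : ℝ) : bath.corr₂ g α β t s = bath.corr g α β (t - s) := by
  have h1 := bath.state_evol s (bath.evol (t - s) (bath.B α) * bath.evol 0 (bath.B β))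
  rw [map_mul, ← bath.evol_add, ← bath.evol_add, add_sub_cancel, add_zero] at h1
  simp only [corr, corr₂, h1]

/-- The rates `γ_{αβ}(ω) = ∫ exp(i ω t) G_{αβ}(t) dt`. -/
def rate (α β : ι) (ω : ℝ) : ℂ :=
  ∫ t : ℝ, Complex.exp (Complex.I * ω * t) * bath.corr g α β t

/-- `S_{αβ}(ω) = ∫ γ_{αβ}(ω') P(1 / (ω - ω')) dω'`, with `P` the Cauchy principal value. -/
def lambCoeff (α β : ι) (ω : ℝ) : ℂ :=
  limUnder (𝓝[>] (0 : ℝ)) fun ε : ℝ =>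
    ∫ ω' in {x : ℝ | ε < |ω - x|}, bath.rate g α β ω' * ((1 / (ω - ω') : ℝ) : ℂ)

/-- The regularity of the bath that makes the rates well defined functions of the frequency,
smooth except possibly at zero frequency. -/
structure Regular : Prop where
  continuous_corr : ∀ α β, Continuous (bath.corr g α β)
  integrable_corr : ∀ α β, Integrable (bath.corr g α β)
  contDiffOn_rate : ∀ α β, ContDiffOn ℝ (⊤ : ℕ∞) (bath.rate g α β) {0}ᶜ

end Bath

/-! ### Levels, Bohr frequencies, jump operators -/

section System

variable {n : Type*} [Fintype n] [DecidableEq n] {H : Matrix n n ℂ}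

/-- The (distinct) energy levels of the Hamiltonian `H`. -/
def levels (hH : H.IsHermitian) : Finset ℝ := Finset.univ.image hH.eigenvalues

/-- The spectral projection of `H` on the level `E` (zero if `E` is not a level). -/
def energyProj (hH : H.IsHermitian) (E : ℝ) : Matrix n n ℂ :=
  (hH.eigenvectorUnitary : Matrix n n ℂ) *
    Matrix.diagonal (fun i => if hH.eigenvalues i = E then (1 : ℂ) else 0) *
    (hH.eigenvectorUnitary : Matrix n n ℂ)ᴴ

/-- The (distinct) Bohr frequencies of `H`: the differences of its levels. -/
def bohrFreqs (hH : H.IsHermitian) : Finset ℝ :=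
  (levels hH ×ˢ levels hH).image fun p => p.2 - p.1

/-- The jump operator `A(ω) = ∑_{E' - E = ω} Π_E A Π_{E'}`, which is the component of frequency `ω`
of `exp(i t H) A exp(-i t H)`; see `exp_mul_mul_exp_eq_sum`. -/
def jumpOp (H : Matrix n n ℂ) (hH : H.IsHermitian) (A : Matrix n n ℂ) (ω : ℝ) : Matrix n n ℂ :=
  ∑ p ∈ levels hH ×ˢ levels hH with p.2 - p.1 = ω, energyProj hH p.1 * A * energyProj hH p.2

/-- `energy H hH i` is the `i`-th eigenvalue of `H` in decreasing order, with multiplicity. -/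
def energy (H : Matrix n n ℂ) (hH : H.IsHermitian) (i : Fin (Fintype.card n)) : ℝ := hH.eigenvalues₀ i

/-- The Bohr frequency `E_j - E_i`. -/
def bohr (H : Matrix n n ℂ) (hH : H.IsHermitian) (i j : Fin (Fintype.card n)) : ℝ := energy H hH j - energy H hH i

theorem exp_eq_sum (hH : H.IsHermitian) (z : ℂ) :
    NormedSpace.exp (z • H) = ∑ E ∈ levels hH, Complex.exp (z * E) • energyProj hH E := by
  set U : Matrix n n ℂ := (hH.eigenvectorUnitary : Matrix n n ℂ) with hU
  have hUU : U * Uᴴ = 1 := Unitary.coe_mul_star_self hH.eigenvectorUnitary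
  have hinv : U⁻¹ = Uᴴ := Matrix.inv_eq_right_inv hUU
  have hunit : IsUnit U := IsUnit.of_mul_eq_one _ hUU
  have hspec : H = U * Matrix.diagonal (fun i => (hH.eigenvalues i : ℂ)) * Uᴴ := by
    conv_lhs => rw [hH.spectral_theorem, Unitary.conjStarAlgAut_apply]
    rfl
  have hz : z • H = U * Matrix.diagonal (fun i => z * (hH.eigenvalues i : ℂ)) * U⁻¹ := by
    conv_lhs => rw [hspec]
    rw [hinv, ← Matrix.smul_mul, ← Matrix.mul_smul, ← Matrix.diagonal_smul]
    rfl
  rw [hz, Matrix.exp_conj _ _ hunit, Matrix.exp_diagonal, hinv]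
  simp only [energyProj, ← hU]
  have hterm : ∀ E : ℝ, Complex.exp (z * E) •
      (U * Matrix.diagonal (fun i => if hH.eigenvalues i = E then (1 : ℂ) else 0) * Uᴴ) =
      U * (Complex.exp (z * E) •
        Matrix.diagonal (fun i => if hH.eigenvalues i = E then (1 : ℂ) else 0)) * Uᴴ := fun E => by
    rw [Matrix.mul_smul, Matrix.smul_mul]
  simp only [hterm]
  rw [← Finset.sum_mul, ← Finset.mul_sum]
  congr 2
  ext i j
  rw [Matrix.sum_apply]
  by_cases hij : i = j
  · subst hij
    simp [levels, Complex.exp_eq_exp_ℂ, Pi.coe_exp]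
  · simp [Matrix.diagonal_apply_ne _ hij]

/-- The defining relation of the jump operators,
`exp(i t H) A exp(-i t H) = ∑_ω exp(-i t ω) A(ω)`. -/
theorem exp_mul_mul_exp_eq_sum (hH : H.IsHermitian) (A : Matrix n n ℂ) (t : ℝ) :
    NormedSpace.exp ((Complex.I * t) • H) * A * NormedSpace.exp ((-(Complex.I * t)) • H) =
      ∑ ω ∈ bohrFreqs hH, Complex.exp (-(Complex.I * t * ω)) • jumpOp H hH A ω := by
  have hr : ∑ ω ∈ bohrFreqs hH, Complex.exp (-(Complex.I * t * ω)) • jumpOp H hH A ω =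
      ∑ ω ∈ bohrFreqs hH, ∑ p ∈ levels hH ×ˢ levels hH with p.2 - p.1 = ω,
        Complex.exp (-(Complex.I * t * ((p.2 - p.1 : ℝ) : ℂ))) •
          (energyProj hH p.1 * A * energyProj hH p.2) := by
    refine Finset.sum_congr rfl fun ω _ => ?_
    rw [jumpOp, Finset.smul_sum]
    refine Finset.sum_congr rfl fun p hp => ?_
    rw [(Finset.mem_filter.1 hp).2]
  rw [hr, bohrFreqs, Finset.sum_fiberwise_of_maps_to
    (fun p hp => Finset.mem_image_of_mem _ hp), Finset.sum_product,
    exp_eq_sum hH, exp_eq_sum hH, Finset.sum_mul, Finset.sum_mul]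
  refine Finset.sum_congr rfl fun E _ => ?_
  rw [Finset.mul_sum]
  refine Finset.sum_congr rfl fun E' _ => ?_
  rw [Matrix.smul_mul, Matrix.smul_mul, Matrix.mul_smul, smul_smul, ← Complex.exp_add]
  congr 2
  push_cast
  ring

end System

/-! ### The generator -/

section Generator

variable {n ι 𝒜 : Type*} [Fintype n] [DecidableEq n] [Fintype ι]
  [Ring 𝒜] [StarRing 𝒜] [Algebra ℂ 𝒜] (bath : Bath ι 𝒜) (g : ℝ) (A : ι → Matrix n n ℂ)

/-- The superoperator `-i [K, •]`. -/
def hamiltonianPart (K : Matrix n n ℂ) : Matrix n n ℂ →ₗ[ℂ] Matrix n n ℂ :=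
  (-Complex.I) • (LinearMap.mulLeft ℂ K - LinearMap.mulRight ℂ K)

/-- The superoperator `X • Yᴴ - 1/2 {Yᴴ X, •}`. -/
def dissipatorPart (X Y : Matrix n n ℂ) : Matrix n n ℂ →ₗ[ℂ] Matrix n n ℂ :=
  LinearMap.mulLeft ℂ X ∘ₗ LinearMap.mulRight ℂ Yᴴ -
    (1 / 2 : ℂ) • (LinearMap.mulLeft ℂ (Yᴴ * X) + LinearMap.mulRight ℂ (Yᴴ * X))

/-- The Lamb shift `H_LS = ∑_{α, β, ω} S_{αβ}(ω) A_α(ω)ᴴ A_β(ω)`. -/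
def lambShift (H : Matrix n n ℂ) (hH : H.IsHermitian) : Matrix n n ℂ :=
  ∑ α, ∑ β, ∑ ω ∈ bohrFreqs hH,
    bath.lambCoeff g α β ω • ((jumpOp H hH (A α) ω)ᴴ * jumpOp H hH (A β) ω)

/-- The dissipative part of the Davies generator. -/
def dissipator (H : Matrix n n ℂ) (hH : H.IsHermitian) : Matrix n n ℂ →ₗ[ℂ] Matrix n n ℂ :=
  ∑ α, ∑ β, ∑ ω ∈ bohrFreqs hH,
    bath.rate g α β ω • dissipatorPart (jumpOp H hH (A β) ω) (jumpOp H hH (A α) ω)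

/-- The Davies generator `-i [H + H_LS, •] + dissipator` of the system Hamiltonian `H`. -/
def generator (H : Matrix n n ℂ) (hH : H.IsHermitian) : Matrix n n ℂ →L[ℂ] Matrix n n ℂ :=
  LinearMap.toContinuousLinearMap
    (hamiltonianPart (H + lambShift bath g A H hH) + dissipator bath g A H hH)

end Generator

/-! ### Degeneracies -/

section Degeneracy

variable {n : Type*} [Fintype n] [DecidableEq n] {h : ℝ → Matrix n n ℂ}

/-- The degeneracies of the levels of `h s` do not change for `s ∈ [0, 1]`: which of the ordered
eigenvalues coincide does not depend on `s`. -/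
def ConstantLevelDegeneracy (hh : ∀ s, (h s).IsHermitian) : Prop :=
  ∀ s ∈ Icc (0 : ℝ) 1, ∀ i j,
    energy (h s) (hh s) i = energy (h s) (hh s) j ↔ energy (h 0) (hh 0) i = energy (h 0) (hh 0) j

/-- The degeneracies of the Bohr frequencies of `h s` do not change for `s ∈ [0, 1]`: which of the
differences of ordered eigenvalues coincide does not depend on `s`. -/
def ConstantBohrDegeneracy (hh : ∀ s, (h s).IsHermitian) : Prop :=
  ∀ s ∈ Icc (0 : ℝ) 1, ∀ i j i' j',
    bohr (h s) (hh s) i j = bohr (h s) (hh s) i' j' ↔ bohr (h 0) (hh 0) i j = bohr (h 0) (hh 0) i' j'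

end Degeneracy

end

end Davies

/-! The error estimate is an adiabatic expansion. On traceless matrices `L s` is invertible, so with
`c₀ = σ` and `c_{m+1} = L⁻¹ c_m'` (`adiabaticCoeff`) the series `∑_{m ≤ k} τ⁻ᵐ c_m(t/τ)` solves the
evolution equation up to a source of size `τ^{-(k+1)}`. Each coefficient costs one order of the
flatness of `L` at `1`, so `c_1, …, c_k` vanish at the final time (`smoothFlat_adiabaticCoeff`),
where the series is exactly the steady state. At the initial time they need not vanish, but that
mismatch is traceless and dissipation forgets it exponentially fast in `τ`. Dissipation also keeps
the accumulated source of order `τ^{-(k+1)}` instead of letting it grow with the length of the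
interval (`traceNorm_le_decay`, `boundary_cancellation`).

Invertibility and decay follow from uniqueness of the steady state, which need not be faithful.
Correlation functions are of positive type, so the matrix of rates is positive semidefinite
(`Bath.posSemidef_rate`) and the Davies generator has Lindblad form (`isLindblad_generator`);
Lindblad generators contract the trace norm. An eigenvector of the adjoint generator with imaginary
eigenvalue is then a multiple of the identity (`exists_eq_smul_one_of_dual_eigen`), which rules out
imaginary eigenvalues, zero included, on traceless matrices. Compactness of `[0, 1]` makes gap and
decay uniform.

Constant degeneracies make the spectral data smooth. The distinct levels never meet, and their power
sums weighted by multiplicity are the smooth functions `Tr h^p`; the inverse function theorem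
recovers the levels (`contDiffOn_of_powerSums`). Spectral projections are Lagrange polynomials in
`h`. A Bohr frequency is identically zero or never zero, so only smoothness away from zero is needed
from the rates and from the Lamb coefficients. For the latter (`Bath.contDiffAt_lambCoeff`) the rate
is cut near the frequency: the local part gives a convolution with a logarithm, the rest a Cauchy
transform off its support. Vanishing derivatives are carried along as `f s - f 1 = o((s - 1)^k)`,
which passes through smooth maps with no formula for higher derivatives. -/

namespace Davies

set_option linter.unusedSectionVars false

/-! ### Trace norm: duality with the operator norm -/

section TraceNorm

variable {n : Type*} [Fintype n] [DecidableEq n]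

theorem norm_toLp_sq (x : n → ℂ) : ((‖WithLp.toLp 2 x‖ ^ 2 : ℝ) : ℂ) = star x ⬝ᵥ x := by
  rw [EuclideanSpace.norm_sq_eq]
  simp only [dotProduct, Pi.star_apply, RCLike.star_def, Complex.conj_mul']
  push_cast
  rfl

theorem norm_star_dotProduct_le (x y : n → ℂ) :
    ‖star x ⬝ᵥ y‖ ≤ ‖WithLp.toLp 2 x‖ * ‖WithLp.toLp 2 y‖ := by
  have := norm_inner_le_norm (𝕜 := ℂ) (WithLp.toLp 2 x) (WithLp.toLp 2 y)
  rwa [EuclideanSpace.inner_toLp_toLp, dotProduct_comm] at this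

theorem norm_star_dotProduct_mulVec_le (U : Matrix n n ℂ) (x y : n → ℂ) :
    ‖star x ⬝ᵥ (U *ᵥ y)‖ ≤ ‖U‖ * ‖WithLp.toLp 2 x‖ * ‖WithLp.toLp 2 y‖ := by
  refine (norm_star_dotProduct_le _ _).trans ?_
  have := Matrix.l2_opNorm_mulVec U (WithLp.toLp 2 y)
  calc _ ≤ ‖WithLp.toLp 2 x‖ * (‖U‖ * ‖WithLp.toLp 2 y‖) := by gcongr; exact this
    _ = _ := by ring

/-- Diagonalization of a Hermitian matrix. -/
theorem exists_unitary_diagonal {X : Matrix n n ℂ} (hX : X.IsHermitian) :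
    ∃ V : Matrix n n ℂ, Vᴴ * V = 1 ∧ V * Vᴴ = 1 ∧
      X = V * Matrix.diagonal (fun i => (hX.eigenvalues i : ℂ)) * Vᴴ ∧
      Vᴴ * X * V = Matrix.diagonal (fun i => (hX.eigenvalues i : ℂ)) := by
  have h1 : (hX.eigenvectorUnitary : Matrix n n ℂ)ᴴ * hX.eigenvectorUnitary = 1 :=
    Unitary.coe_star_mul_self _
  have h3 : X = hX.eigenvectorUnitary * Matrix.diagonal (fun i => (hX.eigenvalues i : ℂ)) *
      (hX.eigenvectorUnitary : Matrix n n ℂ)ᴴ := by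
    conv_lhs => rw [hX.spectral_theorem, Unitary.conjStarAlgAut_apply]
    rfl
  refine ⟨hX.eigenvectorUnitary, h1, Unitary.coe_mul_star_self _, h3, ?_⟩
  have key : ∀ V D : Matrix n n ℂ, Vᴴ * V = 1 → X = V * D * Vᴴ → Vᴴ * X * V = D := by
    rintro V D h1' rfl
    rw [Matrix.mul_assoc, Matrix.mul_assoc, Matrix.mul_assoc, h1', Matrix.mul_one,
      ← Matrix.mul_assoc, h1', Matrix.one_mul]
  exact key _ _ h1 h3

theorem norm_unitary_conj_le {V : Matrix n n ℂ} (h1 : Vᴴ * V = 1) (Z : Matrix n n ℂ) :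
    ‖V * Z * Vᴴ‖ ≤ ‖Z‖ := by
  rcases isEmpty_or_nonempty n with hn | hn
  · rw [Subsingleton.elim (V * Z * Vᴴ) 0, norm_zero]; exact norm_nonneg _
  have hV1 : ‖V‖ = 1 := by
    have h := Matrix.l2_opNorm_conjTranspose_mul_self V
    rw [h1, norm_one] at h
    nlinarith [norm_nonneg V]
  calc ‖V * Z * Vᴴ‖ ≤ ‖V‖ * ‖Z‖ * ‖Vᴴ‖ := (norm_mul_le _ _).trans (by gcongr; exact norm_mul_le _ _)
    _ = ‖Z‖ := by rw [Matrix.l2_opNorm_conjTranspose, hV1]; ring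

/-- `|Tr (U X)| ≤ ‖U‖ ‖X‖₁`. -/
theorem norm_trace_mul_le (U X : Matrix n n ℂ) : ‖(U * X).trace‖ ≤ ‖U‖ * traceNorm X := by
  obtain ⟨V, h1, h2, h3, h3'⟩ := exists_unitary_diagonal (Matrix.isHermitian_conjTranspose_mul_self X)
  have h4 : (U * X).trace = (Vᴴ * (U * (X * V))).trace := by
    rw [Matrix.trace_mul_comm Vᴴ, Matrix.mul_assoc, Matrix.mul_assoc, h2, Matrix.mul_one]
  have h5 : ∀ i, (Vᴴ * (U * (X * V))) i i = star (V.col i) ⬝ᵥ (U *ᵥ (X * V).col i) := fun i => rfl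
  have h6 : ∀ i, ‖WithLp.toLp 2 (V.col i)‖ = 1 := fun i => by
    have h := norm_toLp_sq (V.col i)
    have h' : star (V.col i) ⬝ᵥ V.col i = (Vᴴ * V) i i := rfl
    rw [h', h1, Matrix.one_apply_eq] at h
    have h'' : ‖WithLp.toLp 2 (V.col i)‖ ^ 2 = 1 := by exact_mod_cast h
    nlinarith [norm_nonneg (WithLp.toLp 2 (V.col i))]
  have h7 : ∀ i, ‖WithLp.toLp 2 ((X * V).col i)‖ =
      Real.sqrt ((Matrix.isHermitian_conjTranspose_mul_self X).eigenvalues i) := fun i => by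
    have h := norm_toLp_sq ((X * V).col i)
    have h' : star ((X * V).col i) ⬝ᵥ (X * V).col i = ((X * V)ᴴ * (X * V)) i i := rfl
    have h'' : (X * V)ᴴ * (X * V) =
        Matrix.diagonal (fun i => ((Matrix.isHermitian_conjTranspose_mul_self X).eigenvalues i : ℂ)) := by
      rw [← h3', Matrix.conjTranspose_mul]
      simp only [Matrix.mul_assoc]
    rw [h', h'', Matrix.diagonal_apply_eq] at h
    rw [← (by exact_mod_cast h : _ ^ 2 = (Matrix.isHermitian_conjTranspose_mul_self X).eigenvalues i),
      Real.sqrt_sq (norm_nonneg _)]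
  rw [h4, Matrix.trace, traceNorm, Finset.mul_sum]
  refine (norm_sum_le _ _).trans (Finset.sum_le_sum fun i _ => ?_)
  rw [Matrix.diag_apply, h5, ← h7]
  simpa [h6] using norm_star_dotProduct_mulVec_le U (V.col i) ((X * V).col i)

/-- The trace norm is attained: `‖X‖₁ = Tr (U X)` for a contraction `U`. -/
theorem exists_trace_mul_eq_traceNorm (X : Matrix n n ℂ) :
    ∃ U : Matrix n n ℂ, ‖U‖ ≤ 1 ∧ (U * X).trace = traceNorm X := by
  have hX := Matrix.isHermitian_conjTranspose_mul_self X
  obtain ⟨V, h1, h2, h3, h3'⟩ := exists_unitary_diagonal hX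
  have hnn : ∀ i, 0 ≤ hX.eigenvalues i :=
    (Matrix.posSemidef_conjTranspose_mul_self X).eigenvalues_nonneg
  -- Since `0⁻¹ = 0`, `r` vanishes on the kernel of `Xᴴ X`. Thus `U = |X|⁻¹ Xᴴ`, with this
  -- generalized inverse, is the adjoint of the partial isometry in the polar decomposition of `X`.
  set r : n → ℝ := fun i => (Real.sqrt (hX.eigenvalues i))⁻¹ with hr
  set D : Matrix n n ℂ := Matrix.diagonal (fun i => (r i : ℂ)) with hD
  have hDD : Dᴴ = D := by
    rw [hD, Matrix.diagonal_conjTranspose]; congr 1; ext i; simp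
  refine ⟨V * D * Vᴴ * Xᴴ, ?_, ?_⟩
  · have h4 : (V * D * Vᴴ * Xᴴ) * (V * D * Vᴴ * Xᴴ)ᴴ =
        V * Matrix.diagonal (fun i => (r i : ℂ) * hX.eigenvalues i * r i) * Vᴴ := by
      simp only [Matrix.conjTranspose_mul, Matrix.conjTranspose_conjTranspose, hDD]
      have : V * D * Vᴴ * Xᴴ * (X * (V * (D * Vᴴ))) = V * (D * (Vᴴ * (Xᴴ * X) * V) * D) * Vᴴ := by
        simp only [Matrix.mul_assoc]
      rw [this, h3', hD, Matrix.diagonal_mul_diagonal, Matrix.diagonal_mul_diagonal]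
    have h5 : ‖(V * D * Vᴴ * Xᴴ) * (V * D * Vᴴ * Xᴴ)ᴴ‖ ≤ 1 := by
      rw [h4]
      refine (norm_unitary_conj_le h1 _).trans ?_
      rw [Matrix.l2_opNorm_diagonal, pi_norm_le_iff_of_nonneg zero_le_one]
      intro i
      have : (r i : ℂ) * hX.eigenvalues i * r i = ((r i * hX.eigenvalues i * r i : ℝ) : ℂ) := by
        push_cast; rfl
      rw [this, Complex.norm_real, Real.norm_eq_abs, hr]
      rcases (hnn i).eq_or_lt with h0 | h0
      · simp [← h0]
      · have hs := Real.sqrt_pos.2 h0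
        have : (√(hX.eigenvalues i))⁻¹ * hX.eigenvalues i * (√(hX.eigenvalues i))⁻¹ = 1 := by
          nth_rw 2 [← Real.mul_self_sqrt (hnn i)]
          field_simp
        simp only [this, abs_one, le_refl]
    have h6 := Matrix.l2_opNorm_conjTranspose_mul_self (V * D * Vᴴ * Xᴴ)ᴴ
    rw [Matrix.conjTranspose_conjTranspose, Matrix.l2_opNorm_conjTranspose] at h6
    rw [h6] at h5
    nlinarith [norm_nonneg (V * D * Vᴴ * Xᴴ)]
  · have h4 : (V * D * Vᴴ * Xᴴ * X).trace = (D * (Vᴴ * (Xᴴ * X) * V)).trace := by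
      rw [show V * D * Vᴴ * Xᴴ * X = V * (D * Vᴴ * Xᴴ * X) by simp only [Matrix.mul_assoc],
        Matrix.trace_mul_comm]
      simp only [Matrix.mul_assoc]
    rw [h4, h3', hD, Matrix.diagonal_mul_diagonal, Matrix.trace_diagonal, traceNorm]
    push_cast
    refine Finset.sum_congr rfl fun i _ => ?_
    rw [← Complex.ofReal_mul]
    congr 1
    rcases (hnn i).eq_or_lt with h0 | h0
    · simp [hr, ← h0]
    · have hs := Real.sqrt_pos.2 h0
      simp only [hr]
      nth_rw 2 [← Real.mul_self_sqrt (hnn i)]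
      field_simp

theorem traceNorm_nonneg (X : Matrix n n ℂ) : 0 ≤ traceNorm X :=
  Finset.sum_nonneg fun _ _ => Real.sqrt_nonneg _

/-- A bound on the trace norm by duality. -/
theorem traceNorm_le_of_forall {X : Matrix n n ℂ} {c : ℝ}
    (h : ∀ U : Matrix n n ℂ, ‖U‖ ≤ 1 → ‖(U * X).trace‖ ≤ c) : traceNorm X ≤ c := by
  obtain ⟨U, hU, hUX⟩ := exists_trace_mul_eq_traceNorm X
  have := h U hU
  rwa [hUX, Complex.norm_real, Real.norm_of_nonneg (traceNorm_nonneg X)] at this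

theorem norm_trace_mul_le_of_le_one {U : Matrix n n ℂ} (hU : ‖U‖ ≤ 1) (X : Matrix n n ℂ) :
    ‖(U * X).trace‖ ≤ traceNorm X :=
  (norm_trace_mul_le U X).trans (mul_le_of_le_one_left (traceNorm_nonneg X) hU)

theorem traceNorm_add_le (X Y : Matrix n n ℂ) : traceNorm (X + Y) ≤ traceNorm X + traceNorm Y := by
  refine traceNorm_le_of_forall fun U hU => ?_
  rw [Matrix.mul_add, Matrix.trace_add]
  exact (norm_add_le _ _).trans
    (add_le_add (norm_trace_mul_le_of_le_one hU X) (norm_trace_mul_le_of_le_one hU Y))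

theorem traceNorm_smul_le (c : ℂ) (X : Matrix n n ℂ) : traceNorm (c • X) ≤ ‖c‖ * traceNorm X := by
  refine traceNorm_le_of_forall fun U hU => ?_
  rw [Matrix.mul_smul, Matrix.trace_smul, norm_smul]
  gcongr
  exact norm_trace_mul_le_of_le_one hU X

theorem traceNorm_smul (c : ℂ) (X : Matrix n n ℂ) : traceNorm (c • X) = ‖c‖ * traceNorm X := by
  refine le_antisymm (traceNorm_smul_le c X) ?_
  rcases eq_or_ne c 0 with rfl | hc
  · simpa using traceNorm_nonneg _
  have := traceNorm_smul_le c⁻¹ (c • X)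
  rw [smul_smul, inv_mul_cancel₀ hc, one_smul, norm_inv] at this
  have hc' : 0 < ‖c‖ := norm_pos_iff.2 hc
  calc ‖c‖ * traceNorm X ≤ ‖c‖ * (‖c‖⁻¹ * traceNorm (c • X)) := by gcongr
    _ = traceNorm (c • X) := by field_simp

@[simp] theorem traceNorm_zero : traceNorm (0 : Matrix n n ℂ) = 0 := by
  simpa using traceNorm_smul 0 (0 : Matrix n n ℂ)

theorem traceNorm_neg (X : Matrix n n ℂ) : traceNorm (-X) = traceNorm X := by
  simpa using traceNorm_smul (-1) X

theorem traceNorm_sub_le (X Y : Matrix n n ℂ) : traceNorm (X - Y) ≤ traceNorm X + traceNorm Y := by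
  rw [sub_eq_add_neg, ← traceNorm_neg Y]
  exact traceNorm_add_le _ _

theorem traceNorm_sum_le {κ : Type*} (s : Finset κ) (f : κ → Matrix n n ℂ) :
    traceNorm (∑ i ∈ s, f i) ≤ ∑ i ∈ s, traceNorm (f i) :=
  Finset.le_sum_of_subadditive _ traceNorm_zero.le traceNorm_add_le _ _

theorem norm_entry_le (X : Matrix n n ℂ) (i j : n) : ‖X i j‖ ≤ ‖X‖ := by
  have h := norm_star_dotProduct_mulVec_le X (Pi.single i 1) (Pi.single j 1)
  simpa [Matrix.mulVec_single_one] using h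

theorem norm_trace_le (X : Matrix n n ℂ) : ‖X.trace‖ ≤ Fintype.card n * ‖X‖ := by
  refine (norm_sum_le _ _).trans ((Finset.sum_le_sum fun i _ => norm_entry_le X i i).trans ?_)
  simp

theorem traceNorm_le_norm (X : Matrix n n ℂ) : traceNorm X ≤ Fintype.card n * ‖X‖ := by
  refine traceNorm_le_of_forall fun U hU => (norm_trace_le _).trans ?_
  gcongr
  exact (norm_mul_le _ _).trans (mul_le_of_le_one_left (norm_nonneg _) hU)

/-- The operator norm is dominated by the trace norm. -/
theorem norm_le_traceNorm (X : Matrix n n ℂ) : ‖X‖ ≤ traceNorm X := by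
  have hX := Matrix.isHermitian_conjTranspose_mul_self X
  obtain ⟨V, h1, h2, h3, h3'⟩ := exists_unitary_diagonal hX
  have hnn : ∀ i, 0 ≤ hX.eigenvalues i :=
    (Matrix.posSemidef_conjTranspose_mul_self X).eigenvalues_nonneg
  have h4 : ‖Xᴴ * X‖ ≤ traceNorm X ^ 2 := by
    have h := norm_unitary_conj_le h1 (Matrix.diagonal (fun i => (hX.eigenvalues i : ℂ)))
    rw [← h3] at h
    refine h.trans ?_
    rw [Matrix.l2_opNorm_diagonal, pi_norm_le_iff_of_nonneg (sq_nonneg _)]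
    intro i
    rw [Complex.norm_real, Real.norm_of_nonneg (hnn i), ← Real.sq_sqrt (hnn i)]
    gcongr
    exact Finset.single_le_sum (f := fun i => Real.sqrt (hX.eigenvalues i))
      (fun j _ => Real.sqrt_nonneg _) (Finset.mem_univ i)
  rw [Matrix.l2_opNorm_conjTranspose_mul_self, ← sq] at h4
  exact (pow_le_pow_iff_left₀ (norm_nonneg _) (traceNorm_nonneg X) two_ne_zero).1 h4

theorem abs_traceNorm_sub_le (X Y : Matrix n n ℂ) :
    |traceNorm X - traceNorm Y| ≤ traceNorm (X - Y) := by
  have h1 := traceNorm_add_le (X - Y) Y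
  have h2 := traceNorm_add_le (Y - X) X
  rw [sub_add_cancel] at h1 h2
  rw [← neg_sub X Y, traceNorm_neg] at h2
  exact abs_sub_le_iff.2 ⟨by linarith, by linarith⟩

theorem continuous_traceNorm : Continuous (traceNorm : Matrix n n ℂ → ℝ) := by
  refine (LipschitzWith.of_dist_le_mul (K := Fintype.card n) fun X Y => ?_).continuous
  rw [Real.dist_eq, dist_eq_norm]
  exact (abs_traceNorm_sub_le X Y).trans (traceNorm_le_norm _)

theorem norm_one_le : ‖(1 : Matrix n n ℂ)‖ ≤ 1 := by
  rw [← Matrix.diagonal_one, Matrix.l2_opNorm_diagonal, pi_norm_le_iff_of_nonneg zero_le_one]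
  simp

/-- For a Hermitian matrix, the trace norm is the sum of the absolute values of the eigenvalues. -/
theorem traceNorm_eq_sum_abs {X : Matrix n n ℂ} (hX : X.IsHermitian) :
    traceNorm X = ∑ i, |hX.eigenvalues i| := by
  obtain ⟨V, h1, h2, h3, h3'⟩ := exists_unitary_diagonal hX
  refine le_antisymm (traceNorm_le_of_forall fun U hU => ?_) ?_
  · have h4 : (U * X).trace =
        ((Vᴴ * U * V) * Matrix.diagonal (fun i => (hX.eigenvalues i : ℂ))).trace := by
      rw [← h3', show Vᴴ * U * V * (Vᴴ * X * V) = Vᴴ * U * (V * Vᴴ) * X * V by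
        simp only [Matrix.mul_assoc], h2, Matrix.mul_one, Matrix.trace_mul_comm (Vᴴ * U * X),
        ← Matrix.mul_assoc, ← Matrix.mul_assoc, h2, Matrix.one_mul]
    have h5 : ‖Vᴴ * U * V‖ ≤ 1 := by
      have h := norm_unitary_conj_le (V := Vᴴ) (by rwa [Matrix.conjTranspose_conjTranspose]) U
      rw [Matrix.conjTranspose_conjTranspose] at h
      exact h.trans hU
    rw [h4, Matrix.trace]
    refine (norm_sum_le _ _).trans (Finset.sum_le_sum fun i _ => ?_)
    rw [Matrix.diag_apply, Matrix.mul_diagonal, norm_mul, Complex.norm_real, Real.norm_eq_abs]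
    exact mul_le_of_le_one_left (abs_nonneg _) ((norm_entry_le _ _ _).trans h5)
  -- The lower bound tests duality against the sign of `X`, a contraction.
  · set s : n → ℂ := fun i => ((SignType.sign (hX.eigenvalues i) : ℝ) : ℂ) with hs
    have h5 : ‖V * Matrix.diagonal s * Vᴴ‖ ≤ 1 := by
      refine (norm_unitary_conj_le h1 _).trans ?_
      rw [Matrix.l2_opNorm_diagonal, pi_norm_le_iff_of_nonneg zero_le_one]
      intro i
      simp only [hs, Complex.norm_real]
      rcases lt_trichotomy (hX.eigenvalues i) 0 with h | h | h <;> simp [h]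
    have h4 : (V * Matrix.diagonal s * Vᴴ * X).trace = ((∑ i, |hX.eigenvalues i| : ℝ) : ℂ) := by
      rw [show V * Matrix.diagonal s * Vᴴ * X = V * (Matrix.diagonal s * Vᴴ * X) by
        simp only [Matrix.mul_assoc], Matrix.trace_mul_comm, Matrix.mul_assoc, Matrix.mul_assoc,
        ← Matrix.mul_assoc Vᴴ, h3', Matrix.diagonal_mul_diagonal, Matrix.trace_diagonal]
      push_cast
      refine Finset.sum_congr rfl fun i _ => ?_
      rw [hs, ← Complex.ofReal_mul, sign_mul_self]
    have h6 := norm_trace_mul_le_of_le_one h5 X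
    rw [h4, Complex.norm_real, Real.norm_eq_abs] at h6
    exact (le_abs_self _).trans h6

theorem traceNorm_eq_trace {X : Matrix n n ℂ} (hX : X.PosSemidef) : (traceNorm X : ℂ) = X.trace := by
  rw [traceNorm_eq_sum_abs hX.isHermitian, hX.isHermitian.trace_eq_sum_eigenvalues]
  push_cast
  refine Finset.sum_congr rfl fun i _ => ?_
  rw [abs_of_nonneg (hX.eigenvalues_nonneg i)]
  rfl

/-- A Hermitian matrix whose trace norm is at most its trace is positive semidefinite. -/
theorem posSemidef_of_traceNorm_le {X : Matrix n n ℂ} (hX : X.IsHermitian)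
    (h : traceNorm X ≤ X.trace.re) : X.PosSemidef := by
  rw [traceNorm_eq_sum_abs hX, hX.trace_eq_sum_eigenvalues, Complex.re_sum] at h
  have h2 : ∑ i, |hX.eigenvalues i| = ∑ i, hX.eigenvalues i :=
    le_antisymm (by simpa using h) (Finset.sum_le_sum fun i _ => le_abs_self _)
  rw [eq_comm, Finset.sum_eq_sum_iff_of_le fun i _ => le_abs_self _] at h2
  rw [hX.posSemidef_iff_eigenvalues_nonneg]
  intro i
  rw [Pi.zero_apply, h2 i (Finset.mem_univ i)]
  exact abs_nonneg _

end TraceNorm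
end Davies

/-! ### Lindblad generators and contraction of the trace norm -/

namespace Davies

set_option linter.unusedSectionVars false

section Lindblad

variable {n : Type*} [Fintype n] [DecidableEq n]

/-- `L` is a generator in Gorini-Kossakowski-Sudarshan-Lindblad form. -/
def IsLindblad (L : Matrix n n ℂ →L[ℂ] Matrix n n ℂ) : Prop :=
  ∃ (m : ℕ) (G : Matrix n n ℂ) (V : Fin m → Matrix n n ℂ),
    (∀ X, L X = G * X + X * Gᴴ + ∑ a, V a * X * (V a)ᴴ) ∧ G + Gᴴ + ∑ a, (V a)ᴴ * V a = 0

theorem norm_le_of_forall_dotProduct {M : Matrix n n ℂ} {c : ℝ} (hc : 0 ≤ c)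
    (h : ∀ x y : n → ℂ, ‖star x ⬝ᵥ (M *ᵥ y)‖ ≤ c * ‖WithLp.toLp 2 x‖ * ‖WithLp.toLp 2 y‖) :
    ‖M‖ ≤ c := by
  rw [Matrix.cstar_norm_def]
  refine ContinuousLinearMap.opNorm_le_bound _ hc fun v => ?_
  set w := M *ᵥ v.ofLp with hw
  have h1 : Matrix.toEuclideanCLM (n := n) (𝕜 := ℂ) M v = WithLp.toLp 2 w := rfl
  have h2 := h w v.ofLp
  rw [← hw, ← norm_toLp_sq, Complex.norm_real, Real.norm_of_nonneg (by positivity)] at h2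
  rw [h1]
  rcases (norm_nonneg (WithLp.toLp 2 w)).eq_or_lt with h0 | h0
  · rw [← h0]; positivity
  · have : WithLp.toLp 2 v.ofLp = v := rfl
    rw [this] at h2
    nlinarith

/-- The adjoint of a completely positive map attains its norm at the identity. -/
theorem norm_sum_conj_le {κ : Type*} [Fintype κ] (K : κ → Matrix n n ℂ) (U : Matrix n n ℂ) :
    ‖∑ a, (K a)ᴴ * U * K a‖ ≤ ‖U‖ * ‖∑ a, (K a)ᴴ * K a‖ := by
  set c := ‖∑ a, (K a)ᴴ * K a‖ with hc
  have hc0 : 0 ≤ c := norm_nonneg _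
  -- The quadratic form of `∑ (K a)ᴴ K a`. Cauchy–Schwarz in the index `a` then controls the
  -- sesquilinear form of `∑ (K a)ᴴ U K a`.
  have h1 : ∀ x : n → ℂ, ∑ a, ‖WithLp.toLp 2 (K a *ᵥ x)‖ ^ 2 ≤ c * ‖WithLp.toLp 2 x‖ ^ 2 := fun x => by
    have h := norm_star_dotProduct_mulVec_le (∑ a, (K a)ᴴ * K a) x x
    have h2 : star x ⬝ᵥ ((∑ a, (K a)ᴴ * K a) *ᵥ x) =
        ((∑ a, ‖WithLp.toLp 2 (K a *ᵥ x)‖ ^ 2 : ℝ) : ℂ) := by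
      rw [Complex.ofReal_sum, Matrix.sum_mulVec, dotProduct_sum]
      refine Finset.sum_congr rfl fun a _ => ?_
      rw [norm_toLp_sq, Matrix.star_mulVec, ← Matrix.mulVec_mulVec, Matrix.dotProduct_mulVec]
    rw [h2, Complex.norm_real, Real.norm_of_nonneg (by positivity)] at h
    linarith [sq ‖WithLp.toLp 2 x‖]
  refine norm_le_of_forall_dotProduct (by positivity) fun x y => ?_
  have h3 : star x ⬝ᵥ ((∑ a, (K a)ᴴ * U * K a) *ᵥ y) =
      ∑ a, star (K a *ᵥ x) ⬝ᵥ (U *ᵥ (K a *ᵥ y)) := by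
    rw [Matrix.sum_mulVec, dotProduct_sum]
    refine Finset.sum_congr rfl fun a _ => ?_
    rw [Matrix.star_mulVec, ← Matrix.dotProduct_mulVec, Matrix.mulVec_mulVec, Matrix.mulVec_mulVec,
      Matrix.mul_assoc]
  rw [h3]
  calc _ ≤ ∑ a, ‖U‖ * (‖WithLp.toLp 2 (K a *ᵥ x)‖ * ‖WithLp.toLp 2 (K a *ᵥ y)‖) :=
        (norm_sum_le _ _).trans (Finset.sum_le_sum fun a _ => by
          rw [← mul_assoc]; exact norm_star_dotProduct_mulVec_le _ _ _)
    _ = ‖U‖ * ∑ a, ‖WithLp.toLp 2 (K a *ᵥ x)‖ * ‖WithLp.toLp 2 (K a *ᵥ y)‖ := by rw [Finset.mul_sum]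
    _ ≤ ‖U‖ * (√(c * ‖WithLp.toLp 2 x‖ ^ 2) * √(c * ‖WithLp.toLp 2 y‖ ^ 2)) := by
        gcongr
        refine (Real.sum_mul_le_sqrt_mul_sqrt _ _ _).trans ?_
        gcongr
        · exact h1 x
        · exact h1 y
    _ = ‖U‖ * c * ‖WithLp.toLp 2 x‖ * ‖WithLp.toLp 2 y‖ := by
        rw [Real.sqrt_mul hc0, Real.sqrt_mul hc0, Real.sqrt_sq (norm_nonneg _),
          Real.sqrt_sq (norm_nonneg _)]
        nth_rw 3 [← Real.mul_self_sqrt hc0]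
        ring

/-- Dual to `norm_sum_conj_le`: under the trace pairing `X ↦ ∑ K X Kᴴ` becomes `U ↦ ∑ Kᴴ U K`. -/
theorem traceNorm_sum_conj_le {κ : Type*} [Fintype κ] (K : κ → Matrix n n ℂ) (X : Matrix n n ℂ) :
    traceNorm (∑ a, K a * X * (K a)ᴴ) ≤ ‖∑ a, (K a)ᴴ * K a‖ * traceNorm X := by
  refine traceNorm_le_of_forall fun U hU => ?_
  have : (U * ∑ a, K a * X * (K a)ᴴ).trace = ((∑ a, (K a)ᴴ * U * K a) * X).trace := by
    rw [Finset.mul_sum, Finset.sum_mul, Matrix.trace_sum, Matrix.trace_sum]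
    refine Finset.sum_congr rfl fun a _ => ?_
    rw [← Matrix.mul_assoc, Matrix.trace_mul_comm]
    simp only [Matrix.mul_assoc]
  rw [this]
  refine (norm_trace_mul_le _ _).trans ?_
  gcongr
  · exact traceNorm_nonneg X
  · exact (norm_sum_conj_le K U).trans (mul_le_of_le_one_left (norm_nonneg _) hU)

theorem traceNorm_conj_le (K X : Matrix n n ℂ) : traceNorm (K * X * Kᴴ) ≤ ‖K‖ ^ 2 * traceNorm X := by
  have := traceNorm_sum_conj_le (fun _ : Unit => K) X
  simpa [Matrix.l2_opNorm_conjTranspose_mul_self, sq] using this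

/-- A Lindblad generator is dissipative for the trace norm, up to a second order error. -/
theorem IsLindblad.exists_traceNorm_add_smul_le {L : Matrix n n ℂ →L[ℂ] Matrix n n ℂ}
    (hL : IsLindblad L) : ∃ c : ℝ, 0 ≤ c ∧ ∀ ε : ℝ, 0 ≤ ε → ∀ X,
      traceNorm (X + (ε : ℂ) • L X) ≤ (1 + c * ε ^ 2) * traceNorm X := by
  obtain ⟨m, G, V, hLX, hG⟩ := hL
  refine ⟨2 * ‖G‖ ^ 2, by positivity, fun ε hε X => ?_⟩
  -- Kraus operators of an Euler step of length `ε`: the condition on `G` and `V` cancels the first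
  -- order of `∑ Kᴴ K`, and the map agrees with `1 + ε L` up to `ε² G X Gᴴ`. Each of the two defects
  -- contributes one `‖G‖²` to the constant.
  set K : Option (Fin m) → Matrix n n ℂ := fun o =>
    o.elim (1 + (ε : ℂ) • G) (fun a => (√ε : ℂ) • V a) with hK
  have hs : (√ε : ℂ) * √ε = ε := by exact_mod_cast Real.mul_self_sqrt hε
  have h1 : ∑ o, (K o)ᴴ * K o = 1 + ((ε : ℂ) ^ 2) • (Gᴴ * G) := by
    rw [Fintype.sum_option]
    simp only [hK, Option.elim, Matrix.conjTranspose_add, Matrix.conjTranspose_smul,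
      Matrix.conjTranspose_one, RCLike.star_def, Complex.conj_ofReal, Matrix.smul_mul,
      Matrix.mul_smul, smul_smul, hs, ← Finset.smul_sum]
    rw [eq_neg_of_add_eq_zero_right hG]
    simp only [add_mul, mul_add, Matrix.smul_mul, Matrix.mul_smul, smul_smul, Matrix.one_mul,
      Matrix.mul_one, smul_add, smul_neg, sq]
    abel
  have h2 : ∑ o, K o * X * (K o)ᴴ = X + (ε : ℂ) • L X + ((ε : ℂ) ^ 2) • (G * X * Gᴴ) := by
    rw [Fintype.sum_option]
    simp only [hK, Option.elim, Matrix.conjTranspose_add, Matrix.conjTranspose_smul,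
      Matrix.conjTranspose_one, RCLike.star_def, Complex.conj_ofReal, Matrix.smul_mul,
      Matrix.mul_smul, smul_smul, hs, ← Finset.smul_sum, hLX]
    simp only [add_mul, mul_add, Matrix.smul_mul, Matrix.mul_smul, smul_smul, Matrix.one_mul,
      Matrix.mul_one, smul_add, sq]
    abel
  have h3 := traceNorm_sum_conj_le K X
  have hX := traceNorm_nonneg X
  have hn : ‖((ε : ℂ) ^ 2)‖ = ε ^ 2 := by rw [norm_pow, Complex.norm_real, Real.norm_of_nonneg hε]
  have h4 : ‖∑ o, (K o)ᴴ * K o‖ ≤ 1 + ε ^ 2 * ‖G‖ ^ 2 := by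
    rw [h1]
    refine (norm_add_le _ _).trans (add_le_add norm_one_le ?_)
    rw [norm_smul, hn, Matrix.l2_opNorm_conjTranspose_mul_self, sq ‖G‖]
  have h5 : traceNorm (((ε : ℂ) ^ 2) • (G * X * Gᴴ)) ≤ ε ^ 2 * (‖G‖ ^ 2 * traceNorm X) := by
    rw [traceNorm_smul, hn]
    gcongr
    exact traceNorm_conj_le G X
  calc traceNorm (X + (ε : ℂ) • L X)
      = traceNorm ((∑ o, K o * X * (K o)ᴴ) - ((ε : ℂ) ^ 2) • (G * X * Gᴴ)) := by rw [h2, add_sub_cancel_right]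
    _ ≤ _ := (traceNorm_sub_le _ _).trans (add_le_add h3 h5)
    _ ≤ (1 + ε ^ 2 * ‖G‖ ^ 2) * traceNorm X + ε ^ 2 * (‖G‖ ^ 2 * traceNorm X) := by gcongr
    _ = _ := by ring

theorem IsLindblad.trace_apply {L : Matrix n n ℂ →L[ℂ] Matrix n n ℂ} (hL : IsLindblad L)
    (X : Matrix n n ℂ) : (L X).trace = 0 := by
  obtain ⟨m, G, V, hLX, hG⟩ := hL
  have h1 : (∑ a, V a * X * (V a)ᴴ).trace = ((∑ a, (V a)ᴴ * V a) * X).trace := by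
    rw [Finset.sum_mul, Matrix.trace_sum, Matrix.trace_sum]
    refine Finset.sum_congr rfl fun a _ => ?_
    rw [Matrix.trace_mul_comm, Matrix.mul_assoc]
  rw [hLX, Matrix.trace_add, Matrix.trace_add, h1, Matrix.trace_mul_comm X, ← Matrix.trace_add,
    ← Matrix.trace_add, ← Matrix.add_mul, ← Matrix.add_mul, hG, Matrix.zero_mul, Matrix.trace_zero]

theorem IsLindblad.map_conjTranspose {L : Matrix n n ℂ →L[ℂ] Matrix n n ℂ} (hL : IsLindblad L)
    (X : Matrix n n ℂ) : L Xᴴ = (L X)ᴴ := by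
  obtain ⟨m, G, V, hLX, hG⟩ := hL
  simp only [hLX, Matrix.conjTranspose_add, Matrix.conjTranspose_mul, Matrix.conjTranspose_sum,
    Matrix.conjTranspose_conjTranspose, Matrix.mul_assoc]
  abel

/-- A perturbed evolution generated by Lindblad generators grows in trace norm at most by the
integral of the perturbation. -/
theorem traceNorm_le_of_hasDerivWithinAt {L : ℝ → Matrix n n ℂ →L[ℂ] Matrix n n ℂ}
    {R b : ℝ → Matrix n n ℂ} {B t₀ t₁ : ℝ} (hL : ∀ t ∈ Icc t₀ t₁, IsLindblad (L t))
    (hR : ∀ t ∈ Icc t₀ t₁, HasDerivWithinAt R (L t (R t) + b t) (Icc t₀ t₁) t)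
    (hb : ∀ t ∈ Icc t₀ t₁, traceNorm (b t) ≤ B) :
    ∀ t ∈ Icc t₀ t₁, traceNorm (R t) ≤ traceNorm (R t₀) + B * (t - t₀) := by
  have hcont : ContinuousOn R (Icc t₀ t₁) := fun t ht => (hR t ht).continuousWithinAt
  -- The trace norm is not differentiable, but an upper bound on its right slopes suffices.
  refine image_le_of_liminf_slope_right_le_deriv_boundary (f := fun t => traceNorm (R t))
    (continuous_traceNorm.comp_continuousOn hcont) (B := fun t => traceNorm (R t₀) + B * (t - t₀))
    (B' := fun _ => B) (by simp) (by fun_prop) (fun t _ => ?_) fun t ht r hr => ?_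
  · have := ((hasDerivAt_id t).sub_const t₀).const_mul B |>.const_add (traceNorm (R t₀))
    simpa using this.hasDerivWithinAt
  · have ht' := Ico_subset_Icc_self ht
    obtain ⟨c, hc, hLc⟩ := (hL t ht').exists_traceNorm_add_smul_le
    have hd : HasDerivWithinAt R (L t (R t) + b t) (Ici t) t :=
      (hR t ht').mono_of_mem_nhdsWithin (Icc_mem_nhdsGE_of_mem ht)
    have hd' := hd.Ioi_of_Ici
    rw [hasDerivWithinAt_iff_tendsto_slope' self_notMem_Ioi] at hd'
    have h1 : Tendsto (fun z => traceNorm (slope R t z - (L t (R t) + b t))) (𝓝[>] t) (𝓝 0) := by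
      have := (continuous_traceNorm (n := n)).continuousAt.tendsto.comp (hd'.sub_const (L t (R t) + b t))
      simpa [Function.comp_def] using this
    have h2 : Tendsto (fun z => c * (z - t) * traceNorm (R t) + B +
        traceNorm (slope R t z - (L t (R t) + b t))) (𝓝[>] t) (𝓝 (c * (t - t) * traceNorm (R t) + B + 0)) := by
      refine Tendsto.add (Tendsto.mono_left ?_ nhdsWithin_le_nhds) h1
      exact (by fun_prop : Continuous fun z => c * (z - t) * traceNorm (R t) + B).tendsto t
    have h3 := h2.eventually_lt_const (u := r) (by simpa using hr)
    refine Eventually.frequently ?_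
    filter_upwards [h3, self_mem_nhdsWithin] with z hz hzt
    have hzt : 0 < z - t := sub_pos.2 hzt
    refine lt_of_le_of_lt ?_ hz
    -- Euler step, source and differentiability remainder. The first is nonexpansive up to second
    -- order in `z - t`, and the last vanishes after division by `z - t`.
    have h4 : R z = (R t + ((z - t : ℝ) : ℂ) • L t (R t)) + ((z - t : ℝ) : ℂ) • b t +
        ((z - t : ℝ) : ℂ) • (slope R t z - (L t (R t) + b t)) := by
      have : ((z - t : ℝ) : ℂ) • slope R t z = R z - R t := by
        rw [slope_def_module, Complex.coe_smul, smul_smul, mul_inv_cancel₀ hzt.ne', one_smul]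
      rw [smul_sub, this, smul_add]
      abel
    have hn : ‖((z - t : ℝ) : ℂ)‖ = z - t := by rw [Complex.norm_real, Real.norm_of_nonneg hzt.le]
    have h5 : traceNorm (R z) ≤ (1 + c * (z - t) ^ 2) * traceNorm (R t) + (z - t) * B +
        (z - t) * traceNorm (slope R t z - (L t (R t) + b t)) := by
      conv_lhs => rw [h4]
      refine (traceNorm_add_le _ _).trans (add_le_add ((traceNorm_add_le _ _).trans (add_le_add
        (hLc _ hzt.le _) ?_)) ?_)
      · rw [traceNorm_smul, hn]
        gcongr
        exact hb t ht'
      · rw [traceNorm_smul, hn]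
    rw [slope_def_field, div_le_iff₀ hzt]
    nlinarith

theorem hasDerivAt_exp_smul_apply (L : Matrix n n ℂ →L[ℂ] Matrix n n ℂ) (X : Matrix n n ℂ) (t : ℝ) :
    HasDerivAt (fun r : ℝ => NormedSpace.exp (r • L) X) (L (NormedSpace.exp (t • L) X)) t := by
  have := (hasDerivAt_exp_smul_const' (𝕂 := ℝ) L t)
  have h := (ContinuousLinearMap.apply ℂ (Matrix n n ℂ) X).restrictScalars ℝ |>.hasFDerivAt.comp_hasDerivAt t this
  exact h

theorem exp_zero_smul_apply (L : Matrix n n ℂ →L[ℂ] Matrix n n ℂ) (X : Matrix n n ℂ) :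
    NormedSpace.exp ((0 : ℝ) • L) X = X := by
  have : (0 : ℝ) • L = 0 := by ext1 Y; simp
  rw [this, NormedSpace.exp_zero]
  rfl

/-- A Lindblad generator generates a contraction semigroup for the trace norm. -/
theorem IsLindblad.traceNorm_exp_le {L : Matrix n n ℂ →L[ℂ] Matrix n n ℂ} (hL : IsLindblad L)
    {r : ℝ} (hr : 0 ≤ r) (X : Matrix n n ℂ) :
    traceNorm (NormedSpace.exp (r • L) X) ≤ traceNorm X := by
  have := traceNorm_le_of_hasDerivWithinAt (L := fun _ => L) (b := fun _ => 0) (B := 0) (t₀ := 0)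
    (t₁ := r) (R := fun r => NormedSpace.exp (r • L) X) (fun _ _ => hL)
    (fun t _ => by simpa using (hasDerivAt_exp_smul_apply L X t).hasDerivWithinAt)
    (fun _ _ => by simp) r ⟨hr, le_rfl⟩
  simpa [exp_zero_smul_apply] using this

theorem IsLindblad.trace_exp {L : Matrix n n ℂ →L[ℂ] Matrix n n ℂ} (hL : IsLindblad L)
    (r : ℝ) (X : Matrix n n ℂ) : (NormedSpace.exp (r • L) X).trace = X.trace := by
  have h : ∀ t, HasDerivAt (fun r : ℝ => (NormedSpace.exp (r • L) X).trace) 0 t := fun t => by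
    have := (LinearMap.toContinuousLinearMap (Matrix.traceLinearMap n ℂ ℂ)).restrictScalars ℝ
      |>.hasFDerivAt.comp_hasDerivAt t (hasDerivAt_exp_smul_apply L X t)
    convert! this using 1
    exact (hL.trace_apply _).symm
  have := is_const_of_deriv_eq_zero (fun t => (h t).differentiableAt) (fun t => (h t).deriv) r 0
  simpa [exp_zero_smul_apply] using this

/-- The difference of the two sides solves the same linear equation with zero initial value, so the
growth bound keeps it zero. -/
theorem IsLindblad.exp_conjTranspose {L : Matrix n n ℂ →L[ℂ] Matrix n n ℂ} (hL : IsLindblad L)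
    {r : ℝ} (hr : 0 ≤ r) (X : Matrix n n ℂ) :
    NormedSpace.exp (r • L) Xᴴ = (NormedSpace.exp (r • L) X)ᴴ := by
  have := traceNorm_le_of_hasDerivWithinAt (L := fun _ => L) (b := fun _ => 0) (B := 0) (t₀ := 0)
    (t₁ := r) (R := fun r => NormedSpace.exp (r • L) Xᴴ - (NormedSpace.exp (r • L) X)ᴴ)
    (fun _ _ => hL) (fun t _ => by
      have h1 := (hasDerivAt_exp_smul_apply L X t)
      have h2 := h1.star
      rw [Matrix.star_eq_conjTranspose, ← hL.map_conjTranspose] at h2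
      have h3 := (hasDerivAt_exp_smul_apply L Xᴴ t).sub h2
      rw [add_zero, map_sub]
      exact h3.hasDerivWithinAt)
    (fun _ _ => by simp) r ⟨hr, le_rfl⟩
  have h0 : traceNorm (NormedSpace.exp (r • L) Xᴴ - (NormedSpace.exp (r • L) X)ᴴ) ≤ 0 := by
    simpa [exp_zero_smul_apply] using this
  have := (norm_le_traceNorm _).trans h0
  exact sub_eq_zero.1 (norm_le_zero_iff.1 this)

/-- Positivity comes from the equality case of the contraction: the trace is conserved, the trace
norm cannot exceed it, and a Hermitian matrix with this property has no negative eigenvalue. -/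
theorem IsLindblad.posSemidef_exp {L : Matrix n n ℂ →L[ℂ] Matrix n n ℂ} (hL : IsLindblad L)
    {r : ℝ} (hr : 0 ≤ r) {X : Matrix n n ℂ} (hX : X.PosSemidef) :
    (NormedSpace.exp (r • L) X).PosSemidef := by
  refine posSemidef_of_traceNorm_le ?_ ?_
  · rw [Matrix.IsHermitian, ← hL.exp_conjTranspose hr, hX.isHermitian.eq]
  · rw [hL.trace_exp, ← traceNorm_eq_trace hX, Complex.ofReal_re]
    exact hL.traceNorm_exp_le hr X

end Lindblad
end Davies

/-! ### Eigenvectors of the adjoint generator with imaginary eigenvalue -/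

namespace Davies

set_option linter.unusedSectionVars false

section Peripheral

variable {n : Type*} [Fintype n] [DecidableEq n]

open scoped MatrixOrder in
theorem exists_eq_conjTranspose_mul_self {X : Matrix n n ℂ} (hX : X.PosSemidef) :
    ∃ B : Matrix n n ℂ, X = Bᴴ * B :=
  CStarAlgebra.nonneg_iff_eq_star_mul_self.mp hX.nonneg

/-- With `σ = Bᴴ B`, the trace is the squared Hilbert–Schmidt norm of `C Bᴴ`. -/
theorem mul_eq_zero_of_trace_conj_eq_zero {σ C : Matrix n n ℂ} (hσ : σ.PosSemidef)
    (h : (C * σ * Cᴴ).trace = 0) : C * σ = 0 := by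
  obtain ⟨B, rfl⟩ := exists_eq_conjTranspose_mul_self hσ
  have h1 : C * (Bᴴ * B) * Cᴴ = (C * Bᴴ) * (C * Bᴴ)ᴴ := by
    simp [Matrix.conjTranspose_mul, Matrix.mul_assoc]
  rw [h1, Matrix.trace_mul_conjTranspose_self_eq_zero_iff] at h
  rw [← Matrix.mul_assoc, h, Matrix.zero_mul]

/-- Cauchy-Schwarz inequality in a state. -/
theorem norm_trace_mul_sq_le {ρ : Matrix n n ℂ} (hρ : ρ.PosSemidef) (h1 : ρ.trace = 1)
    (X : Matrix n n ℂ) : ‖(X * ρ).trace‖ ^ 2 ≤ (X * ρ * Xᴴ).trace.re := by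
  set c := (X * ρ).trace with hc
  have h2 : (ρ * Xᴴ).trace = star c := by
    rw [hc, ← Matrix.trace_conjTranspose, Matrix.conjTranspose_mul, hρ.isHermitian.eq]
  have h3 : ((X - c • 1) * ρ * (X - c • 1)ᴴ).trace = (X * ρ * Xᴴ).trace - c * star c := by
    simp only [Matrix.conjTranspose_sub, Matrix.conjTranspose_smul, Matrix.conjTranspose_one,
      Matrix.sub_mul, Matrix.mul_sub, Matrix.smul_mul, Matrix.mul_smul, Matrix.one_mul, Matrix.mul_one,
      Matrix.trace_sub, Matrix.trace_smul, h1, h2, ← hc, smul_eq_mul]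
    ring
  have h4 := (hρ.mul_mul_conjTranspose_same (X - c • 1)).trace_nonneg
  rw [h3, RCLike.star_def, Complex.mul_conj'] at h4
  have h5 := (Complex.nonneg_iff.1 h4).1
  rw [Complex.sub_re] at h5
  have h6 : ((‖c‖ : ℂ) ^ 2).re = ‖c‖ ^ 2 := by rw [← Complex.ofReal_pow, Complex.ofReal_re]
  linarith

/-- A positive semidefinite element of the kernel is a multiple of the unique steady state. -/
theorem eq_trace_smul_of_posSemidef {L : Matrix n n ℂ →L[ℂ] Matrix n n ℂ} {σ : Matrix n n ℂ}
    (hu : ∀ σ', IsSteadyState L σ' → σ' = σ) {ρ : Matrix n n ℂ} (hρ : ρ.PosSemidef)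
    (h0 : L ρ = 0) : ρ = ρ.trace • σ := by
  by_cases ht : ρ.trace = 0
  · rw [ht, zero_smul, ← hρ.trace_eq_zero_iff, ht]
  · have hn := hρ.trace_nonneg
    have h2 : IsSteadyState L (ρ.trace⁻¹ • ρ) := by
      refine ⟨hρ.smul ?_, ?_, ?_⟩
      · obtain ⟨hr, hi⟩ := Complex.nonneg_iff.1 hn
        have : ρ.trace = (ρ.trace.re : ℂ) := Complex.ext rfl (by simp [← hi])
        rw [this, ← Complex.ofReal_inv]
        exact_mod_cast inv_nonneg.2 hr
      · rw [Matrix.trace_smul, smul_eq_mul, inv_mul_cancel₀ ht]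
      · rw [map_smul, h0, smul_zero]
    rw [← hu _ h2, smul_smul, mul_inv_cancel₀ ht, one_smul]

section Form

variable {m : ℕ} {G : Matrix n n ℂ} {V : Fin m → Matrix n n ℂ} {L : Matrix n n ℂ →L[ℂ] Matrix n n ℂ}
  {σ X : Matrix n n ℂ} {z : ℂ}

/-- The Heisenberg picture: `Y ↦ Y G + Gᴴ Y + ∑ Vᴴ Y V` is the adjoint of `L` for the trace pairing.
-/
theorem trace_mul_lindblad (hL : ∀ X, L X = G * X + X * Gᴴ + ∑ a, V a * X * (V a)ᴴ)
    (Y Z : Matrix n n ℂ) :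
    (Y * L Z).trace = ((Y * G + Gᴴ * Y + ∑ a, (V a)ᴴ * Y * V a) * Z).trace := by
  rw [hL, Matrix.mul_add, Matrix.mul_add, Matrix.add_mul, Matrix.add_mul, Matrix.trace_add,
    Matrix.trace_add, Matrix.trace_add, Matrix.trace_add, Finset.mul_sum, Finset.sum_mul,
    Matrix.trace_sum, Matrix.trace_sum, Matrix.mul_assoc, ← Matrix.mul_assoc Y Z,
    Matrix.trace_mul_comm (Y * Z), Matrix.mul_assoc Gᴴ]
  congr 1
  refine Finset.sum_congr rfl fun a _ => ?_
  rw [← Matrix.mul_assoc, Matrix.trace_mul_comm]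
  simp only [Matrix.mul_assoc]

theorem dual_eigen_eq (hL : ∀ X, L X = G * X + X * Gᴴ + ∑ a, V a * X * (V a)ᴴ)
    (hX : ∀ Y, (X * L Y).trace = z * (X * Y).trace) :
    X * G + Gᴴ * X + ∑ a, (V a)ᴴ * X * V a = z • X := by
  rw [Matrix.ext_iff_trace_mul_right]
  intro Y
  rw [← trace_mul_lindblad hL, hX, Matrix.smul_mul, Matrix.trace_smul, smul_eq_mul]

/-- A peripheral eigenvector of the adjoint generator commutes with the jump operators on the
support of a steady state. -/
theorem jump_mul_mul_eq (hL : ∀ X, L X = G * X + X * Gᴴ + ∑ a, V a * X * (V a)ᴴ)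
    (hG : G + Gᴴ + ∑ a, (V a)ᴴ * V a = 0) (hσ : σ.PosSemidef) (h0 : L σ = 0) (hz : z + star z = 0)
    (hX : ∀ Y, (X * L Y).trace = z * (X * Y).trace) (a : Fin m) : V a * X * σ = X * V a * σ := by
  have hd := dual_eigen_eq hL hX
  have hd' : Gᴴ * Xᴴ + Xᴴ * G + ∑ a, (V a)ᴴ * Xᴴ * V a = star z • Xᴴ := by
    have := congrArg Matrix.conjTranspose hd
    simpa only [Matrix.conjTranspose_add, Matrix.conjTranspose_mul, Matrix.conjTranspose_sum,
      Matrix.conjTranspose_smul, Matrix.conjTranspose_conjTranspose, Matrix.mul_assoc] using this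
  -- Dissipation identity: with `L'` the adjoint generator, this sum is `L'(Xᴴ X) - L'(Xᴴ) X - Xᴴ
  -- L'(X)`. On an eigenvector the last two terms cancel, since `z` is imaginary, which leaves
  -- `L'(Xᴴ X)`.
  have h1 : ∑ a, (V a * X - X * V a)ᴴ * (V a * X - X * V a) =
      Xᴴ * (∑ a, (V a)ᴴ * V a) * X - Xᴴ * (∑ a, (V a)ᴴ * X * V a) -
        (∑ a, (V a)ᴴ * Xᴴ * V a) * X + ∑ a, (V a)ᴴ * (Xᴴ * X) * V a := by
    simp only [Finset.mul_sum, Finset.sum_mul, ← Finset.sum_sub_distrib, ← Finset.sum_add_distrib,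
      Matrix.conjTranspose_sub, Matrix.conjTranspose_mul]
    refine Finset.sum_congr rfl fun a _ => ?_
    noncomm_ring
  have h2 : ∑ a, (V a * X - X * V a)ᴴ * (V a * X - X * V a) =
      Xᴴ * X * G + Gᴴ * (Xᴴ * X) + ∑ a, (V a)ᴴ * (Xᴴ * X) * V a := by
    rw [h1, eq_neg_of_add_eq_zero_right hG, eq_sub_of_add_eq' hd, eq_sub_of_add_eq' hd']
    have h3 : Xᴴ * z • X + star z • Xᴴ * X = 0 := by
      rw [Matrix.mul_smul, Matrix.smul_mul, ← add_smul, hz, zero_smul]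
    rw [← sub_eq_zero]
    calc _ = -(Xᴴ * z • X + star z • Xᴴ * X) := by noncomm_ring
      _ = 0 := by rw [h3, neg_zero]
  -- The state `σ` annihilates the range of the adjoint generator, so a sum of nonnegative terms is
  -- zero.
  have h3 : ∑ a, ((V a * X - X * V a) * σ * (V a * X - X * V a)ᴴ).trace = 0 := by
    have h4 := trace_mul_lindblad hL (Xᴴ * X) σ
    rw [h0, Matrix.mul_zero, Matrix.trace_zero, ← h2, Finset.sum_mul, Matrix.trace_sum] at h4
    rw [h4]
    refine Finset.sum_congr rfl fun a _ => ?_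
    rw [Matrix.trace_mul_comm, Matrix.mul_assoc]
  have h4 := (Finset.sum_eq_zero_iff_of_nonneg fun a _ =>
    (hσ.mul_mul_conjTranspose_same (V a * X - X * V a)).trace_nonneg).1 h3 a (Finset.mem_univ a)
  have h5 := mul_eq_zero_of_trace_conj_eq_zero hσ h4
  rwa [Matrix.sub_mul, sub_eq_zero] at h5

/-- In the eigenvalue equation applied to `σ` the jump operators can be moved past `X`; then `∑ Vᴴ V
= -(G + Gᴴ)` cancels the terms with `Gᴴ`. -/
theorem drift_mul_mul_eq (hL : ∀ X, L X = G * X + X * Gᴴ + ∑ a, V a * X * (V a)ᴴ)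
    (hG : G + Gᴴ + ∑ a, (V a)ᴴ * V a = 0) (hσ : σ.PosSemidef) (h0 : L σ = 0) (hz : z + star z = 0)
    (hX : ∀ Y, (X * L Y).trace = z * (X * Y).trace) : G * X * σ = X * G * σ - z • (X * σ) := by
  have hd := congrArg (· * σ) (dual_eigen_eq hL hX)
  simp only [Matrix.add_mul, Finset.sum_mul, Matrix.smul_mul] at hd
  have h1 : ∑ a, (V a)ᴴ * X * V a * σ = (∑ a, (V a)ᴴ * V a) * X * σ := by
    simp only [Finset.sum_mul]
    refine Finset.sum_congr rfl fun a _ => ?_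
    have := jump_mul_mul_eq hL hG hσ h0 hz hX a
    rw [Matrix.mul_assoc, Matrix.mul_assoc, ← Matrix.mul_assoc X, ← this]
    simp only [Matrix.mul_assoc]
  rw [h1, eq_neg_of_add_eq_zero_right hG] at hd
  rw [← hd]
  noncomm_ring

/-- Next to `σ`, `X` commutes with the jumps and with the drift up to `z`. So `L` passes through `X
· Xᴴ`, with an error proportional to `z + star z = 0`. -/
theorem map_conj_eq_zero (hL : ∀ X, L X = G * X + X * Gᴴ + ∑ a, V a * X * (V a)ᴴ)
    (hG : G + Gᴴ + ∑ a, (V a)ᴴ * V a = 0) (hσ : σ.PosSemidef) (h0 : L σ = 0) (hz : z + star z = 0)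
    (hX : ∀ Y, (X * L Y).trace = z * (X * Y).trace) : L (X * σ * Xᴴ) = 0 := by
  have h1 := drift_mul_mul_eq hL hG hσ h0 hz hX
  have h1' : σ * Xᴴ * Gᴴ = σ * Gᴴ * Xᴴ - star z • (σ * Xᴴ) := by
    have := congrArg Matrix.conjTranspose h1
    simpa only [Matrix.conjTranspose_sub, Matrix.conjTranspose_mul, Matrix.conjTranspose_smul,
      hσ.isHermitian.eq, ← Matrix.mul_assoc] using this
  have h2 : ∀ a, V a * (X * σ * Xᴴ) * (V a)ᴴ = X * (V a * σ * (V a)ᴴ) * Xᴴ := fun a => by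
    have h3 := jump_mul_mul_eq hL hG hσ h0 hz hX a
    have h3' : σ * Xᴴ * (V a)ᴴ = σ * (V a)ᴴ * Xᴴ := by
      have := congrArg Matrix.conjTranspose h3
      simpa only [Matrix.conjTranspose_mul, hσ.isHermitian.eq, ← Matrix.mul_assoc] using this
    calc V a * (X * σ * Xᴴ) * (V a)ᴴ = (V a * X * σ) * Xᴴ * (V a)ᴴ := by simp only [Matrix.mul_assoc]
      _ = X * V a * (σ * Xᴴ * (V a)ᴴ) := by rw [h3]; simp only [Matrix.mul_assoc]
      _ = _ := by rw [h3']; simp only [Matrix.mul_assoc]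
  rw [hL]
  simp only [h2]
  rw [← Finset.sum_mul, ← Finset.mul_sum]
  have h4 : ∑ a, V a * σ * (V a)ᴴ = -(G * σ + σ * Gᴴ) := by
    rw [hL] at h0
    exact eq_neg_of_add_eq_zero_right h0
  have h5 : G * (X * σ * Xᴴ) = (X * G * σ - z • (X * σ)) * Xᴴ := by
    rw [← h1]; simp only [Matrix.mul_assoc]
  have h6 : X * σ * Xᴴ * Gᴴ = X * (σ * Gᴴ * Xᴴ - star z • (σ * Xᴴ)) := by
    rw [← h1']; simp only [Matrix.mul_assoc]
  have h7 : z • (X * σ * Xᴴ) + star z • (X * σ * Xᴴ) = 0 := by rw [← add_smul, hz, zero_smul]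
  rw [h4, h5, h6, Matrix.sub_mul, Matrix.mul_sub, Matrix.smul_mul, Matrix.mul_smul,
    ← Matrix.mul_assoc X σ]
  calc _ = -(z • (X * σ * Xᴴ) + star z • (X * σ * Xᴴ)) := by noncomm_ring
    _ = 0 := by rw [h7, neg_zero]

end Form

end Peripheral
end Davies

/-! ### Time averages and uniqueness of the steady state -/

namespace Davies

set_option linter.unusedSectionVars false

section Ergodic

variable {n : Type*} [Fintype n] [DecidableEq n]

theorem continuous_trace : Continuous (Matrix.trace : Matrix n n ℂ → ℂ) :=
  (LinearMap.toContinuousLinearMap (Matrix.traceLinearMap n ℂ ℂ)).continuous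

theorem continuous_exp_smul_apply (L : Matrix n n ℂ →L[ℂ] Matrix n n ℂ) (X : Matrix n n ℂ) :
    Continuous fun r : ℝ => NormedSpace.exp (r • L) X :=
  continuous_iff_continuousAt.2 fun t => (hasDerivAt_exp_smul_apply L X t).continuousAt

/-- A linear lower bound along a trajectory holds in some steady state, a limit of time averages. -/
theorem IsLindblad.exists_steadyState_ge {L : Matrix n n ℂ →L[ℂ] Matrix n n ℂ} (hL : IsLindblad L)
    {ρ : Matrix n n ℂ} (hρ : ρ.PosSemidef) (h1 : ρ.trace = 1) (φ : Matrix n n ℂ →L[ℝ] ℝ) {a : ℝ}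
    (ha : ∀ t : ℝ, 0 ≤ t → a ≤ φ (NormedSpace.exp (t • L) ρ)) :
    ∃ σ, IsSteadyState L σ ∧ a ≤ φ σ := by
  -- Hermitian, trace one and trace norm at most one describe the density matrices by closed convex
  -- conditions.
  set S : Set (Matrix n n ℂ) := {Y | (Yᴴ = Y ∧ traceNorm Y ≤ 1) ∧ Y.trace = 1 ∧ a ≤ φ Y} with hS
  have hSc : IsClosed S := by
    refine ((isClosed_eq (by fun_prop) continuous_id).inter
      (isClosed_le continuous_traceNorm continuous_const)).inter
      ((isClosed_eq continuous_trace continuous_const).inter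
      (isClosed_le continuous_const φ.continuous))
  have hSconv : Convex ℝ S := by
    rintro X ⟨⟨hX1, hX2⟩, hX3, hX4⟩ Y ⟨⟨hY1, hY2⟩, hY3, hY4⟩ p q hp hq hpq
    have hs : ∀ (r : ℝ) (Z : Matrix n n ℂ), r • Z = (r : ℂ) • Z := fun r Z => (Complex.coe_smul r Z).symm
    refine ⟨⟨?_, ?_⟩, ?_, ?_⟩
    · simp [Matrix.conjTranspose_add, Matrix.conjTranspose_smul, hX1, hY1]
    · refine (traceNorm_add_le _ _).trans ?_
      rw [hs, hs, traceNorm_smul, traceNorm_smul, Complex.norm_real, Complex.norm_real,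
        Real.norm_of_nonneg hp, Real.norm_of_nonneg hq]
      nlinarith
    · rw [hs, hs, Matrix.trace_add, Matrix.trace_smul, Matrix.trace_smul, hX3, hY3, smul_eq_mul,
        smul_eq_mul, mul_one, mul_one]
      exact_mod_cast hpq
    · rw [map_add, map_smul, map_smul, smul_eq_mul, smul_eq_mul]
      calc a = p * a + q * a := by rw [← add_mul, hpq, one_mul]
        _ ≤ _ := by gcongr
  have hSb : Bornology.IsBounded S := by
    refine (Metric.isBounded_closedBall (x := (0 : Matrix n n ℂ)) (r := 1)).subset fun Y hY => ?_
    rw [mem_closedBall_zero_iff]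
    exact (norm_le_traceNorm Y).trans hY.1.2
  set f : ℝ → Matrix n n ℂ := fun t => NormedSpace.exp (t • L) ρ with hf
  have hfc : Continuous f := continuous_exp_smul_apply L ρ
  have htn : ∀ t, 0 ≤ t → traceNorm (f t) ≤ 1 := fun t ht => by
    refine (hL.traceNorm_exp_le ht ρ).trans (le_of_eq ?_)
    have := traceNorm_eq_trace hρ
    rw [h1] at this
    exact_mod_cast this
  have hfS : ∀ t, 0 ≤ t → f t ∈ S := fun t ht =>
    ⟨⟨(hL.posSemidef_exp ht hρ).isHermitian, htn t ht⟩, by rw [hL.trace_exp, h1], ha t ht⟩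
  -- The time average over `[0, k + 1]`, rescaled to the unit interval so that it is an integral
  -- against a probability measure and stays in `S`.
  set A : ℕ → Matrix n n ℂ := fun k => ∫ t in (0 : ℝ)..1, f (((k : ℝ) + 1) * t) with hA
  have hAS : ∀ k, A k ∈ S := fun k => by
    have : IsProbabilityMeasure (volume.restrict (Ioc (0 : ℝ) 1)) := ⟨by simp⟩
    simp only [hA]
    rw [intervalIntegral.integral_of_le zero_le_one]
    refine hSconv.integral_mem hSc ?_ ?_
    · refine (ae_restrict_mem measurableSet_Ioc).mono fun t ht => hfS _ ?_
      have := ht.1.le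
      positivity
    · exact ((hfc.comp (by fun_prop)).integrableOn_Icc).mono_set Ioc_subset_Icc_self
  -- `L` of a time average is a boundary term divided by the length of the interval, so every limit
  -- point of the averages is stationary.
  have hLA : ∀ k : ℕ, ((k : ℝ) + 1) • L (A k) = f (k + 1) - f 0 := fun k => by
    have h2 : ∀ t : ℝ, HasDerivAt (fun t => f (((k : ℝ) + 1) * t))
        (((k : ℝ) + 1) • L (f (((k : ℝ) + 1) * t))) t := fun t => by
      have h3 := hasDerivAt_exp_smul_apply L ρ (((k : ℝ) + 1) * t)
      have h4 : HasDerivAt (fun t : ℝ => ((k : ℝ) + 1) * t) ((k : ℝ) + 1) t := by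
        simpa using (hasDerivAt_id t).const_mul ((k : ℝ) + 1)
      exact h3.scomp t h4
    have h5 := intervalIntegral.integral_eq_sub_of_hasDerivAt (a := 0) (b := 1) (fun t _ => h2 t)
      (Continuous.intervalIntegrable (by fun_prop) _ _)
    rw [intervalIntegral.integral_smul] at h5
    have h6 : L (A k) = ∫ t in (0 : ℝ)..1, L (f (((k : ℝ) + 1) * t)) :=
      (L.intervalIntegral_comp_comm (Continuous.intervalIntegrable (by fun_prop) _ _)).symm
    rw [h6, h5]
    simp
  obtain ⟨σ, hσ, ψ, hψ, hlim⟩ := (Metric.isCompact_of_isClosed_isBounded hSc hSb).tendsto_subseq hAS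
  have hL0 : Tendsto (fun k => L (A k)) atTop (𝓝 0) := by
    refine squeeze_zero_norm (a := fun k : ℕ => 2 * (1 / ((k : ℝ) + 1))) (fun k => ?_) ?_
    · have hk : (0 : ℝ) < (k : ℝ) + 1 := by positivity
      have h2 : ‖((k : ℝ) + 1) • L (A k)‖ ≤ 2 := by
        rw [hLA]
        have h3 := (norm_le_traceNorm _).trans (htn ((k : ℝ) + 1) hk.le)
        have h4 := (norm_le_traceNorm _).trans (htn 0 le_rfl)
        exact (norm_sub_le _ _).trans (by linarith)
      rw [norm_smul, Real.norm_of_nonneg hk.le] at h2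
      rw [mul_one_div, le_div_iff₀ hk]
      linarith
    · simpa using (tendsto_one_div_add_atTop_nhds_zero_nat (𝕜 := ℝ)).const_mul 2
  have h0 : L σ = 0 := tendsto_nhds_unique ((L.continuous.tendsto σ).comp hlim)
    (hL0.comp hψ.tendsto_atTop)
  refine ⟨σ, ⟨posSemidef_of_traceNorm_le hσ.1.1 ?_, hσ.2.1, h0⟩, hσ.2.2⟩
  rw [hσ.2.1, Complex.one_re]
  exact hσ.1.2

/-- Along the evolution `Tr (X ·)` acquires only the factor `exp (z t)`, of modulus one. -/
theorem norm_trace_mul_exp_eq {L : Matrix n n ℂ →L[ℂ] Matrix n n ℂ} {X : Matrix n n ℂ} {z : ℂ}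
    (hz : z.re = 0) (hX : ∀ Y, (X * L Y).trace = z * (X * Y).trace) (ρ : Matrix n n ℂ) (t : ℝ) :
    ‖(X * NormedSpace.exp (t • L) ρ).trace‖ = ‖(X * ρ).trace‖ := by
  set T : Matrix n n ℂ →L[ℂ] ℂ := LinearMap.toContinuousLinearMap
    (Matrix.traceLinearMap n ℂ ℂ ∘ₗ LinearMap.mulLeft ℂ X) with hT
  have hT' : ∀ Y, T Y = (X * Y).trace := fun Y => rfl
  have h : ∀ t : ℝ, HasDerivAt (fun r : ℝ => Complex.exp (-(z * r)) *
      T (NormedSpace.exp (r • L) ρ)) 0 t := fun t => by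
    have h1 := (T.restrictScalars ℝ).hasFDerivAt.comp_hasDerivAt t (hasDerivAt_exp_smul_apply L ρ t)
    have h2 : HasDerivAt (fun r : ℝ => Complex.exp (-(z * r))) (Complex.exp (-(z * t)) * (-z)) t := by
      have := ((hasDerivAt_id t).ofReal_comp.const_mul z).neg.cexp
      simpa using this
    convert! h2.mul h1 using 1
    simp only [ContinuousLinearMap.coe_restrictScalars', hT', hX, Function.comp]
    ring
  have h2 := is_const_of_deriv_eq_zero (fun t => (h t).differentiableAt) (fun t => (h t).deriv) t 0
  simp only [Complex.ofReal_zero, mul_zero, neg_zero, Complex.exp_zero, one_mul,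
    exp_zero_smul_apply, hT'] at h2
  rw [← h2, norm_mul, Complex.norm_exp]
  simp [hz]

/-- Rank one states give the diagonal quadratic form of `X`, which determines `X` over the complex
numbers. -/
theorem eq_zero_of_forall_trace_state {X : Matrix n n ℂ}
    (h : ∀ ρ : Matrix n n ℂ, ρ.PosSemidef → ρ.trace = 1 → (X * ρ).trace = 0) : X = 0 := by
  have h1 : ∀ v : n → ℂ, star v ⬝ᵥ (X *ᵥ v) = 0 := fun v => by
    have hP := Matrix.posSemidef_vecMulVec_self_star v
    have h2 : (X * Matrix.vecMulVec v (star v)).trace = star v ⬝ᵥ (X *ᵥ v) := by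
      rw [Matrix.mul_vecMulVec, Matrix.trace_vecMulVec, dotProduct_comm]
    rw [← h2]
    by_cases h0 : (Matrix.vecMulVec v (star v)).trace = 0
    · rw [hP.trace_eq_zero_iff.1 h0, Matrix.mul_zero, Matrix.trace_zero]
    · set c := (Matrix.vecMulVec v (star v)).trace with hc
      have h3 := h (c⁻¹ • Matrix.vecMulVec v (star v)) (hP.smul ?_) ?_
      · rw [Matrix.mul_smul, Matrix.trace_smul, smul_eq_mul] at h3
        exact (mul_eq_zero.1 h3).resolve_left (inv_ne_zero h0)
      · obtain ⟨hr, hi⟩ := Complex.nonneg_iff.1 hP.trace_nonneg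
        have : c = (c.re : ℂ) := Complex.ext rfl (by rw [Complex.ofReal_im]; exact hi.symm)
        rw [this, ← Complex.ofReal_inv]
        exact_mod_cast inv_nonneg.2 hr
      · rw [Matrix.trace_smul, ← hc, smul_eq_mul, inv_mul_cancel₀ h0]
  have h2 : Matrix.toEuclideanLin X = 0 := by
    rw [← inner_map_self_eq_zero]
    intro x
    have := h1 x.ofLp
    rw [← inner_conj_symm, map_eq_zero_iff _ (RingHom.injective _)]
    rw [EuclideanSpace.inner_eq_star_dotProduct, dotProduct_comm]
    exact this
  exact (LinearEquiv.map_eq_zero_iff _).1 h2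

/-- Two operators related by a shifted commutation relation on a space on which one of them is
invertible commute. -/
theorem eq_zero_of_shift_relation {E : Type*} [AddCommGroup E] [Module ℂ E] [FiniteDimensional ℂ E]
    [Nontrivial E] {g x : E →ₗ[ℂ] E} {c : ℂ} (hx : Function.Injective x)
    (h : ∀ v, x (g v) = g (x v) + c • x v) : c = 0 := by
  let e : E ≃ₗ[ℂ] E := LinearEquiv.ofInjectiveEndo x hx
  -- Conjugation by `x` shifts `g` by `c`, but preserves its trace.
  have h1 : e.conj g = g + c • LinearMap.id := by
    ext v
    have h2 : x (e.symm v) = v := e.apply_symm_apply v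
    rw [LinearEquiv.conj_apply_apply]
    change x (g (e.symm v)) = _
    rw [h, h2]
    rfl
  have h3 := LinearMap.trace_conj' g e
  rw [h1, map_add, map_smul, LinearMap.trace_id, smul_eq_mul] at h3
  have h4 : c * (Module.finrank ℂ E : ℂ) = 0 := by linear_combination h3
  refine (mul_eq_zero.1 h4).resolve_right ?_
  exact_mod_cast (Module.finrank_pos (R := ℂ) (M := E)).ne'

end Ergodic

section Unique

variable {n : Type*} [Fintype n] [DecidableEq n] {L : Matrix n n ℂ →L[ℂ] Matrix n n ℂ}
  {σ X : Matrix n n ℂ} {z : ℂ}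

/-- This replaces faithfulness of `σ`. For a state `ρ`, `|Tr (X ρ)|²` is constant in time and bounds
`Tr (X ρ_t Xᴴ)` from below; the bound survives in a steady state, which must be `σ`, where the value
is zero. -/
theorem eq_zero_of_mul_steadyState_eq_zero (hL : IsLindblad L)
    (hu : ∀ σ', IsSteadyState L σ' → σ' = σ) (hz : z.re = 0)
    (hX : ∀ Y, (X * L Y).trace = z * (X * Y).trace) (h0 : X * σ = 0) : X = 0 := by
  refine eq_zero_of_forall_trace_state fun ρ hρ h1 => ?_
  set φ : Matrix n n ℂ →L[ℝ] ℝ := Complex.reCLM ∘L (LinearMap.toContinuousLinearMap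
    (Matrix.traceLinearMap n ℂ ℂ ∘ₗ LinearMap.mulLeft ℂ X ∘ₗ LinearMap.mulRight ℂ Xᴴ)).restrictScalars ℝ
    with hφ
  have hφ' : ∀ Y, φ Y = (X * (Y * Xᴴ)).trace.re := fun Y => rfl
  obtain ⟨σ', hσ', h2⟩ := hL.exists_steadyState_ge hρ h1 φ (a := ‖(X * ρ).trace‖ ^ 2) fun t ht => by
    rw [← norm_trace_mul_exp_eq hz hX ρ t, hφ', ← Matrix.mul_assoc]
    exact norm_trace_mul_sq_le (hL.posSemidef_exp ht hρ) (by rw [hL.trace_exp, h1]) X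
  rw [hu σ' hσ', hφ', ← Matrix.mul_assoc, h0, Matrix.zero_mul, Matrix.trace_zero, Complex.zero_re] at h2
  exact norm_eq_zero.1 (pow_eq_zero_iff two_ne_zero |>.1 (le_antisymm h2 (sq_nonneg _)))

/-- With a unique steady state, a peripheral eigenvector of the adjoint generator is a multiple of
the identity. -/
theorem exists_eq_smul_one_of_dual_eigen (hL : IsLindblad L) (hσ : IsSteadyState L σ)
    (hu : ∀ σ', IsSteadyState L σ' → σ' = σ) (hz : z.re = 0)
    (hX : ∀ Y, (X * L Y).trace = z * (X * Y).trace) : ∃ c : ℂ, X = c • 1 ∧ (c = 0 ∨ z = 0) := by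
  obtain ⟨m, G, V, hLX, hG⟩ := id hL
  obtain ⟨hP, ht, h0⟩ := hσ
  have hz' : ∀ {w : ℂ}, w.re = 0 → w + star w = 0 := fun {w} hw => by
    rw [RCLike.star_def, Complex.add_conj, hw]; simp
  have hconj : ∀ {w : ℂ} {Y : Matrix n n ℂ}, w.re = 0 →
      (∀ Z, (Y * L Z).trace = w * (Y * Z).trace) → Y * σ * Yᴴ = (Y * σ * Yᴴ).trace • σ :=
    fun {w Y} hw hY => eq_trace_smul_of_posSemidef hu (hP.mul_mul_conjTranspose_same Y)
      (map_conj_eq_zero hLX hG hP h0 (hz' hw) hY)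
  have hzero : ∀ {w : ℂ} {Y : Matrix n n ℂ}, w.re = 0 →
      (∀ Z, (Y * L Z).trace = w * (Y * Z).trace) → (Y * σ * Yᴴ).trace = 0 → Y = 0 :=
    fun {w Y} hw hY h => eq_zero_of_mul_steadyState_eq_zero hL hu hw hY
      (mul_eq_zero_of_trace_conj_eq_zero hP h)
  by_cases hc : (X * σ * Xᴴ).trace = 0
  · exact ⟨0, by rw [hzero hz hX hc, zero_smul], Or.inl rfl⟩
  -- the quotient by the kernel of the steady state
  set K : Submodule ℂ (n → ℂ) := LinearMap.ker σ.mulVecLin with hK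
  have hmem : ∀ v, v ∈ K ↔ σ *ᵥ v = 0 := fun v => by rw [hK, LinearMap.mem_ker, Matrix.mulVecLin_apply]
  -- `X σ Xᴴ` is a multiple of `σ`, so the quadratic form of `σ` at `Xᴴ v` vanishes along with `σ
  -- v`.
  have hKX : K ≤ K.comap Xᴴ.mulVecLin := fun v hv => by
    rw [Submodule.mem_comap, hmem, Matrix.mulVecLin_apply]
    rw [hmem] at hv
    rw [← hP.dotProduct_mulVec_zero_iff, Matrix.star_mulVec, Matrix.conjTranspose_conjTranspose,
      ← Matrix.dotProduct_mulVec, Matrix.mulVec_mulVec, Matrix.mulVec_mulVec,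
      hconj hz hX, Matrix.smul_mulVec, hv, smul_zero, dotProduct_zero]
  have hntriv : Nontrivial ((n → ℂ) ⧸ K) := by
    rw [Submodule.Quotient.nontrivial_iff]
    intro hK1
    have : σ = 0 := by
      have h : σ.mulVecLin = 0 := LinearMap.ker_eq_top.1 hK1
      have h' := congrArg LinearMap.toMatrix' h
      simpa [← Matrix.toLin'_apply'] using h'
    rw [this, Matrix.trace_zero] at ht
    exact zero_ne_one ht
  -- The form of `L σ = 0` at `v` leaves a sum of nonnegative terms, so every `(V a)ᴴ v` lies in the
  -- kernel; then `(L σ) v = 0` reduces to `σ Gᴴ v = 0`.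
  have hKG : K ≤ K.comap Gᴴ.mulVecLin := fun v hv => by
    rw [Submodule.mem_comap, hmem, Matrix.mulVecLin_apply]
    rw [hmem] at hv
    have hv' : star v ᵥ* σ = 0 := by
      have := congrArg star hv
      rwa [Matrix.star_mulVec, hP.isHermitian.eq, star_zero] at this
    have h1 := h0
    rw [hLX] at h1
    have h2 : ∀ a, σ *ᵥ ((V a)ᴴ *ᵥ v) = 0 := by
      have h3 : ∑ a, star ((V a)ᴴ *ᵥ v) ⬝ᵥ (σ *ᵥ ((V a)ᴴ *ᵥ v)) = 0 := by
        have h4 := congrArg (fun Z => star v ⬝ᵥ (Z *ᵥ v)) h1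
        simp only [Matrix.add_mulVec, Matrix.sum_mulVec, dotProduct_add, dotProduct_sum,
          Matrix.zero_mulVec, dotProduct_zero, ← Matrix.mulVec_mulVec, hv, Matrix.mulVec_zero] at h4
        rw [Matrix.dotProduct_mulVec _ σ, hv', zero_dotProduct, zero_add, zero_add] at h4
        rw [← h4]
        refine Finset.sum_congr rfl fun a _ => ?_
        rw [Matrix.star_mulVec, Matrix.conjTranspose_conjTranspose, Matrix.dotProduct_mulVec _ (V a)]
      intro a
      rw [← hP.dotProduct_mulVec_zero_iff]
      exact (Finset.sum_eq_zero_iff_of_nonneg fun a _ => hP.dotProduct_mulVec_nonneg _).1 h3 a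
        (Finset.mem_univ a)
    have h5 := congrArg (fun Z => Z *ᵥ v) h1
    simpa only [Matrix.add_mulVec, Matrix.sum_mulVec, Matrix.zero_mulVec, ← Matrix.mulVec_mulVec, hv,
      Matrix.mulVec_zero, h2, Finset.sum_const_zero, zero_add, add_zero] using h5
  set x := K.mapQ K Xᴴ.mulVecLin hKX with hx
  -- For `z = 0`, subtracting from `X` the conjugate of an eigenvalue of `Xᴴ` on the quotient gives
  -- another zero mode `Y`. The multiple of `σ` equal to `Y σ Yᴴ` kills a vector outside the kernel
  -- of `σ`, so it is zero and `Y = 0`.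
  by_cases hz0 : z = 0
  · obtain ⟨μ, hμ⟩ := Module.End.exists_eigenvalue x
    obtain ⟨w, hw⟩ := hμ.exists_hasEigenvector
    obtain ⟨v, rfl⟩ := K.mkQ_surjective w
    have hvK : σ *ᵥ v ≠ 0 := fun h => hw.2 (by
      rw [Submodule.mkQ_apply, Submodule.Quotient.mk_eq_zero, hmem, h])
    have h1 : σ *ᵥ ((X - star μ • 1)ᴴ *ᵥ v) = 0 := by
      have h2 := hw.apply_eq_smul
      rw [hx, Submodule.mkQ_apply, Submodule.mapQ_apply, ← Submodule.Quotient.mk_smul,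
        Submodule.Quotient.eq, hmem, Matrix.mulVecLin_apply] at h2
      rw [← h2]
      simp [Matrix.sub_mulVec, Matrix.smul_mulVec]
    have hX' : ∀ Z, ((X - star μ • 1) * L Z).trace = 0 * ((X - star μ • 1) * Z).trace := fun Z => by
      rw [Matrix.sub_mul, Matrix.trace_sub, hX, hz0, Matrix.smul_mul, Matrix.trace_smul,
        Matrix.one_mul, hL.trace_apply]
      simp
    have h2 := congrArg (fun Z => Z *ᵥ v) (hconj Complex.zero_re hX')
    simp only [← Matrix.mulVec_mulVec, h1, Matrix.mulVec_zero, Matrix.smul_mulVec] at h2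
    have h3 := (smul_eq_zero.1 h2.symm).resolve_right hvK
    exact ⟨star μ, sub_eq_zero.1 (hzero Complex.zero_re hX' h3), Or.inr hz0⟩
  -- For `z ≠ 0`, `Xᴴ` is invertible on the nonzero quotient and shifts `Gᴴ` by a multiple of the
  -- identity; comparing traces forces `z = 0`.
  · exfalso
    have hinj : Function.Injective x := by
      rw [injective_iff_map_eq_zero]
      intro w hw
      obtain ⟨v, rfl⟩ := K.mkQ_surjective w
      rw [hx, Submodule.mkQ_apply, Submodule.mapQ_apply, Submodule.Quotient.mk_eq_zero, hmem,
        Matrix.mulVecLin_apply] at hw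
      have h2 := congrArg (fun Z => Z *ᵥ v) (hconj hz hX)
      simp only [← Matrix.mulVec_mulVec, hw, Matrix.mulVec_zero, Matrix.smul_mulVec] at h2
      rw [Submodule.mkQ_apply, Submodule.Quotient.mk_eq_zero, hmem]
      exact (smul_eq_zero.1 h2.symm).resolve_left hc
    have hrel : ∀ w, x (K.mapQ K Gᴴ.mulVecLin hKG w) =
        K.mapQ K Gᴴ.mulVecLin hKG (x w) + (-star z) • x w := by
      intro w
      obtain ⟨v, rfl⟩ := K.mkQ_surjective w
      simp only [hx, Submodule.mkQ_apply, Submodule.mapQ_apply, ← Submodule.Quotient.mk_smul,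
        ← Submodule.Quotient.mk_add]
      rw [Submodule.Quotient.eq, hmem]
      have h1 : σ * Xᴴ * Gᴴ = σ * Gᴴ * Xᴴ - star z • (σ * Xᴴ) := by
        have := congrArg Matrix.conjTranspose (drift_mul_mul_eq hLX hG hP h0 (hz' hz) hX)
        simpa only [Matrix.conjTranspose_sub, Matrix.conjTranspose_mul, Matrix.conjTranspose_smul,
          hP.isHermitian.eq, ← Matrix.mul_assoc] using this
      simp only [Matrix.mulVecLin_apply, Matrix.mulVec_sub, Matrix.mulVec_add, Matrix.mulVec_smul,
        Matrix.mulVec_mulVec, ← Matrix.mul_assoc]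
      rw [h1, Matrix.sub_mulVec, Matrix.smul_mulVec, neg_smul]
      abel
    have := eq_zero_of_shift_relation hinj hrel
    simp [hz0] at this

end Unique
end Davies

/-! ### Finite-dimensional semigroups -/

namespace Davies

set_option linter.unusedSectionVars false

section Abstract

variable {E : Type*} [NormedAddCommGroup E] [NormedSpace ℂ E]

theorem exp_smul_apply_comm [CompleteSpace E] (L : E →L[ℂ] E) (r : ℝ) (v : E) :
    L (NormedSpace.exp (r • L) v) = NormedSpace.exp (r • L) (L v) := by
  have : Commute L (r • L) := (Commute.refl L).smul_right r
  exact congrArg (fun M : E →L[ℂ] E => M v) this.exp_right.eq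

theorem exp_add_smul_apply [CompleteSpace E] (L : E →L[ℂ] E) (a b : ℝ) (v : E) :
    NormedSpace.exp ((a + b) • L) v = NormedSpace.exp (a • L) (NormedSpace.exp (b • L) v) := by
  let _ : NormedAlgebra ℚ (E →L[ℂ] E) := NormedAlgebra.restrictScalars ℚ ℂ _
  rw [add_smul, NormedSpace.exp_add_of_commute (((Commute.refl L).smul_left _).smul_right _)]
  rfl

theorem continuousOn_exp_smul [CompleteSpace E] {L : ℝ → E →L[ℂ] E} {S : Set ℝ}
    (hL : ContinuousOn L S) (c : ℝ) : ContinuousOn (fun s => NormedSpace.exp (c • L s)) S := by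
  let _ : NormedAlgebra ℚ (E →L[ℂ] E) := NormedAlgebra.restrictScalars ℚ ℂ _
  exact NormedSpace.exp_continuous.comp_continuousOn (hL.const_smul c)

theorem exp_apply_eigen [CompleteSpace E] {L : E →L[ℂ] E} {z : ℂ} {v : E} (hv : L v = z • v) :
    NormedSpace.exp L v = Complex.exp z • v := by
  have h1 : ∀ k : ℕ, (L ^ k) v = z ^ k • v := fun k => by
    induction k with
    | zero => simp
    | succ k ih =>
      rw [pow_succ, mul_apply_eq_comp, hv, map_smul, ih, smul_smul, pow_succ, mul_comm]
  have h2 := (NormedSpace.exp_series_hasSum_exp' (𝕂 := ℂ) L).mapL (ContinuousLinearMap.apply ℂ E v)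
  have h3 := (NormedSpace.exp_series_hasSum_exp' (𝕂 := ℂ) z).smul_const v
  refine h2.unique ?_
  rw [Complex.exp_eq_exp_ℂ]
  convert! h3 using 2 with k
  simp [h1, smul_smul]

variable [FiniteDimensional ℂ E]

theorem isUnit_of_injective {M : E →L[ℂ] E} (hM : Function.Injective M) : IsUnit M := by
  let e : E ≃L[ℂ] E := (LinearEquiv.ofInjectiveEndo (M : E →ₗ[ℂ] E) hM).toContinuousLinearEquiv
  have : M = e := by ext v; rfl
  rw [this]
  exact ⟨ContinuousLinearEquiv.toUnit e, rfl⟩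

theorem exists_eigenvector_of_mem_spectrum {M : E →L[ℂ] E} {z : ℂ} (hz : z ∈ spectrum ℂ M) :
    ∃ v, v ≠ 0 ∧ M v = z • v := by
  by_contra! h
  refine hz (isUnit_of_injective ?_)
  rw [injective_iff_map_eq_zero]
  intro v hv
  by_contra hv0
  refine h v hv0 ?_
  rw [sub_apply, sub_eq_zero] at hv
  rw [← hv]
  rfl

/-- A compact family of injective operators is uniformly bounded below. -/
theorem exists_uniform_lower_bound {M : ℝ → E →L[ℂ] E} {S : Set ℝ} (hS : IsCompact S)
    (hM : ContinuousOn M S) (hinj : ∀ s ∈ S, Function.Injective (M s)) :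
    ∃ K : ℝ, 0 < K ∧ ∀ s ∈ S, ∀ v, ‖v‖ ≤ K * ‖M s v‖ := by
  have := FiniteDimensional.complete ℂ E
  have hc : ContinuousOn (fun s => Ring.inverse (M s)) S := fun s hs => by
    obtain ⟨u, hu⟩ := isUnit_of_injective (hinj s hs)
    have h1 : ContinuousAt Ring.inverse (M s) := hu ▸ NormedRing.inverse_continuousAt u
    exact h1.comp_continuousWithinAt (hM s hs)
  obtain ⟨K, hK⟩ := hS.exists_bound_of_continuousOn hc
  refine ⟨|K| + 1, by positivity, fun s hs v => ?_⟩
  have h1 : Ring.inverse (M s) (M s v) = v :=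
    congrArg (fun N : E →L[ℂ] E => N v) (Ring.inverse_mul_cancel _ (isUnit_of_injective (hinj s hs)))
  conv_lhs => rw [← h1]
  refine (ContinuousLinearMap.le_opNorm _ _).trans ?_
  gcongr
  linarith [hK s hs, le_abs_self K]

/-- An eigenspace of `exp B` is invariant under `B`, hence contains an eigenvector of `B`: every
eigenvalue of `exp B` is the exponential of an eigenvalue of `B`. -/
theorem norm_lt_one_of_mem_spectrum_exp {B : E →L[ℂ] E} (hB : ∀ (z : ℂ) (v : E), v ≠ 0 → B v = z • v → z.re < 0)
    {μ : ℂ} (hμ : μ ∈ spectrum ℂ (NormedSpace.exp B)) : ‖μ‖ < 1 := by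
  have := FiniteDimensional.complete ℂ E
  obtain ⟨v, hv, hvμ⟩ := exists_eigenvector_of_mem_spectrum hμ
  set W : Submodule ℂ E :=
    LinearMap.ker ((NormedSpace.exp B : E →L[ℂ] E) - μ • (1 : E →L[ℂ] E) : E →L[ℂ] E).toLinearMap with hW
  have hmem : ∀ w, w ∈ W ↔ NormedSpace.exp B w = μ • w := fun w => by
    rw [hW, LinearMap.mem_ker, ← sub_eq_zero (a := NormedSpace.exp B w)]
    rfl
  have hinv : ∀ w ∈ W, B.toLinearMap w ∈ W := fun w hw => by
    rw [hmem] at hw ⊢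
    have := exp_smul_apply_comm B 1 w
    rw [one_smul] at this
    change NormedSpace.exp B (B w) = μ • B w
    rw [← this, hw, map_smul]
  have : Nontrivial W := ⟨⟨⟨v, (hmem v).2 hvμ⟩, 0, fun h => hv (congrArg Subtype.val h)⟩⟩
  obtain ⟨z, hz⟩ := Module.End.exists_eigenvalue (B.toLinearMap.restrict hinv)
  obtain ⟨w, hw⟩ := hz.exists_hasEigenvector
  have hw1 : B w.1 = z • w.1 := congrArg Subtype.val hw.apply_eq_smul
  have hw0 : w.1 ≠ 0 := fun h => hw.2 (Subtype.ext h)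
  have hw2 := exp_apply_eigen hw1
  rw [(hmem w.1).1 w.2] at hw2
  rw [smul_left_injective ℂ hw0 hw2, Complex.norm_exp, Real.exp_lt_one_iff]
  exact hB z w hw0 hw1

/-- Gelfand's formula: eventually `‖a ^ m‖ < r ^ m` for some `r < 1` above the spectral radius. -/
theorem tendsto_pow_zero_of_spectrum {A : Type*} [NormedRing A] [NormedAlgebra ℂ A] [CompleteSpace A]
    [Nontrivial A] {a : A} (h : ∀ z ∈ spectrum ℂ a, ‖z‖ < 1) :
    Tendsto (fun m : ℕ => ‖a ^ m‖) atTop (𝓝 0) := by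
  have h1 : spectralRadius ℂ a < 1 := by
    have := spectrum.spectralRadius_lt_of_forall_lt a (r := 1) (fun z hz => by exact_mod_cast h z hz)
    exact_mod_cast this
  obtain ⟨r, hr1, hr2⟩ := ENNReal.lt_iff_exists_nnreal_btwn.1 h1
  have hr2' : (r : ℝ) < 1 := by exact_mod_cast hr2
  have h3 := (spectrum.pow_nnnorm_pow_one_div_tendsto_nhds_spectralRadius a).eventually_lt_const hr1
  refine squeeze_zero' (Eventually.of_forall fun _ => norm_nonneg _) ?_
    (tendsto_pow_atTop_nhds_zero_of_lt_one r.coe_nonneg hr2')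
  filter_upwards [h3, eventually_gt_atTop 0] with m hm hm0
  have h4 := ENNReal.rpow_lt_rpow hm (z := (m : ℝ)) (by positivity)
  rw [← ENNReal.rpow_mul, one_div, inv_mul_cancel₀ (by positivity), ENNReal.rpow_one,
    ENNReal.rpow_natCast] at h4
  have h5 : ‖a ^ m‖₊ < r ^ m := by exact_mod_cast h4
  exact_mod_cast h5.le

/-- If the eigenvalues of `L - T` have negative real part, where `L T = T L = 0`, then the semigroup
generated by `L` decays on the kernel of `T`. -/
theorem exists_nat_norm_exp_le [Nontrivial E] {L T : E →L[ℂ] E} (hLT : ∀ v, L (T v) = 0)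
    (hTL : ∀ v, T (L v) = 0) (h : ∀ (z : ℂ) (v : E), v ≠ 0 → (L - T) v = z • v → z.re < 0) {ε : ℝ} (hε : 0 < ε) :
    ∃ m : ℕ, ∀ v, T v = 0 → ‖NormedSpace.exp ((m : ℝ) • L) v‖ ≤ ε * ‖v‖ := by
  have := FiniteDimensional.complete ℂ E
  let _ : NormedAlgebra ℚ (E →L[ℂ] E) := NormedAlgebra.restrictScalars ℚ ℂ _
  have h1 : L * T = 0 := by ext1 v; exact hLT v
  have h2 : T * L = 0 := by ext1 v; exact hTL v
  have hcomm : Commute (L - T) T := by rw [Commute, SemiconjBy, sub_mul, mul_sub, h1, h2]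
  obtain ⟨m, hm⟩ := ((tendsto_pow_zero_of_spectrum fun z hz =>
    norm_lt_one_of_mem_spectrum_exp h hz).eventually_lt_const hε).exists
  refine ⟨m, fun v hv => ?_⟩
  -- `L - T` and `T` commute, so the exponential factors, and `exp T` is trivial on the kernel of
  -- `T`.
  have h3 : NormedSpace.exp ((m : ℝ) • L) = NormedSpace.exp (L - T) ^ m * NormedSpace.exp T ^ m := by
    rw [Nat.cast_smul_eq_nsmul, NormedSpace.exp_nsmul, ← (hcomm.exp_right.exp_left).mul_pow,
      ← NormedSpace.exp_add_of_commute hcomm, sub_add_cancel]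
  have h4 : (NormedSpace.exp T ^ m) v = v := by
    have : (m • T) v = (0 : ℂ) • v := by simp [hv]
    rw [← NormedSpace.exp_nsmul, exp_apply_eigen this]
    simp
  rw [h3, mul_apply_eq_comp, h4]
  exact ContinuousLinearMap.le_of_opNorm_le _ hm.le _

end Abstract

/-! ### Spectrum and decay on traceless matrices -/

section Spectral

variable {n : Type*} [Fintype n] [DecidableEq n] {L : Matrix n n ℂ →L[ℂ] Matrix n n ℂ}
  {σ : Matrix n n ℂ}

/-- The trace as a continuous linear functional. -/
noncomputable def traceCLM : Matrix n n ℂ →L[ℂ] ℂ :=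
  LinearMap.toContinuousLinearMap (Matrix.traceLinearMap n ℂ ℂ)

theorem exists_forall_eq_trace_mul (f : Matrix n n ℂ →ₗ[ℂ] ℂ) :
    ∃ X : Matrix n n ℂ, ∀ Y, f Y = (X * Y).trace := by
  refine ⟨Matrix.of fun i j => f (Matrix.single j i 1), fun Y => ?_⟩
  conv_lhs => rw [Matrix.matrix_eq_sum_single Y]
  simp only [map_sum, Matrix.trace, Matrix.diag_apply, Matrix.mul_apply, Matrix.of_apply]
  rw [Finset.sum_comm]
  refine Finset.sum_congr rfl fun i _ => Finset.sum_congr rfl fun j _ => ?_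
  have : Matrix.single j i (Y j i) = Y j i • Matrix.single j i (1 : ℂ) := by
    rw [Matrix.smul_single, smul_eq_mul, mul_one]
  rw [this, map_smul, smul_eq_mul, mul_comm]

/-- A singular superoperator annihilates a nonzero functional `Tr (X ·)` from the left. -/
theorem exists_trace_mul_apply_eq_zero {M : Matrix n n ℂ →L[ℂ] Matrix n n ℂ}
    (hM : ¬ Function.Injective M) : ∃ X : Matrix n n ℂ, X ≠ 0 ∧ ∀ Y, (X * M Y).trace = 0 := by
  have h1 : ¬ Function.Surjective (M : Matrix n n ℂ →ₗ[ℂ] Matrix n n ℂ) := fun h =>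
    hM (LinearMap.injective_iff_surjective.2 h)
  rw [← LinearMap.range_eq_top] at h1
  obtain ⟨f, hf, hf'⟩ := Submodule.exists_le_ker_of_lt_top _ (lt_top_iff_ne_top.2 h1)
  obtain ⟨X, hX⟩ := exists_forall_eq_trace_mul f
  refine ⟨X, fun h => hf ?_, fun Y => ?_⟩
  · ext1 Y; rw [hX, h, Matrix.zero_mul, Matrix.trace_zero]; rfl
  · rw [← hX]; exact hf' ⟨Y, rfl⟩

/-- The invertible superoperator that coincides with `L` on traceless matrices. -/
noncomputable def traceShift (L : Matrix n n ℂ →L[ℂ] Matrix n n ℂ) :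
    Matrix n n ℂ →L[ℂ] Matrix n n ℂ := L + traceCLM.smulRight (1 : Matrix n n ℂ)

theorem traceShift_apply (X : Matrix n n ℂ) : traceShift L X = L X + X.trace • 1 := rfl

/-- Otherwise a nonzero functional `Tr (X ·)` kills the range. Testing on `σ`, which is mapped to
`1`, gives `Tr X = 0`; hence `X` is a zero mode of the adjoint, a traceless multiple of the
identity. -/
theorem traceShift_injective (hL : IsLindblad L) (hσ : IsSteadyState L σ)
    (hu : ∀ σ', IsSteadyState L σ' → σ' = σ) : Function.Injective (traceShift L) := by
  by_contra hM
  obtain ⟨X, hX, h⟩ := exists_trace_mul_apply_eq_zero hM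
  have h1 := h σ
  rw [traceShift_apply, hσ.2.2, hσ.2.1, zero_add, one_smul, Matrix.mul_one] at h1
  have h2 : ∀ Y, (X * L Y).trace = 0 * (X * Y).trace := fun Y => by
    have := h Y
    rw [traceShift_apply, Matrix.mul_add, Matrix.trace_add, Matrix.mul_smul, Matrix.trace_smul,
      Matrix.mul_one, h1, smul_zero, add_zero] at this
    rw [this, zero_mul]
  obtain ⟨c, rfl, -⟩ := exists_eq_smul_one_of_dual_eigen hL hσ hu Complex.zero_re h2
  rw [Matrix.trace_smul, Matrix.trace_one, smul_eq_mul] at h1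
  rcases mul_eq_zero.1 h1 with h3 | h3
  · exact hX (by rw [h3, zero_smul])
  · have : IsEmpty n := Fintype.card_eq_zero_iff.1 (by exact_mod_cast h3)
    exact hX (Subsingleton.elim _ _)

/-- Extends uniqueness from density matrices to all matrices of trace one. -/
theorem eq_zero_of_apply_eq_zero (hL : IsLindblad L) (hσ : IsSteadyState L σ)
    (hu : ∀ σ', IsSteadyState L σ' → σ' = σ) {Y : Matrix n n ℂ} (h : L Y = 0) (ht : Y.trace = 0) :
    Y = 0 := by
  refine traceShift_injective hL hσ hu ?_
  rw [traceShift_apply, h, ht, zero_smul, zero_add, map_zero]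

theorem exp_smul_apply_eigen {z : ℂ} {Y : Matrix n n ℂ} (hY : L Y = z • Y) (r : ℝ) :
    NormedSpace.exp (r • L) Y = Complex.exp (z * r) • Y := by
  refine exp_apply_eigen (E := Matrix n n ℂ) (L := r • L) ?_
  rw [smul_apply, hY, ← Complex.coe_smul, smul_smul, mul_comm]

theorem traceNorm_eq_zero_iff {X : Matrix n n ℂ} : traceNorm X = 0 ↔ X = 0 :=
  ⟨fun h => norm_le_zero_iff.1 ((norm_le_traceNorm X).trans h.le), fun h => by rw [h, traceNorm_zero]⟩

/-- With a unique steady state, the eigenvalues of a Lindblad generator on traceless matrices have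
negative real part. -/
theorem re_neg_of_traceless_eigen (hL : IsLindblad L) (hσ : IsSteadyState L σ)
    (hu : ∀ σ', IsSteadyState L σ' → σ' = σ) {z : ℂ} {Y : Matrix n n ℂ} (hY : Y ≠ 0)
    (ht : Y.trace = 0) (hLY : L Y = z • Y) : z.re < 0 := by
  have h1 : z.re ≤ 0 := by
    have h := hL.traceNorm_exp_le zero_le_one Y
    rw [exp_smul_apply_eigen hLY, traceNorm_smul, Complex.norm_exp] at h
    have hp : 0 < traceNorm Y := lt_of_le_of_ne (traceNorm_nonneg Y)
      fun h => hY (traceNorm_eq_zero_iff.1 h.symm)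
    have h3 := (mul_le_iff_le_one_left hp).1 h
    simpa using h3
  refine lt_of_le_of_ne h1 fun hz => ?_
  -- An imaginary eigenvalue of `L` is also one of its adjoint, whose eigenvectors are multiples of
  -- the identity; that leaves only `z = 0`.
  have hni : ¬ Function.Injective (L - z • (1 : Matrix n n ℂ →L[ℂ] Matrix n n ℂ)) := fun h =>
    hY (h (by simp [hLY]))
  obtain ⟨X, hX, h⟩ := exists_trace_mul_apply_eq_zero hni
  have h2 : ∀ Y, (X * L Y).trace = z * (X * Y).trace := fun Y => by
    have := h Y
    simp only [sub_apply, smul_apply,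
      one_apply_eq_self, Matrix.mul_sub, Matrix.trace_sub, Matrix.mul_smul,
      Matrix.trace_smul, smul_eq_mul] at this
    exact sub_eq_zero.1 this
  obtain ⟨c, rfl, hc⟩ := exists_eq_smul_one_of_dual_eigen hL hσ hu hz h2
  have hz0 : z = 0 := hc.resolve_left fun h => hX (by rw [h, zero_smul])
  exact hY (eq_zero_of_apply_eq_zero hL hσ hu (by rw [hLY, hz0, zero_smul]) ht)

/-- The semigroup of a Lindblad generator with unique steady state decays on traceless matrices. -/
theorem exists_nat_traceNorm_exp_le (hL : IsLindblad L) (hσ : IsSteadyState L σ)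
    (hu : ∀ σ', IsSteadyState L σ' → σ' = σ) {ε : ℝ} (hε : 0 < ε) :
    ∃ m : ℕ, ∀ Y : Matrix n n ℂ, Y.trace = 0 →
      traceNorm (NormedSpace.exp ((m : ℝ) • L) Y) ≤ ε * traceNorm Y := by
  have hne : Nonempty n := by
    by_contra hn
    rw [not_nonempty_iff] at hn
    have := hσ.2.1
    rw [Subsingleton.elim σ 0, Matrix.trace_zero] at this
    exact zero_ne_one this
  -- Subtracting the projection on the steady state moves the eigenvalue `0` to `-1` and changes
  -- nothing on traceless matrices.
  set T : Matrix n n ℂ →L[ℂ] Matrix n n ℂ := traceCLM.smulRight σ with hT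
  have hTY : ∀ Y, T Y = Y.trace • σ := fun Y => rfl
  have hc : (0 : ℝ) < Fintype.card n := by exact_mod_cast Fintype.card_pos
  obtain ⟨m, hm⟩ := exists_nat_norm_exp_le (E := Matrix n n ℂ) (L := L) (T := T)
    (fun Y => by rw [hTY, map_smul, hσ.2.2, smul_zero])
    (fun Y => by rw [hTY, hL.trace_apply, zero_smul]) (fun z w hw0 hw1 => by
      have htr := congrArg Matrix.trace hw1
      rw [sub_apply, Matrix.trace_sub, hL.trace_apply, hTY, Matrix.trace_smul,
        Matrix.trace_smul, hσ.2.1, smul_eq_mul, smul_eq_mul, mul_one, zero_sub] at htr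
      by_cases ht : w.trace = 0
      · refine re_neg_of_traceless_eigen hL hσ hu hw0 ht ?_
        rw [← hw1, sub_apply, hTY, ht, zero_smul, sub_zero]
      · have : z = -1 := by
          have h3 : (z + 1) * w.trace = 0 := by linear_combination -htr
          exact eq_neg_of_add_eq_zero_left ((mul_eq_zero.1 h3).resolve_right ht)
        rw [this]
        simp) (div_pos hε hc)
  refine ⟨m, fun Y hY => ?_⟩
  calc traceNorm (NormedSpace.exp ((m : ℝ) • L) Y)
      ≤ Fintype.card n * ‖NormedSpace.exp ((m : ℝ) • L) Y‖ := traceNorm_le_norm _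
    _ ≤ Fintype.card n * (ε / Fintype.card n * ‖Y‖) := by
        gcongr
        exact hm Y (by rw [hTY, hY, zero_smul])
    _ = ε * ‖Y‖ := by field_simp
    _ ≤ ε * traceNorm Y := by gcongr; exact norm_le_traceNorm Y

end Spectral

/-! ### Uniform decay and gap over a compact parameter set -/

section Family

variable {n : Type*} [Fintype n] [DecidableEq n] {L : ℝ → Matrix n n ℂ →L[ℂ] Matrix n n ℂ}

theorem IsLindblad.traceNorm_exp_mono {L : Matrix n n ℂ →L[ℂ] Matrix n n ℂ} (hL : IsLindblad L)
    {r t : ℝ} (hrt : r ≤ t) (X : Matrix n n ℂ) :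
    traceNorm (NormedSpace.exp (t • L) X) ≤ traceNorm (NormedSpace.exp (r • L) X) := by
  have h1 := exp_add_smul_apply (E := Matrix n n ℂ) L (t - r) r X
  rw [sub_add_cancel] at h1
  rw [h1]
  exact hL.traceNorm_exp_le (sub_nonneg.2 hrt) _

/-- Uniform decay on traceless matrices for a continuous family of generators over a compact set. -/
theorem exists_uniform_decay {S : Set ℝ} (hS : IsCompact S) (hLc : ContinuousOn L S)
    (hL : ∀ s ∈ S, IsLindblad (L s)) (hu : ∀ s ∈ S, ∃! σ, IsSteadyState (L s) σ) :
    ∃ T : ℝ, 0 < T ∧ ∀ s ∈ S, ∀ Y : Matrix n n ℂ, Y.trace = 0 →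
      traceNorm (NormedSpace.exp (T • L s) Y) ≤ 1 / 2 * traceNorm Y := by
  suffices h : ∃ T : ℝ, 0 < T ∧ ∀ s ∈ S ∩ S, ∀ Y : Matrix n n ℂ, Y.trace = 0 →
      traceNorm (NormedSpace.exp (T • L s) Y) ≤ 1 / 2 * traceNorm Y by simpa using h
  refine hS.induction_on (p := fun S' => ∃ T : ℝ, 0 < T ∧ ∀ s ∈ S' ∩ S, ∀ Y : Matrix n n ℂ,
    Y.trace = 0 → traceNorm (NormedSpace.exp (T • L s) Y) ≤ 1 / 2 * traceNorm Y) ?_ ?_ ?_ ?_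
  · exact ⟨1, one_pos, by simp⟩
  · rintro s t hst ⟨T, hT, h⟩
    exact ⟨T, hT, fun s hs => h s ⟨hst hs.1, hs.2⟩⟩
  · rintro s t ⟨T, hT, h⟩ ⟨T', hT', h'⟩
    refine ⟨max T T', lt_max_of_lt_left hT, fun r hr Y hY => ?_⟩
    rcases hr.1 with h1 | h1
    · exact ((hL r hr.2).traceNorm_exp_mono (le_max_left _ _) Y).trans (h r ⟨h1, hr.2⟩ Y hY)
    · exact ((hL r hr.2).traceNorm_exp_mono (le_max_right _ _) Y).trans (h' r ⟨h1, hr.2⟩ Y hY)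
  · intro s hs
    obtain ⟨σ, hσ, hσu⟩ := hu s hs
    -- The target `1/2` is split: `1/4` at `s`, and `1/4` for the variation of the exponential near
    -- `s`.
    obtain ⟨m, hm⟩ := exists_nat_traceNorm_exp_le (hL s hs) hσ hσu (ε := 1 / 4) (by norm_num)
    set F : ℝ → Matrix n n ℂ →L[ℂ] Matrix n n ℂ := fun r => NormedSpace.exp ((m : ℝ) • L r) with hF
    have hFc : ContinuousWithinAt F S s :=
      continuousOn_exp_smul (E := Matrix n n ℂ) hLc m s hs
    have h1 : ∀ᶠ r in 𝓝[S] s, Fintype.card n * ‖F r - F s‖ < 1 / 4 := by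
      have h2 : Tendsto (fun r => Fintype.card n * ‖F r - F s‖) (𝓝[S] s) (𝓝 (Fintype.card n * ‖F s - F s‖)) :=
        ((hFc.tendsto.sub_const _).norm).const_mul _
      exact h2.eventually_lt_const (by simp)
    obtain ⟨U, hU, hUS⟩ := h1.exists_mem
    -- `m` may be zero; a longer time is allowed because the trace norm decreases.
    refine ⟨U, hU, m + 1, by positivity, fun r hr Y hY => ?_⟩
    refine ((hL r hr.2).traceNorm_exp_mono (r := (m : ℝ)) (by linarith) Y).trans ?_
    have h3 : F r Y = (F r - F s) Y + F s Y := by simp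
    change traceNorm (F r Y) ≤ _
    rw [h3]
    refine (traceNorm_add_le _ _).trans ?_
    have h4 : traceNorm ((F r - F s) Y) ≤ 1 / 4 * traceNorm Y := by
      calc traceNorm ((F r - F s) Y) ≤ Fintype.card n * ‖(F r - F s) Y‖ := traceNorm_le_norm _
        _ ≤ Fintype.card n * (‖F r - F s‖ * ‖Y‖) := by
            gcongr; exact ContinuousLinearMap.le_opNorm _ _
        _ = Fintype.card n * ‖F r - F s‖ * ‖Y‖ := by ring
        _ ≤ 1 / 4 * traceNorm Y := by
            gcongr
            · exact (hUS r hr.1).le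
            · exact norm_le_traceNorm Y
    have h5 := hm Y hY
    linarith

theorem continuousOn_traceShift {S : Set ℝ} (hLc : ContinuousOn L S) :
    ContinuousOn (fun s => traceShift (L s)) S := hLc.add continuousOn_const

/-- The gap of a compact family of generators with unique steady states. -/
theorem exists_uniform_gap {S : Set ℝ} (hS : IsCompact S) (hLc : ContinuousOn L S)
    (hL : ∀ s ∈ S, IsLindblad (L s)) (hu : ∀ s ∈ S, ∃! σ, IsSteadyState (L s) σ) :
    ∃ Δ : ℝ, 0 < Δ ∧ ∀ s ∈ S, ∀ z ∈ spectrum ℂ (L s), z ≠ 0 → Δ ≤ ‖z‖ := by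
  obtain ⟨K, hK0, hK⟩ := exists_uniform_lower_bound (E := Matrix n n ℂ) hS (continuousOn_traceShift hLc)
    fun s hs => by
      obtain ⟨σ, hσ, hσu⟩ := hu s hs
      exact traceShift_injective (hL s hs) hσ hσu
  refine ⟨K⁻¹, by positivity, fun s hs z hz hz0 => ?_⟩
  obtain ⟨Y, hY, hLY⟩ := exists_eigenvector_of_mem_spectrum (E := Matrix n n ℂ) hz
  -- Trace preservation makes an eigenvector with `z ≠ 0` traceless, so `traceShift` acts on it as
  -- `L`.
  have ht : Y.trace = 0 := by
    have := congrArg Matrix.trace hLY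
    rw [(hL s hs).trace_apply, Matrix.trace_smul, smul_eq_mul] at this
    exact (mul_eq_zero.1 this.symm).resolve_left hz0
  have h2 := hK s hs Y
  rw [traceShift_apply, ht, zero_smul, add_zero, hLY, norm_smul] at h2
  have hYp : 0 < ‖Y‖ := norm_pos_iff.2 hY
  have h3 : 1 ≤ K * ‖z‖ := by
    by_contra! h
    nlinarith
  rw [inv_le_iff_one_le_mul₀ (by positivity)]
  linarith

end Family
end Davies

/-! ### Smooth functions flat at the final point -/

namespace Davies

set_option linter.unusedSectionVars false

open scoped ContDiff

section Flat

variable {E F : Type*} [NormedAddCommGroup E] [NormedSpace ℝ E] [NormedAddCommGroup F] [NormedSpace ℝ F]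

theorem isLittleO_of_iteratedDerivWithin_eq_zero {f : ℝ → E} {a b : ℝ} {k : ℕ} (hab : a < b)
    (hf : ContDiffOn ℝ ∞ f (Icc a b))
    (h : ∀ j : ℕ, 1 ≤ j → j ≤ k → iteratedDerivWithin j f (Icc a b) b = 0) :
    (fun s => f s - f b) =o[𝓝[Icc a b] b] fun s => (s - b) ^ k := by
  have h1 := taylor_isLittleO (n := k) (convex_Icc a b) (right_mem_Icc.2 hab.le)
    (hf.of_le (by exact_mod_cast le_top))
  refine h1.congr_left fun s => ?_
  rw [taylor_within_apply, Finset.sum_range_succ', Finset.sum_eq_zero fun j hj => ?_]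
  · simp
  · rw [h (j + 1) (by omega) (by simpa using hj), smul_zero]

theorem eq_zero_of_pow_smul_isLittleO {D : E} {a b : ℝ} {j : ℕ} (hab : a < b)
    (h : (fun s : ℝ => (s - b) ^ j • D) =o[𝓝[Icc a b] b] fun s => (s - b) ^ j) : D = 0 := by
  by_contra hD
  have hD' : 0 < ‖D‖ := norm_pos_iff.2 hD
  have h1 := h.def (c := ‖D‖ / 2) (by positivity)
  have h2 : ∀ᶠ s in 𝓝[<] b, ‖(s - b) ^ j • D‖ ≤ ‖D‖ / 2 * ‖(s - b) ^ j‖ :=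
    h1.filter_mono (by
      rw [← nhdsWithin_Ico_eq_nhdsLT hab]; exact nhdsWithin_mono b Ico_subset_Icc_self)
  obtain ⟨s, hs, hsb⟩ := (h2.and self_mem_nhdsWithin).exists
  have hp : 0 < ‖(s - b) ^ j‖ := norm_pos_iff.2 (pow_ne_zero _ (sub_ne_zero.2 (ne_of_lt hsb)))
  rw [norm_smul] at hs
  nlinarith

/-- Converse of the Taylor estimate: the first surviving term would be a nonzero multiple of `(s -
b) ^ j` that is negligible against `(s - b) ^ j`. -/
theorem iteratedDerivWithin_eq_zero_of_isLittleO {f : ℝ → E} {a b : ℝ} {k : ℕ} (hab : a < b)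
    (hf : ContDiffOn ℝ ∞ f (Icc a b))
    (h : (fun s => f s - f b) =o[𝓝[Icc a b] b] fun s => (s - b) ^ k) :
    ∀ j : ℕ, 1 ≤ j → j ≤ k → iteratedDerivWithin j f (Icc a b) b = 0 := by
  intro j
  induction j using Nat.strong_induction_on with
  | _ j ih =>
    intro hj hjk
    have h1 := taylor_isLittleO (n := j) (convex_Icc a b) (right_mem_Icc.2 hab.le)
      (hf.of_le (by exact_mod_cast le_top))
    obtain ⟨i, rfl⟩ : ∃ i, j = i + 1 := ⟨j - 1, by omega⟩
    have h2 : (fun s : ℝ => (s - b) ^ k) =O[𝓝[Icc a b] b] fun s => (s - b) ^ (i + 1) := by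
      obtain ⟨d, rfl⟩ := Nat.exists_eq_add_of_le hjk
      have h3 : (fun s : ℝ => (s - b) ^ d) =O[𝓝[Icc a b] b] fun _ => (1 : ℝ) :=
        (Continuous.tendsto (by fun_prop : Continuous fun s : ℝ => (s - b) ^ d) b).isBigO_one ℝ
          |>.mono nhdsWithin_le_nhds
      simpa [pow_add] using (Asymptotics.isBigO_refl (fun s : ℝ => (s - b) ^ (i + 1)) _).mul h3
    have h4 := (h.trans_isBigO h2).sub h1
    have h5 : (fun s : ℝ => (s - b) ^ (i + 1) •
        (((i + 1).factorial : ℝ)⁻¹ • iteratedDerivWithin (i + 1) f (Icc a b) b)) =o[𝓝[Icc a b] b]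
        fun s => (s - b) ^ (i + 1) := by
      refine h4.congr_left fun s => ?_
      rw [taylor_within_apply, Finset.sum_range_succ, Finset.sum_range_succ',
        Finset.sum_eq_zero fun l hl => ?_]
      · simp [smul_smul, mul_comm]
      · rw [Finset.mem_range] at hl
        rw [ih (l + 1) (by omega) (by omega) (by omega), smul_zero]
    have h6 := eq_zero_of_pow_smul_isLittleO hab h5
    exact (smul_eq_zero.1 h6).resolve_left (by positivity)

/-- A smooth function on `[0, 1]` whose derivatives of orders `1, …, k` vanish at `1`. -/
def SmoothFlat (k : ℕ) (f : ℝ → E) : Prop :=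
  ContDiffOn ℝ ∞ f (Icc 0 1) ∧ (fun s => f s - f 1) =o[𝓝[Icc 0 1] 1] fun s : ℝ => (s - 1) ^ k

namespace SmoothFlat

variable {k : ℕ} {f : ℝ → E} {g : ℝ → F}

theorem contDiffOn_div (hf : SmoothFlat k f) {τ : ℝ} (hτ : 0 < τ) :
    ContDiffOn ℝ ∞ (fun t => f (t / τ)) (Icc 0 τ) :=
  hf.1.comp (by fun_prop) fun t ht => ⟨div_nonneg ht.1 hτ.le, (div_le_one hτ).2 ht.2⟩

theorem iteratedDerivWithin_div (hf : SmoothFlat k f) {τ : ℝ} (hτ : 0 < τ) (j : ℕ) (h1 : 1 ≤ j)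
    (h2 : j ≤ k) : iteratedDerivWithin j (fun t => f (t / τ)) (Icc 0 τ) τ = 0 := by
  refine iteratedDerivWithin_eq_zero_of_isLittleO hτ (hf.contDiffOn_div hτ) ?_ j h1 h2
  have ht : Tendsto (fun t : ℝ => t / τ) (𝓝[Icc 0 τ] τ) (𝓝[Icc 0 1] 1) := by
    refine tendsto_nhdsWithin_iff.2 ⟨?_, ?_⟩
    · have : Continuous fun t : ℝ => t / τ := by fun_prop
      simpa [div_self hτ.ne'] using this.continuousWithinAt.tendsto (x := τ) (s := Icc 0 τ)
    · filter_upwards [self_mem_nhdsWithin] with t ht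
      exact ⟨div_nonneg ht.1 hτ.le, (div_le_one hτ).2 ht.2⟩
  have h3 := hf.2.comp_tendsto ht
  rw [div_self hτ.ne']
  refine h3.trans_isBigO ?_
  have : ((fun s : ℝ => (s - 1) ^ k) ∘ fun t => t / τ) = fun t => (τ⁻¹) ^ k * (t - τ) ^ k := by
    ext t
    simp only [Function.comp, ← mul_pow]
    congr 1
    field_simp
  rw [this]
  exact Asymptotics.isBigO_const_mul_self _ _ _

theorem iteratedDerivWithin_eq_zero (hf : SmoothFlat k f) (j : ℕ) (h1 : 1 ≤ j) (h2 : j ≤ k) :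
    iteratedDerivWithin j f (Icc 0 1) 1 = 0 :=
  iteratedDerivWithin_eq_zero_of_isLittleO one_pos hf.1 hf.2 j h1 h2

theorem of_iteratedDerivWithin (hf : ContDiffOn ℝ ∞ f (Icc 0 1))
    (h : ∀ j : ℕ, 1 ≤ j → j ≤ k → iteratedDerivWithin j f (Icc 0 1) 1 = 0) : SmoothFlat k f :=
  ⟨hf, isLittleO_of_iteratedDerivWithin_eq_zero one_pos hf h⟩

theorem const (c : E) : SmoothFlat k fun _ : ℝ => c := by
  refine ⟨contDiffOn_const, ?_⟩
  simp

theorem congr (hf : SmoothFlat k f) {f' : ℝ → E} (h : ∀ s ∈ Icc (0 : ℝ) 1, f' s = f s) :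
    SmoothFlat k f' := by
  refine ⟨hf.1.congr h, hf.2.congr' ?_ EventuallyEq.rfl⟩
  filter_upwards [self_mem_nhdsWithin] with s hs
  rw [h s hs, h 1 (right_mem_Icc.2 zero_le_one)]

/-- Here the little-o form pays off: flatness of the composite uses only that `Ψ` is differentiable
at `f 1`. -/
theorem comp {Ψ : E → F} (hf : SmoothFlat k f) (hΨ : ∀ s ∈ Icc (0 : ℝ) 1, ContDiffAt ℝ ∞ Ψ (f s)) :
    SmoothFlat k fun s => Ψ (f s) := by
  have h1 : (1 : ℝ) ∈ Icc (0 : ℝ) 1 := right_mem_Icc.2 zero_le_one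
  refine ⟨fun s hs => (hΨ s hs).comp_contDiffWithinAt s (hf.1 s hs), ?_⟩
  have h2 := ((hΨ 1 h1).differentiableAt (by simp)).hasFDerivAt.isBigO_sub
  have h3 : Tendsto f (𝓝[Icc 0 1] 1) (𝓝 (f 1)) := (hf.1.continuousOn 1 h1).tendsto
  exact (h2.comp_tendsto h3).trans_isLittleO hf.2

theorem prodMk (hf : SmoothFlat k f) (hg : SmoothFlat k g) : SmoothFlat k fun s => (f s, g s) :=
  ⟨hf.1.prodMk hg.1, hf.2.prod_left hg.2⟩

theorem comp₂ {G : Type*} [NormedAddCommGroup G] [NormedSpace ℝ G] {Ψ : E → F → G}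
    (hf : SmoothFlat k f) (hg : SmoothFlat k g)
    (hΨ : ContDiff ℝ ∞ fun p : E × F => Ψ p.1 p.2) : SmoothFlat k fun s => Ψ (f s) (g s) :=
  (hf.prodMk hg).comp (Ψ := fun p : E × F => Ψ p.1 p.2) fun _ _ => hΨ.contDiffAt

theorem add {f' : ℝ → E} (hf : SmoothFlat k f) (hf' : SmoothFlat k f') :
    SmoothFlat k fun s => f s + f' s := hf.comp₂ hf' (by fun_prop)

theorem sum {κ : Type*} {S : Finset κ} {f : κ → ℝ → E} (hf : ∀ i ∈ S, SmoothFlat k (f i)) :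
    SmoothFlat k fun s => ∑ i ∈ S, f i s := by
  classical
  induction S using Finset.induction_on with
  | empty => simpa using const (0 : E)
  | insert i S hi ih =>
    simp only [Finset.sum_insert hi]
    exact (hf i (Finset.mem_insert_self _ _)).add (ih fun j hj => hf j (Finset.mem_insert_of_mem hj))

end SmoothFlat

theorem isLittleO_derivWithin {f : ℝ → E} {k : ℕ} (hf : SmoothFlat (k + 1) f) :
    (fun s => derivWithin f (Icc 0 1) s) =o[𝓝[Icc 0 1] 1] fun s : ℝ => (s - 1) ^ k := by
  have h0 := hf.iteratedDerivWithin_eq_zero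
  have hd : ContDiffOn ℝ ∞ (derivWithin f (Icc 0 1)) (Icc 0 1) :=
    hf.1.derivWithin (uniqueDiffOn_Icc one_pos) (by simp)
  have h1 : derivWithin f (Icc 0 1) 1 = 0 := by
    have := h0 1 le_rfl (by omega)
    rwa [iteratedDerivWithin_one] at this
  have h2 := isLittleO_of_iteratedDerivWithin_eq_zero (k := k) one_pos hd fun j hj hjk => by
    rw [← iteratedDerivWithin_succ']
    exact h0 (j + 1) (by omega) (by omega)
  simpa [h1] using h2

/-- The filter sees the point `1` itself, so the estimate with constant `‖f 1‖ / 2` may be read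
there; `0 ^ k ≤ 1` covers `k = 0` as well. -/
theorem eq_zero_of_isLittleO_pow {f : ℝ → E} {k : ℕ}
    (h : f =o[𝓝[Icc 0 1] 1] fun s : ℝ => (s - 1) ^ k) : f 1 = 0 := by
  by_contra h0
  have hp : 0 < ‖f 1‖ := norm_pos_iff.2 h0
  have h1 := (h.def (c := ‖f 1‖ / 2) (by positivity)).self_of_nhdsWithin (right_mem_Icc.2 zero_le_one)
  have h2 : ‖((1 : ℝ) - 1) ^ k‖ ≤ 1 := by
    rw [sub_self, norm_pow]
    exact pow_le_one₀ (norm_nonneg _) (by simp)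
  have h3 := mul_le_of_le_one_right (by positivity : 0 ≤ ‖f 1‖ / 2) h2
  linarith

/-- Inversion preserves smoothness and flatness. -/
theorem SmoothFlat.ringInverse {E : Type*} [NormedAddCommGroup E] [NormedSpace ℂ E]
    [FiniteDimensional ℂ E] {k : ℕ} {M : ℝ → E →L[ℂ] E} (hM : SmoothFlat k M)
    (hinj : ∀ s ∈ Icc (0 : ℝ) 1, Function.Injective (M s)) :
    SmoothFlat k fun s => Ring.inverse (M s) := by
  have := FiniteDimensional.complete ℂ E
  refine hM.comp fun s hs => ?_
  obtain ⟨u, hu⟩ := isUnit_of_injective (hinj s hs)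
  exact hu ▸ contDiffAt_ringInverse ℝ u

end Flat
end Davies

/-! ### Adiabatic expansion and boundary cancellation -/

namespace Davies

set_option linter.unusedSectionVars false

open scoped ContDiff

section Adiabatic

variable {n : Type*} [Fintype n] [DecidableEq n]

theorem hasDerivWithinAt_clm_comp {E F : Type*} [NormedAddCommGroup E] [NormedSpace ℂ E]
    [NormedAddCommGroup F] [NormedSpace ℂ F] (T : E →L[ℂ] F) {R : ℝ → E} {R' : E} {S : Set ℝ} {t : ℝ}
    (h : HasDerivWithinAt R R' S t) : HasDerivWithinAt (fun t => T (R t)) (T R') S t :=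
  (T.restrictScalars ℝ).hasFDerivAt.comp_hasDerivWithinAt t h

theorem contDiffOn_clm_apply {E : Type*} [NormedAddCommGroup E] [NormedSpace ℂ E]
    {N : ℝ → E →L[ℂ] E} {v : ℝ → E} {S : Set ℝ} (hN : ContDiffOn ℝ ∞ N S) (hv : ContDiffOn ℝ ∞ v S) :
    ContDiffOn ℝ ∞ (fun s => N s (v s)) S :=
  ContDiffOn.clm_apply (f := fun s => (N s).restrictScalars ℝ)
    (((ContinuousLinearMap.restrictScalarsL ℂ E E ℝ ℝ).contDiff (n := ∞)).comp_contDiffOn hN) hv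

theorem isLittleO_clm_apply {E : Type*} [NormedAddCommGroup E] [NormedSpace ℂ E]
    {N : ℝ → E →L[ℂ] E} {v : ℝ → E} {g : ℝ → ℝ} {S : Set ℝ} {a : ℝ} (hN : ContinuousWithinAt N S a)
    (hv : v =o[𝓝[S] a] g) : (fun s => N s (v s)) =o[𝓝[S] a] g := by
  have h1 : N =O[𝓝[S] a] fun _ => (1 : ℝ) := hN.tendsto.isBigO_one ℝ
  have h2 : (fun s => N s (v s)) =O[𝓝[S] a] fun s => ‖N s‖ * ‖v s‖ :=
    Asymptotics.isBigO_of_le _ fun s => by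
      rw [Real.norm_of_nonneg (by positivity)]; exact (N s).le_opNorm _
  refine h2.trans_isLittleO ?_
  simpa using h1.norm_left.mul_isLittleO hv.norm_left

theorem SmoothFlat.clm_apply_const {E : Type*} [NormedAddCommGroup E] [NormedSpace ℂ E] {k : ℕ}
    {N : ℝ → E →L[ℂ] E} (hN : SmoothFlat k N) (v : E) : SmoothFlat k fun s => N s v := by
  refine hN.comp (Ψ := fun M : E →L[ℂ] E => M v) fun s _ => ?_
  exact (((ContinuousLinearMap.apply ℂ E v).restrictScalars ℝ).contDiff).contDiffAt

theorem hasDerivWithinAt_trace {R : ℝ → Matrix n n ℂ} {R' : Matrix n n ℂ} {S : Set ℝ} {t : ℝ}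
    (h : HasDerivWithinAt R R' S t) : HasDerivWithinAt (fun t => (R t).trace) R'.trace S t :=
  hasDerivWithinAt_clm_comp (E := Matrix n n ℂ) traceCLM h

theorem trace_eq_of_hasDerivWithinAt {R : ℝ → Matrix n n ℂ} {R' : ℝ → Matrix n n ℂ} {a b : ℝ}
    (h : ∀ t ∈ Icc a b, HasDerivWithinAt R (R' t) (Icc a b) t) (h0 : ∀ t ∈ Icc a b, (R' t).trace = 0) :
    ∀ t ∈ Icc a b, (R t).trace = (R a).trace := by
  refine constant_of_has_deriv_right_zero
    (fun t ht => (hasDerivWithinAt_trace (h t ht)).continuousWithinAt) fun t ht => ?_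
  have h1 := hasDerivWithinAt_trace (h t (Ico_subset_Icc_self ht))
  rw [h0 t (Ico_subset_Icc_self ht)] at h1
  exact h1.mono_of_mem_nhdsWithin (Icc_mem_nhdsGE_of_mem ht)

/-- A slowly varying family of generators decays traceless solutions, up to the size of the
perturbation. -/
theorem traceNorm_le_decay {Λ : ℝ → Matrix n n ℂ →L[ℂ] Matrix n n ℂ} {R b : ℝ → Matrix n n ℂ}
    {B T τ : ℝ} (hT : 0 < T) (hτ : 0 ≤ τ) (hΛ : ∀ t ∈ Icc 0 τ, IsLindblad (Λ t))
    (hdec : ∀ t ∈ Icc 0 τ, ∀ Y : Matrix n n ℂ, Y.trace = 0 →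
      traceNorm (NormedSpace.exp (T • Λ t) Y) ≤ 1 / 2 * traceNorm Y)
    (hvar : ∀ t ∈ Icc 0 τ, ∀ t' ∈ Icc 0 τ, |t - t'| ≤ T →
      T * (Fintype.card n * ‖Λ t - Λ t'‖) ≤ 1 / 4)
    (hR : ∀ t ∈ Icc 0 τ, HasDerivWithinAt R (Λ t (R t) + b t) (Icc 0 τ) t)
    (hb : ∀ t ∈ Icc 0 τ, traceNorm (b t) ≤ B) (hb0 : ∀ t ∈ Icc 0 τ, (b t).trace = 0)
    (hR0 : (R 0).trace = 0) :
    traceNorm (R τ) ≤ (3 / 4) ^ ⌊τ / T⌋₊ * traceNorm (R 0) + 6 * B * T := by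
  have hB : 0 ≤ B := (traceNorm_nonneg _).trans (hb 0 ⟨le_rfl, hτ⟩)
  have htr : ∀ t ∈ Icc 0 τ, (R t).trace = 0 := fun t ht => by
    rw [trace_eq_of_hasDerivWithinAt hR (fun t ht => by
      rw [Matrix.trace_add, (hΛ t ht).trace_apply, hb0 t ht, add_zero]) t ht, hR0]
  have hsub : ∀ {t₀ t₁ : ℝ}, 0 ≤ t₀ → t₁ ≤ τ → Icc t₀ t₁ ⊆ Icc 0 τ := fun h0 h1 =>
    Icc_subset_Icc h0 h1
  have hgrow : ∀ {t₀ t₁ : ℝ}, 0 ≤ t₀ → t₁ ≤ τ → ∀ t ∈ Icc t₀ t₁,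
      traceNorm (R t) ≤ traceNorm (R t₀) + B * (t - t₀) := fun h0 h1 =>
    traceNorm_le_of_hasDerivWithinAt (fun t ht => hΛ t (hsub h0 h1 ht))
      (fun t ht => (hR t (hsub h0 h1 ht)).mono (hsub h0 h1)) (fun t ht => hb t (hsub h0 h1 ht))
  have hstep : ∀ t₀ : ℝ, 0 ≤ t₀ → t₀ + T ≤ τ →
      traceNorm (R (t₀ + T)) ≤ 3 / 4 * traceNorm (R t₀) + 5 / 4 * B * T := fun t₀ h0 h1 => by
    have hm0 : t₀ ∈ Icc 0 τ := ⟨h0, by linarith⟩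
    -- Bound for the error made on a window of length `T` by freezing the generator at `t₀`. Over
    -- the window it costs a quarter of `‖R t₀‖₁ + B T`; with the decay by `1/2` this gives the
    -- factors `3/4` and `5/4`.
    set c : ℝ := 1 / (4 * T) * (traceNorm (R t₀) + B * T) with hc
    have hq : ∀ t ∈ Icc t₀ (t₀ + T), traceNorm ((Λ t - Λ t₀) (R t)) ≤ c := fun t ht => by
      have h2 := hvar t (hsub h0 h1 ht) t₀ hm0 (by
        rw [abs_of_nonneg (by linarith [ht.1])]; linarith [ht.2])
      have h3 : Fintype.card n * ‖Λ t - Λ t₀‖ ≤ 1 / (4 * T) := by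
        rw [le_div_iff₀ (by positivity)]; linarith
      have h4 : traceNorm (R t) ≤ traceNorm (R t₀) + B * T :=
        (hgrow h0 h1 t ht).trans (by gcongr; linarith [ht.2])
      calc traceNorm ((Λ t - Λ t₀) (R t)) ≤ Fintype.card n * ‖(Λ t - Λ t₀) (R t)‖ := traceNorm_le_norm _
        _ ≤ Fintype.card n * (‖Λ t - Λ t₀‖ * ‖R t‖) := by
            gcongr; exact ContinuousLinearMap.le_opNorm _ _
        _ = Fintype.card n * ‖Λ t - Λ t₀‖ * ‖R t‖ := by ring
        _ ≤ c := by
            rw [hc]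
            gcongr
            exact (norm_le_traceNorm _).trans h4
    have h5 := traceNorm_le_of_hasDerivWithinAt (L := fun _ => Λ t₀)
      (R := fun t => R t - NormedSpace.exp ((t - t₀) • Λ t₀) (R t₀))
      (b := fun t => (Λ t - Λ t₀) (R t) + b t) (B := c + B) (t₀ := t₀) (t₁ := t₀ + T)
      (fun _ _ => hΛ t₀ hm0) (fun t ht => by
        have h6 := (hR t (hsub h0 h1 ht)).mono (hsub h0 h1)
        have h7 := (hasDerivAt_exp_smul_apply (Λ t₀) (R t₀) (t - t₀)).comp_sub_const t t₀
        convert! h6.sub h7.hasDerivWithinAt using 1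
        rw [map_sub, sub_apply]
        abel)
      (fun t ht => (traceNorm_add_le _ _).trans (add_le_add (hq t ht) (hb t (hsub h0 h1 ht))))
      (t₀ + T) ⟨by linarith, le_rfl⟩
    simp only [sub_self, exp_zero_smul_apply, traceNorm_zero, zero_add, add_sub_cancel_left] at h5
    have h6 : R (t₀ + T) = (R (t₀ + T) - NormedSpace.exp (T • Λ t₀) (R t₀)) +
        NormedSpace.exp (T • Λ t₀) (R t₀) := by rw [sub_add_cancel]
    rw [h6]
    refine (traceNorm_add_le _ _).trans ((add_le_add h5 (hdec t₀ hm0 _ (htr t₀ hm0))).trans (le_of_eq ?_))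
    rw [hc]
    field_simp
    ring
  -- `5 B T` is the fixed point of `x ↦ (3/4) x + (5/4) B T`. The last incomplete window adds
  -- another `B T`, hence `6 B T`.
  have hiter : ∀ m : ℕ, (m : ℝ) * T ≤ τ →
      traceNorm (R (m * T)) ≤ (3 / 4) ^ m * traceNorm (R 0) + 5 * B * T := fun m => by
    induction m with
    | zero => intro _; simp; positivity
    | succ m ih =>
      intro hm
      push_cast at hm ⊢
      have h1 := ih (by linarith)
      have h2 := hstep (m * T) (by positivity) (by linarith)
      rw [add_mul, one_mul]
      refine h2.trans ?_
      rw [pow_succ]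
      linarith
  have hfl : (⌊τ / T⌋₊ : ℝ) * T ≤ τ := by
    rw [← le_div_iff₀ hT]; exact Nat.floor_le (by positivity)
  have hfl' : τ - (⌊τ / T⌋₊ : ℝ) * T ≤ T := by
    have := (Nat.lt_floor_add_one (τ / T)).le
    rw [div_le_iff₀ hT] at this
    linarith
  have h1 := hgrow (t₀ := ⌊τ / T⌋₊ * T) (t₁ := τ) (by positivity) le_rfl τ ⟨hfl, le_rfl⟩
  have h2 := hiter _ hfl
  have h3 : B * (τ - ⌊τ / T⌋₊ * T) ≤ B * T := by gcongr
  linarith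

/-- `τ` is at most `T` times `⌊τ/T⌋₊ + 1`, and geometric decay beats powers; the factor `4/3` shifts
the exponent by one. -/
theorem exists_pow_floor_mul_pow_le {T : ℝ} (hT : 0 < T) (k : ℕ) :
    ∃ C : ℝ, ∀ τ : ℝ, 0 < τ → (3 / 4 : ℝ) ^ ⌊τ / T⌋₊ * τ ^ k ≤ C := by
  have h := tendsto_pow_const_mul_const_pow_of_abs_lt_one k (r := 3 / 4) (by norm_num [abs_of_pos])
  obtain ⟨K, hK⟩ := h.bddAbove_range
  refine ⟨4 / 3 * T ^ k * K, fun τ hτ => ?_⟩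
  have h1 : τ ≤ T * ((⌊τ / T⌋₊ + 1 : ℕ) : ℝ) := by
    have := (Nat.lt_floor_add_one (τ / T)).le
    rw [div_le_iff₀ hT] at this
    push_cast
    linarith
  have h2 := hK ⟨⌊τ / T⌋₊ + 1, rfl⟩
  simp only at h2
  calc (3 / 4 : ℝ) ^ ⌊τ / T⌋₊ * τ ^ k
      ≤ (3 / 4 : ℝ) ^ ⌊τ / T⌋₊ * (T * ((⌊τ / T⌋₊ + 1 : ℕ) : ℝ)) ^ k := by gcongr
    _ = 4 / 3 * T ^ k * (((⌊τ / T⌋₊ + 1 : ℕ) : ℝ) ^ k * (3 / 4) ^ (⌊τ / T⌋₊ + 1)) := by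
        rw [mul_pow, pow_succ (3 / 4 : ℝ)]; ring
    _ ≤ _ := by gcongr

/-- The coefficients of the adiabatic expansion of the solution around the steady state. -/
noncomputable def adiabaticCoeff (L : ℝ → Matrix n n ℂ →L[ℂ] Matrix n n ℂ) : ℕ → ℝ → Matrix n n ℂ
  | 0 => fun s => Ring.inverse (traceShift (L s)) 1
  | m + 1 => fun s => Ring.inverse (traceShift (L s)) (derivWithin (adiabaticCoeff L m) (Icc 0 1) s)

section Coeff

variable {L : ℝ → Matrix n n ℂ →L[ℂ] Matrix n n ℂ} {k : ℕ}

theorem smoothFlat_inverse_traceShift (hflat : SmoothFlat k L) (hL : ∀ s ∈ Icc (0 : ℝ) 1, IsLindblad (L s))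
    (hu : ∀ s ∈ Icc (0 : ℝ) 1, ∃! σ, IsSteadyState (L s) σ) :
    SmoothFlat k fun s => Ring.inverse (traceShift (L s)) := by
  refine SmoothFlat.ringInverse (E := Matrix n n ℂ) (hflat.add (SmoothFlat.const _)) fun s hs => ?_
  obtain ⟨σ, hσ, hσu⟩ := hu s hs
  exact traceShift_injective (hL s hs) hσ hσu

theorem inverse_traceShift_apply {L : Matrix n n ℂ →L[ℂ] Matrix n n ℂ} (hL : IsLindblad L)
    (hu : ∃! σ, IsSteadyState L σ) (X : Matrix n n ℂ) :
    Ring.inverse (traceShift L) (traceShift L X) = X := by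
  obtain ⟨σ, hσ, hσu⟩ := hu
  exact congrArg (fun M : Matrix n n ℂ →L[ℂ] Matrix n n ℂ => M X)
    (Ring.inverse_mul_cancel _ (isUnit_of_injective (E := Matrix n n ℂ) (traceShift_injective hL hσ hσu)))

theorem traceShift_inverse_apply {L : Matrix n n ℂ →L[ℂ] Matrix n n ℂ} (hL : IsLindblad L)
    (hu : ∃! σ, IsSteadyState L σ) (X : Matrix n n ℂ) :
    traceShift L (Ring.inverse (traceShift L) X) = X := by
  obtain ⟨σ, hσ, hσu⟩ := hu
  exact congrArg (fun M : Matrix n n ℂ →L[ℂ] Matrix n n ℂ => M X)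
    (Ring.mul_inverse_cancel _ (isUnit_of_injective (E := Matrix n n ℂ) (traceShift_injective hL hσ hσu)))

/-- The inverse of the generator on traceless matrices. -/
theorem inverse_traceShift_of_trace_eq_zero {L : Matrix n n ℂ →L[ℂ] Matrix n n ℂ} (hL : IsLindblad L)
    (hu : ∃! σ, IsSteadyState L σ) {X : Matrix n n ℂ} (hX : X.trace = 0) :
    (Ring.inverse (traceShift L) X).trace = 0 ∧ L (Ring.inverse (traceShift L) X) = X := by
  have h1 := traceShift_inverse_apply hL hu X
  rw [traceShift_apply] at h1
  have h2 := congrArg Matrix.trace h1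
  rw [Matrix.trace_add, hL.trace_apply, zero_add, hX, Matrix.trace_smul, Matrix.trace_one,
    smul_eq_mul] at h2
  have h3 : (Ring.inverse (traceShift L) X).trace = 0 := by
    refine (mul_eq_zero.1 h2).resolve_right fun h => ?_
    have : IsEmpty n := Fintype.card_eq_zero_iff.1 (by exact_mod_cast h)
    obtain ⟨σ, hσ, -⟩ := hu
    have h4 := hσ.2.1
    rw [Subsingleton.elim σ 0, Matrix.trace_zero] at h4
    exact zero_ne_one h4
  exact ⟨h3, by rwa [h3, zero_smul, add_zero] at h1⟩

/-- `traceShift L` maps the steady state to `1`, so the zeroth adiabatic coefficient is the steady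
state and inherits the smoothness of the inverse. -/
theorem inverse_traceShift_one {L : Matrix n n ℂ →L[ℂ] Matrix n n ℂ} (hL : IsLindblad L)
    (hu : ∃! σ, IsSteadyState L σ) {σ : Matrix n n ℂ} (hσ : IsSteadyState L σ) :
    Ring.inverse (traceShift L) 1 = σ := by
  rw [← inverse_traceShift_apply hL hu σ, traceShift_apply, hσ.2.2, hσ.2.1, one_smul, zero_add]

variable (hflat : SmoothFlat k L) (hL : ∀ s ∈ Icc (0 : ℝ) 1, IsLindblad (L s))
  (hu : ∀ s ∈ Icc (0 : ℝ) 1, ∃! σ, IsSteadyState (L s) σ)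

include hflat hL hu

theorem contDiffOn_adiabaticCoeff (m : ℕ) : ContDiffOn ℝ ∞ (adiabaticCoeff L m) (Icc 0 1) := by
  have h := (smoothFlat_inverse_traceShift hflat hL hu).1
  induction m with
  | zero => exact contDiffOn_clm_apply (E := Matrix n n ℂ) h contDiffOn_const
  | succ m ih => exact contDiffOn_clm_apply (E := Matrix n n ℂ) h (ih.derivWithin (uniqueDiffOn_Icc one_pos) (by simp))

theorem hasDerivWithinAt_adiabaticCoeff (m : ℕ) {s : ℝ} (hs : s ∈ Icc (0 : ℝ) 1) :
    HasDerivWithinAt (adiabaticCoeff L m) (derivWithin (adiabaticCoeff L m) (Icc 0 1) s) (Icc 0 1) s :=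
  ((contDiffOn_adiabaticCoeff hflat hL hu m).differentiableOn (by simp) s hs).hasDerivWithinAt

theorem trace_derivWithin_of_trace_eq (m : ℕ) {c : ℂ}
    (hc : ∀ s ∈ Icc (0 : ℝ) 1, (adiabaticCoeff L m s).trace = c) {s : ℝ} (hs : s ∈ Icc (0 : ℝ) 1) :
    (derivWithin (adiabaticCoeff L m) (Icc 0 1) s).trace = 0 := by
  have h1 := hasDerivWithinAt_trace (hasDerivWithinAt_adiabaticCoeff hflat hL hu m hs)
  have h2 : HasDerivWithinAt (fun t => (adiabaticCoeff L m t).trace) 0 (Icc 0 1) s :=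
    (hasDerivWithinAt_const s (Icc 0 1) c).congr (fun t ht => hc t ht) (hc s hs)
  exact (uniqueDiffOn_Icc one_pos s hs).eq_deriv _ h1 h2

theorem trace_derivWithin_adiabaticCoeff (m : ℕ) :
    ∀ s ∈ Icc (0 : ℝ) 1, (derivWithin (adiabaticCoeff L m) (Icc 0 1) s).trace = 0 := by
  induction m with
  | zero =>
    intro s hs
    refine trace_derivWithin_of_trace_eq hflat hL hu 0 (c := 1) (fun s hs => ?_) hs
    obtain ⟨σ, hσ, hσu⟩ := id (hu s hs)
    change (Ring.inverse (traceShift (L s)) 1).trace = 1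
    rw [inverse_traceShift_one (hL s hs) (hu s hs) hσ, hσ.2.1]
  | succ m ih =>
    intro s hs
    exact trace_derivWithin_of_trace_eq hflat hL hu (m + 1) (c := 0)
      (fun s hs => (inverse_traceShift_of_trace_eq_zero (hL s hs) (hu s hs) (ih s hs)).1) hs

theorem adiabaticCoeff_succ_spec (m : ℕ) {s : ℝ} (hs : s ∈ Icc (0 : ℝ) 1) :
    (adiabaticCoeff L (m + 1) s).trace = 0 ∧
      L s (adiabaticCoeff L (m + 1) s) = derivWithin (adiabaticCoeff L m) (Icc 0 1) s :=
  inverse_traceShift_of_trace_eq_zero (hL s hs) (hu s hs)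
    (trace_derivWithin_adiabaticCoeff hflat hL hu m s hs)

/-- Differentiation lowers the flatness by one and the inverse operator preserves it. Beyond order
zero the coefficient itself, not just its increment, is small at `1`. -/
theorem smoothFlat_adiabaticCoeff (m : ℕ) : ∀ j, j + m = k →
    SmoothFlat j (adiabaticCoeff L m) ∧ (1 ≤ m → adiabaticCoeff L m 1 = 0) := by
  have hN := smoothFlat_inverse_traceShift hflat hL hu
  induction m with
  | zero =>
    rintro j rfl
    exact ⟨hN.clm_apply_const (E := Matrix n n ℂ) 1, fun h => absurd h (by omega)⟩
  | succ m ih =>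
    intro j hj
    have h1 := isLittleO_derivWithin (ih (j + 1) (by omega)).1
    have h2 : adiabaticCoeff L (m + 1) =o[𝓝[Icc 0 1] 1] fun s : ℝ => (s - 1) ^ j :=
      isLittleO_clm_apply (E := Matrix n n ℂ) (hN.1.continuousOn 1 (right_mem_Icc.2 zero_le_one)) h1
    have h3 := eq_zero_of_isLittleO_pow h2
    refine ⟨⟨contDiffOn_adiabaticCoeff hflat hL hu _, ?_⟩, fun _ => h3⟩
    simpa only [h3, sub_zero] using h2

end Coeff

theorem IsSteadyState.traceNorm_eq {L : Matrix n n ℂ →L[ℂ] Matrix n n ℂ} {σ : Matrix n n ℂ}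
    (h : IsSteadyState L σ) : traceNorm σ = 1 := by
  have := traceNorm_eq_trace h.1
  rw [h.2.1] at this
  exact_mod_cast this

/-- **Boundary cancellation.** If the generators vary smoothly, with derivatives vanishing up to
order `k` at the final time, then the final adiabatic error is `O(τ ^ (-(k + 1)))`. -/
theorem boundary_cancellation {L : ℝ → Matrix n n ℂ →L[ℂ] Matrix n n ℂ} {k : ℕ} (hflat : SmoothFlat k L)
    (hL : ∀ s ∈ Icc (0 : ℝ) 1, IsLindblad (L s))
    (hu : ∀ s ∈ Icc (0 : ℝ) 1, ∃! σ, IsSteadyState (L s) σ) :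
    ∃ C : ℝ, ∀ τ : ℝ, 0 < τ → ∀ ρ σ : ℝ → Matrix n n ℂ,
      (∀ t ∈ Icc 0 τ, IsSteadyState (L (t / τ)) (σ t)) → ρ 0 = σ 0 →
      (∀ t ∈ Icc 0 τ, HasDerivWithinAt ρ (L (t / τ) (ρ t)) (Icc 0 τ) t) →
      traceNorm (ρ τ - σ τ) ≤ C / τ ^ (k + 1) := by
  obtain ⟨T, hT, hdec⟩ := exists_uniform_decay isCompact_Icc hflat.1.continuousOn hL hu
  obtain ⟨K, hK⟩ := exists_pow_floor_mul_pow_le hT (k + 1)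
  set c := adiabaticCoeff L with hc
  have hcd := contDiffOn_adiabaticCoeff hflat hL hu
  obtain ⟨D, hD⟩ := isCompact_Icc.bddAbove_image (f := fun s => traceNorm (derivWithin (c k) (Icc 0 1) s))
    (K := Icc (0 : ℝ) 1) (continuous_traceNorm.comp_continuousOn
      ((hcd k).derivWithin (m := 0) (uniqueDiffOn_Icc one_pos) (by simp)).continuousOn)
  have hD' : ∀ s ∈ Icc (0 : ℝ) 1, traceNorm (derivWithin (c k) (Icc 0 1) s) ≤ D := fun s hs =>
    hD (mem_image_of_mem _ hs)
  have hD0 : 0 ≤ D := (traceNorm_nonneg _).trans (hD' 0 ⟨le_rfl, zero_le_one⟩)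
  -- The modulus is chosen to meet the slow-variation condition of `traceNorm_le_decay`; the `+ 1`
  -- keeps the denominator nonzero.
  obtain ⟨δ, hδ, hunif⟩ := Metric.uniformContinuousOn_iff.1
    (isCompact_Icc.uniformContinuousOn_of_continuous hflat.1.continuousOn)
    (1 / (4 * T * (Fintype.card n + 1))) (by positivity)
  set M : ℝ := ∑ m ∈ Finset.range k, traceNorm (c (m + 1) 0) with hM
  have hM0 : 0 ≤ M := Finset.sum_nonneg fun _ _ => traceNorm_nonneg _
  have hK0 : 0 ≤ K := le_trans (by positivity) (hK 1 one_pos)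
  -- From `τ₀` on, `τ ≥ 1` and a window of length `T` has rescaled length below `δ`. Shorter
  -- annealing times use the trivial bound `2` and are absorbed in the constant.
  set τ₀ : ℝ := 1 + T / δ with hτ₀
  have hτ₀0 : 0 < τ₀ := by positivity
  refine ⟨K * M + 6 * D * T + 2 * τ₀ ^ (k + 1), fun τ hτ ρ σ hσ hρ0 hρ => ?_⟩
  have hmem : ∀ t ∈ Icc 0 τ, t / τ ∈ Icc (0 : ℝ) 1 := fun t ht =>
    ⟨div_nonneg ht.1 hτ.le, (div_le_one hτ).2 ht.2⟩
  have h0m : (0 : ℝ) ∈ Icc 0 τ := ⟨le_rfl, hτ.le⟩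
  have h1m : τ ∈ Icc 0 τ := ⟨hτ.le, le_rfl⟩
  have hc0 : ∀ t ∈ Icc 0 τ, c 0 (t / τ) = σ t := fun t ht =>
    inverse_traceShift_one (hL _ (hmem t ht)) (hu _ (hmem t ht)) (hσ t ht)
  rw [le_div_iff₀ (by positivity)]
  rcases lt_or_ge τ τ₀ with hlt | hge
  · have h1 := traceNorm_le_of_hasDerivWithinAt (L := fun t => L (t / τ)) (R := ρ) (b := 0) (B := 0)
      (t₀ := 0) (t₁ := τ) (fun t ht => hL _ (hmem t ht)) (fun t ht => by simpa using hρ t ht)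
      (fun t _ => by simp) τ h1m
    rw [hρ0, (hσ 0 h0m).traceNorm_eq, zero_mul, add_zero] at h1
    have h2 : traceNorm (ρ τ - σ τ) ≤ 2 := by
      have := traceNorm_sub_le (ρ τ) (σ τ)
      rw [(hσ τ h1m).traceNorm_eq] at this
      linarith
    calc traceNorm (ρ τ - σ τ) * τ ^ (k + 1) ≤ 2 * τ₀ ^ (k + 1) := by gcongr
      _ ≤ _ := by
        have : 0 ≤ K * M + 6 * D * T := by positivity
        linarith
  · have hτ1 : 1 ≤ τ := le_trans (by rw [hτ₀]; have : 0 ≤ T / δ := by positivity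
                                     linarith) hge
    have hspec := fun m s hs => adiabaticCoeff_succ_spec hflat hL hu m (s := s) hs
    -- When the equation is applied to the expansion, `L c_{m+1} = c_m'` makes it telescope, leaving
    -- the source with `c_k'`. Also `R τ` is the true error, and `R 0` contains only traceless
    -- terms.
    set R : ℝ → Matrix n n ℂ := fun t => ρ t - ∑ m ∈ Finset.range (k + 1), (τ⁻¹) ^ m • c m (t / τ) with hR
    have hR0 : R 0 = -∑ m ∈ Finset.range k, (τ⁻¹) ^ (m + 1) • c (m + 1) 0 := by
      have h2 := hc0 0 h0m
      rw [zero_div] at h2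
      simp only [hR]
      rw [Finset.sum_range_succ', hρ0, zero_div, h2, pow_zero, one_smul]
      abel
    have hRτ : R τ = ρ τ - σ τ := by
      simp only [hR]
      rw [Finset.sum_range_succ', hc0 τ h1m, pow_zero, one_smul, div_self hτ.ne',
        Finset.sum_eq_zero fun m hm => ?_, zero_add]
      rw [Finset.mem_range] at hm
      have h3 : c (m + 1) 1 = 0 :=
        (smoothFlat_adiabaticCoeff hflat hL hu (m + 1) (k - (m + 1)) (by omega)).2 (by omega)
      rw [h3, smul_zero]
    have hRd : ∀ t ∈ Icc 0 τ, HasDerivWithinAt R (L (t / τ) (R t) +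
        -((τ⁻¹) ^ (k + 1) • derivWithin (c k) (Icc 0 1) (t / τ))) (Icc 0 τ) t := fun t ht => by
      have h1 : ∀ m, HasDerivWithinAt (fun t => c m (t / τ))
          (τ⁻¹ • derivWithin (c m) (Icc 0 1) (t / τ)) (Icc 0 τ) t := fun m =>
        (hasDerivWithinAt_adiabaticCoeff hflat hL hu m (hmem t ht)).scomp t
          (by simpa using (hasDerivWithinAt_id t (Icc 0 τ)).div_const τ) hmem
      have h2 := (hρ t ht).sub (HasDerivWithinAt.fun_sum (u := Finset.range (k + 1)) fun m _ =>
        (h1 m).const_smul ((τ⁻¹) ^ m))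
      convert! h2 using 1
      simp only [hR]
      rw [map_sub, map_sum, Finset.sum_range_succ', Finset.sum_range_succ]
      have h3 : L (t / τ) (τ⁻¹ ^ 0 • c 0 (t / τ)) = 0 := by
        rw [pow_zero, one_smul, hc0 t ht, (hσ t ht).2.2]
      have h4 : ∀ m ∈ Finset.range k, L (t / τ) (τ⁻¹ ^ (m + 1) • c (m + 1) (t / τ)) =
          τ⁻¹ ^ m • τ⁻¹ • derivWithin (c m) (Icc 0 1) (t / τ) := fun m _ => by
        rw [ContinuousLinearMap.map_smul_of_tower, (hspec m _ (hmem t ht)).2, smul_smul, pow_succ]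
      rw [h3, Finset.sum_congr rfl h4, smul_smul, ← pow_succ]
      abel
    have htr : (R 0).trace = 0 := by
      rw [hR0, Matrix.trace_neg, Matrix.trace_sum, Finset.sum_eq_zero fun m _ => ?_, neg_zero]
      rw [Matrix.trace_smul, (hspec m 0 ⟨le_rfl, zero_le_one⟩).1, smul_zero]
    have hR0n : traceNorm (R 0) ≤ M := by
      rw [hR0, traceNorm_neg]
      refine (traceNorm_sum_le _ _).trans (Finset.sum_le_sum fun m _ => ?_)
      rw [← Complex.coe_smul, traceNorm_smul, Complex.norm_real, Real.norm_of_nonneg (by positivity)]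
      exact mul_le_of_le_one_left (traceNorm_nonneg _) (pow_le_one₀ (by positivity) (inv_le_one_of_one_le₀ hτ1))
    have hmain := traceNorm_le_decay (Λ := fun t => L (t / τ)) (R := R) (T := T) (τ := τ)
      (b := fun t => -((τ⁻¹) ^ (k + 1) • derivWithin (c k) (Icc 0 1) (t / τ)))
      (B := (τ⁻¹) ^ (k + 1) * D) hT hτ.le (fun t ht => hL _ (hmem t ht))
      (fun t ht Y hY => hdec _ (hmem t ht) Y hY) (fun t ht t' ht' htt => by
        have h1 : dist (t / τ) (t' / τ) < δ := by
          rw [Real.dist_eq, ← sub_div, abs_div, abs_of_pos hτ, div_lt_iff₀ hτ]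
          have : T < δ * τ := by
            rw [← div_lt_iff₀' hδ]; linarith
          linarith
        have h2 := (hunif _ (hmem t ht) _ (hmem t' ht') h1).le
        rw [dist_eq_norm] at h2
        calc T * (Fintype.card n * ‖L (t / τ) - L (t' / τ)‖)
            ≤ T * ((Fintype.card n + 1) * (1 / (4 * T * (Fintype.card n + 1)))) := by
              gcongr
              linarith
          _ = 1 / 4 := by field_simp)
      hRd (fun t ht => by
        rw [traceNorm_neg, ← Complex.coe_smul, traceNorm_smul, Complex.norm_real,
          Real.norm_of_nonneg (by positivity)]
        gcongr
        exact hD' _ (hmem t ht))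
      (fun t ht => by
        rw [Matrix.trace_neg, Matrix.trace_smul,
          trace_derivWithin_adiabaticCoeff hflat hL hu k _ (hmem t ht), smul_zero, neg_zero]) htr
    rw [← hRτ]
    have h5 : (τ⁻¹) ^ (k + 1) * τ ^ (k + 1) = 1 := by
      rw [← mul_pow, inv_mul_cancel₀ hτ.ne', one_pow]
    calc traceNorm (R τ) * τ ^ (k + 1)
        ≤ ((3 / 4) ^ ⌊τ / T⌋₊ * M + 6 * ((τ⁻¹) ^ (k + 1) * D) * T) * τ ^ (k + 1) := by
          gcongr
          exact hmain.trans (by gcongr)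
      _ = ((3 / 4) ^ ⌊τ / T⌋₊ * τ ^ (k + 1)) * M + 6 * D * T * ((τ⁻¹) ^ (k + 1) * τ ^ (k + 1)) := by ring
      _ ≤ K * M + 6 * D * T := by
          rw [h5, mul_one]
          gcongr
          exact hK τ hτ
      _ ≤ _ := by
        have : 0 ≤ 2 * τ₀ ^ (k + 1) := by positivity
        linarith

end Adiabatic
end Davies

/-! ### Weyl's inequality and traces of powers -/

namespace Davies

set_option linter.unusedSectionVars false

open scoped ContDiff

section Spectral

variable {n : Type*} [Fintype n] [DecidableEq n]

theorem exists_unitary_quadratic_form {X : Matrix n n ℂ} (hX : X.IsHermitian) :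
    ∃ V : Matrix n n ℂ, ∀ v : n → ℂ,
      (star v ⬝ᵥ (X *ᵥ v)).re = ∑ j, hX.eigenvalues j * ‖(V *ᵥ v) j‖ ^ 2 ∧
      ‖WithLp.toLp 2 v‖ ^ 2 = ∑ j, ‖(V *ᵥ v) j‖ ^ 2 := by
  obtain ⟨V, h1, h2, h3, -⟩ := exists_unitary_diagonal hX
  have hs : ∀ v : n → ℂ, star v ᵥ* V = star (Vᴴ *ᵥ v) := fun v => by
    rw [Matrix.star_mulVec, Matrix.conjTranspose_conjTranspose]
  refine ⟨Vᴴ, fun v => ⟨?_, ?_⟩⟩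
  · conv_lhs => rw [h3]
    rw [← Matrix.mulVec_mulVec, ← Matrix.mulVec_mulVec, Matrix.dotProduct_mulVec, hs, dotProduct,
      Complex.re_sum]
    refine Finset.sum_congr rfl fun j _ => ?_
    rw [Matrix.mulVec_diagonal, Pi.star_apply, mul_left_comm, Complex.star_def,
      ← Complex.normSq_eq_conj_mul_self, ← Complex.ofReal_mul, Complex.ofReal_re, Complex.normSq_eq_norm_sq]
  · have h4 : star v ⬝ᵥ v = star (Vᴴ *ᵥ v) ⬝ᵥ (Vᴴ *ᵥ v) := by
      rw [← hs, ← Matrix.dotProduct_mulVec, Matrix.mulVec_mulVec, h2, Matrix.one_mulVec]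
    have h5 := norm_toLp_sq (Vᴴ *ᵥ v)
    rw [← h4, ← norm_toLp_sq v] at h5
    have h6 : ‖WithLp.toLp 2 v‖ ^ 2 = ‖WithLp.toLp 2 (Vᴴ *ᵥ v)‖ ^ 2 := by exact_mod_cast h5.symm
    rw [h6, EuclideanSpace.norm_sq_eq]

/-- **Weyl's inequality**, one-sided. -/
theorem energy_le_add_norm {K K' : Matrix n n ℂ} (hK : K.IsHermitian) (hK' : K'.IsHermitian)
    (i : Fin (Fintype.card n)) : energy K hK i ≤ energy K' hK' i + ‖K - K'‖ := by
  obtain ⟨V, hV⟩ := exists_unitary_quadratic_form hK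
  obtain ⟨V', hV'⟩ := exists_unitary_quadratic_form hK'
  set e : Fin (Fintype.card n) ≃ n := Fintype.equivOfCardEq (Fintype.card_fin _) with he
  have heig : ∀ {X : Matrix n n ℂ} (hX : X.IsHermitian) j, hX.eigenvalues j = energy X hX (e.symm j) :=
    fun _ _ => rfl
  -- Dimension count: the coordinate `i` of `T` is zero, so `T` has a kernel. A vector in it has
  -- only components with index `≤ i` in the eigenbasis of `K` and `≥ i` in that of `K'`.
  let T : (n → ℂ) →ₗ[ℂ] (n → ℂ) := LinearMap.pi fun j =>
    if e.symm j < i then LinearMap.proj j ∘ₗ Matrix.mulVecLin V'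
    else if i < e.symm j then LinearMap.proj j ∘ₗ Matrix.mulVecLin V else 0
  have hTi : ∀ v, T v (e i) = 0 := fun v => by simp [T]
  have hTlt : ∀ v j, e.symm j < i → T v j = (V' *ᵥ v) j := fun v j h => by simp [T, h]
  have hTgt : ∀ v j, i < e.symm j → T v j = (V *ᵥ v) j := fun v j h => by
    simp [T, h, not_lt.2 h.le]
  have hninj : ¬ Function.Injective T := fun h => by
    obtain ⟨v, hv⟩ := (LinearMap.injective_iff_surjective.1 h) (fun _ => 1)
    simpa [hTi] using congrFun hv (e i)
  obtain ⟨v, hv, hv0⟩ : ∃ v, T v = 0 ∧ v ≠ 0 := by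
    by_contra! hcon
    exact hninj ((injective_iff_map_eq_zero T).2 hcon)
  set N := ‖WithLp.toLp 2 v‖ ^ 2 with hN
  have hN0 : 0 < N := by
    have : WithLp.toLp 2 v ≠ 0 := by simpa using hv0
    positivity
  have h1 : energy K hK i * N ≤ (star v ⬝ᵥ (K *ᵥ v)).re := by
    rw [(hV v).1, hN, (hV v).2, Finset.mul_sum]
    refine Finset.sum_le_sum fun j _ => ?_
    rcases le_or_gt (e.symm j) i with h | h
    · rw [heig]
      exact mul_le_mul_of_nonneg_right (hK.eigenvalues₀_antitone h) (by positivity)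
    · simp [← hTgt v j h, hv]
  have h2 : (star v ⬝ᵥ (K' *ᵥ v)).re ≤ energy K' hK' i * N := by
    rw [(hV' v).1, hN, (hV' v).2, Finset.mul_sum]
    refine Finset.sum_le_sum fun j _ => ?_
    rcases le_or_gt i (e.symm j) with h | h
    · rw [heig]
      exact mul_le_mul_of_nonneg_right (hK'.eigenvalues₀_antitone h) (by positivity)
    · simp [← hTlt v j h, hv]
  have h3 : (star v ⬝ᵥ (K *ᵥ v)).re - (star v ⬝ᵥ (K' *ᵥ v)).re ≤ ‖K - K'‖ * N := by
    rw [← Complex.sub_re, ← dotProduct_sub, ← Matrix.sub_mulVec]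
    refine (Complex.re_le_norm _).trans ((norm_star_dotProduct_mulVec_le _ _ _).trans (le_of_eq ?_))
    rw [hN]; ring
  have h4 : energy K hK i * N ≤ (energy K' hK' i + ‖K - K'‖) * N := by rw [add_mul]; linarith
  exact le_of_mul_le_mul_right h4 hN0

/-- **Weyl's inequality**: the ordered eigenvalues are Lipschitz. -/
theorem abs_energy_sub_le {K K' : Matrix n n ℂ} (hK : K.IsHermitian) (hK' : K'.IsHermitian)
    (i : Fin (Fintype.card n)) : |energy K hK i - energy K' hK' i| ≤ ‖K - K'‖ := by
  rw [abs_le]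
  have h1 := energy_le_add_norm hK hK' i
  have h2 := energy_le_add_norm hK' hK i
  rw [norm_sub_rev] at h2
  constructor <;> linarith

theorem trace_pow_eq_sum_energy {K : Matrix n n ℂ} (hK : K.IsHermitian) (p : ℕ) :
    (K ^ p).trace = ((∑ i, energy K hK i ^ p : ℝ) : ℂ) := by
  obtain ⟨V, h1, h2, h3, -⟩ := exists_unitary_diagonal hK
  have h4 : K ^ p = V * Matrix.diagonal (fun i => ((hK.eigenvalues i : ℂ)) ^ p) * Vᴴ := by
    induction p with
    | zero => simp [h2]
    | succ p ih =>
      rw [pow_succ, (congrArg (K ^ p * ·) h3 : K ^ p * K = _), ih]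
      rw [show V * Matrix.diagonal (fun i => (hK.eigenvalues i : ℂ) ^ p) * Vᴴ *
        (V * Matrix.diagonal (fun i => (hK.eigenvalues i : ℂ)) * Vᴴ) =
        V * Matrix.diagonal (fun i => (hK.eigenvalues i : ℂ) ^ p) * (Vᴴ * V) *
        Matrix.diagonal (fun i => (hK.eigenvalues i : ℂ)) * Vᴴ by simp only [Matrix.mul_assoc], h1,
        Matrix.mul_one, Matrix.mul_assoc V, Matrix.diagonal_mul_diagonal]
      simp only [pow_succ]
  rw [h4, Matrix.mul_assoc, Matrix.trace_mul_comm, Matrix.mul_assoc, h1, Matrix.mul_one,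
    Matrix.trace_diagonal]
  push_cast
  exact Fintype.sum_equiv (Fintype.equivOfCardEq (Fintype.card_fin _)).symm _ _ fun i => rfl

end Spectral

/-! ### Smoothness from power sums -/

section PowerSums

/-- Distinct continuous functions are smooth if sufficiently many of their weighted power sums are. -/
theorem contDiffOn_of_powerSums {r : ℕ} {d : Fin r → ℝ} (hd : ∀ b, d b ≠ 0) {y : ℝ → Fin r → ℝ}
    {S : Set ℝ} (hy : ContinuousOn y S) (hinj : ∀ s ∈ S, Function.Injective (y s))
    (hp : ∀ p : ℕ, ContDiffOn ℝ ∞ (fun s => ∑ b, d b * y s b ^ p) S) : ContDiffOn ℝ ∞ y S := by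
  -- The powers start at `1`, since the zeroth power sum is constant.
  set F : (Fin r → ℝ) → (Fin r → ℝ) := fun x p => ∑ b, d b * x b ^ ((p : ℕ) + 1) with hF
  have hFc : ContDiff ℝ ∞ F := contDiff_pi.2 fun p => by fun_prop
  intro s hs
  set a := y s with ha
  have hFd : HasFDerivAt F (fderiv ℝ F a) a := (hFc.differentiable (by simp) a).hasFDerivAt
  have hFa : ∀ δ p, fderiv ℝ F a δ p = ∑ b, d b * (((p : ℕ) + 1) * a b ^ (p : ℕ)) * δ b := fun δ p => by
    have h1 : HasFDerivAt (fun x => F x p) (∑ b, d b • ((((p : ℕ) + 1 : ℕ) : ℝ) * a b ^ (p : ℕ)) •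
        ContinuousLinearMap.proj (R := ℝ) (φ := fun _ : Fin r => ℝ) b) a := by
      refine HasFDerivAt.fun_sum fun b _ => HasFDerivAt.const_mul ?_ _
      simpa using (hasFDerivAt_apply (𝕜 := ℝ) b a).pow ((p : ℕ) + 1)
    have h2 := (hasFDerivAt_pi'.1 hFd p).unique h1
    have h3 := congrArg (fun T : (Fin r → ℝ) →L[ℝ] ℝ => T δ) h2
    simp only [ContinuousLinearMap.comp_apply, ContinuousLinearMap.proj_apply] at h3
    rw [h3]
    simp [mul_assoc]
  have hker : ∀ δ, fderiv ℝ F a δ = 0 → δ = 0 := fun δ h => by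
    -- The Jacobian is a Vandermonde matrix up to nonzero row and column factors.
    have h1 := Matrix.eq_zero_of_forall_pow_sum_mul_pow_eq_zero (v := fun b => d b * δ b)
      (hinj s hs) fun p => by
        have h2 := congrFun h p
        rw [hFa] at h2
        have h3 : ∑ b, d b * (((p : ℕ) + 1) * a b ^ (p : ℕ)) * δ b =
            ((p : ℕ) + 1) * ∑ b, d b * δ b * a b ^ (p : ℕ) := by
          rw [Finset.mul_sum]
          exact Finset.sum_congr rfl fun b _ => by ring
        rw [h3] at h2
        exact (mul_eq_zero.1 h2).resolve_left (by positivity)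
    ext b
    exact (mul_eq_zero.1 (congrFun h1 b)).resolve_left (hd b)
  let F' : (Fin r → ℝ) ≃L[ℝ] (Fin r → ℝ) := (LinearEquiv.ofInjectiveEndo
    (fderiv ℝ F a : (Fin r → ℝ) →ₗ[ℝ] (Fin r → ℝ))
    ((injective_iff_map_eq_zero _).2 hker)).toContinuousLinearEquiv
  have hF' : HasFDerivAt F (F' : (Fin r → ℝ) →L[ℝ] (Fin r → ℝ)) a := by
    convert! hFd using 1
  have hst : HasStrictFDerivAt F (F' : (Fin r → ℝ) →L[ℝ] (Fin r → ℝ)) a :=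
    hFc.contDiffAt.hasStrictFDerivAt' hF' (by simp)
  have hG := hFc.contDiffAt.to_localInverse hF' (by simp)
  have h1 : ContDiffWithinAt ℝ ∞ (fun s => F (y s)) S s :=
    contDiffWithinAt_pi.2 fun p => hp _ s hs
  have h2 : ContDiffWithinAt ℝ ∞ (fun s => hst.localInverse F F' a (F (y s))) S s :=
    ContDiffAt.comp_contDiffWithinAt (f := fun s => F (y s)) s hG h1
  -- Continuity of `y` keeps it in the domain where the local inverse returns `y` itself.
  refine h2.congr_of_eventuallyEq_of_mem ?_ hs
  filter_upwards [(hy s hs).eventually hst.eventually_left_inverse] with t ht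
  exact ht.symm

end PowerSums

/-! ### Smooth energy levels and Bohr frequencies -/

section Representatives

/-- A constant pattern of coincidences allows one index set, chosen at `s = 0`, to enumerate the
distinct values for all `s`. -/
theorem exists_representatives {κ : Type*} [Fintype κ] {f : ℝ → κ → ℝ} {S : Set ℝ}
    (hf : ∀ s ∈ S, ∀ x y, f s x = f s y ↔ f 0 x = f 0 y) :
    ∃ R : Finset κ, (∀ s ∈ S, ∀ x ∈ R, ∀ y ∈ R, f s x = f s y → x = y) ∧
      ∀ x, ∃ b ∈ R, ∀ s ∈ S, f s x = f s b := by
  classical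
  obtain ⟨R, -, hR⟩ := (surjOn_image (f 0) univ).exists_bijOn_subset
  refine ⟨R.toFinset, fun s hs x hx y hy hxy => ?_, fun x => ?_⟩
  · exact hR.injOn (by simpa using hx) (by simpa using hy) ((hf s hs x y).1 hxy)
  · obtain ⟨b, hb, hbx⟩ := hR.surjOn (mem_image_of_mem (f 0) (mem_univ x))
    exact ⟨b, by simpa using hb, fun s hs => (hf s hs x b).2 hbx.symm⟩

variable {n : Type*} [Fintype n] [DecidableEq n] {h : ℝ → Matrix n n ℂ} {hh : ∀ s, (h s).IsHermitian}

theorem continuousOn_energy (hc : ContinuousOn h (Icc 0 1)) (i : Fin (Fintype.card n)) :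
    ContinuousOn (fun s => energy (h s) (hh s) i) (Icc 0 1) := fun s hs => by
  refine tendsto_iff_dist_tendsto_zero.2 (squeeze_zero (fun _ => dist_nonneg) (fun t => ?_)
    (tendsto_iff_dist_tendsto_zero.1 (hc s hs)))
  rw [Real.dist_eq, dist_eq_norm]
  exact abs_energy_sub_le _ _ i

theorem contDiffOn_energy (hsmooth : ContDiffOn ℝ ∞ h (Icc 0 1)) (hlevels : ConstantLevelDegeneracy hh)
    (i : Fin (Fintype.card n)) : ContDiffOn ℝ ∞ (fun s => energy (h s) (hh s) i) (Icc 0 1) := by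
  classical
  obtain ⟨R, hinj, hcov⟩ := exists_representatives (f := fun s => energy (h s) (hh s)) hlevels
  choose c hcR hc using hcov
  set e := R.equivFin
  set y : ℝ → Fin R.card → ℝ := fun s b => energy (h s) (hh s) (e.symm b) with hy
  -- Multiplicities of the distinct levels; they turn the weighted power sums into `Tr h^p`.
  set d : Fin R.card → ℝ := fun b => (Finset.univ.filter fun i => c i = e.symm b).card with hd
  have hsum : ∀ s ∈ Icc (0 : ℝ) 1, ∀ p : ℕ,
      ∑ b, d b * y s b ^ p = ∑ i, energy (h s) (hh s) i ^ p := fun s hs p => by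
    rw [← Finset.sum_fiberwise_of_maps_to (s := Finset.univ) (t := R) (g := c) (fun i _ => hcR i),
      ← Finset.sum_coe_sort R]
    refine Fintype.sum_equiv e.symm _ _ fun b => ?_
    rw [Finset.sum_congr rfl fun i hi => by rw [hc i s hs, (Finset.mem_filter.1 hi).2],
      Finset.sum_const, nsmul_eq_mul]
  have h1 : ContDiffOn ℝ ∞ y (Icc 0 1) := by
    refine contDiffOn_of_powerSums (d := d) (fun b => ?_) ?_ (fun s hs a b hab => ?_) fun p => ?_
    · have : c (e.symm b) = e.symm b :=
        hinj 0 ⟨le_rfl, zero_le_one⟩ _ (hcR _) _ (e.symm b).2 (hc _ 0 ⟨le_rfl, zero_le_one⟩).symm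
      exact Nat.cast_ne_zero.2 (Finset.card_ne_zero_of_mem
        (Finset.mem_filter.2 ⟨Finset.mem_univ ((e.symm b : R) : Fin (Fintype.card n)), this⟩))
    · exact continuousOn_pi.2 fun b => continuousOn_energy hsmooth.continuousOn _
    · exact e.symm.injective (Subtype.ext (hinj s hs _ (e.symm a).2 _ (e.symm b).2 hab))
    · have h2 : ContDiffOn ℝ ∞ (fun s => ((h s) ^ p).trace.re) (Icc 0 1) :=
        (Complex.reCLM.contDiff.comp
          ((traceCLM (n := n)).restrictScalars ℝ).contDiff).comp_contDiffOn (hsmooth.pow p)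
      refine h2.congr fun s hs => ?_
      rw [hsum s hs, trace_pow_eq_sum_energy (hh s), Complex.ofReal_re]
  refine (contDiffOn_pi.1 h1 (e ⟨c i, hcR i⟩)).congr fun s hs => ?_
  simp only [hy, Equiv.symm_apply_apply]
  exact hc i s hs

/-- Flatness is immediate from Weyl's inequality, with no differentiation of eigenvalues. -/
theorem smoothFlat_energy {k : ℕ} (hflat : SmoothFlat k h) (hlevels : ConstantLevelDegeneracy hh)
    (i : Fin (Fintype.card n)) : SmoothFlat k fun s => energy (h s) (hh s) i := by
  refine ⟨contDiffOn_energy hflat.1 hlevels i, ?_⟩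
  refine (Asymptotics.isBigO_of_le _ fun s => ?_).trans_isLittleO hflat.2
  exact abs_energy_sub_le _ _ i

theorem smoothFlat_bohr {k : ℕ} (hflat : SmoothFlat k h) (hlevels : ConstantLevelDegeneracy hh)
    (i j : Fin (Fintype.card n)) : SmoothFlat k fun s => bohr (h s) (hh s) i j :=
  (smoothFlat_energy hflat hlevels j).comp₂ (smoothFlat_energy hflat hlevels i)
    (Ψ := fun x y : ℝ => x - y) (by fun_prop)

end Representatives

/-! ### Spectral projections -/

section Projections

variable {n : Type*} [Fintype n] [DecidableEq n]

/-- Lagrange interpolation. The list may repeat a level, which is harmless because each factor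
equals `1` at `E`; so degenerate indices need not be removed. -/
theorem energyProj_eq_list_prod {K : Matrix n n ℂ} (hK : K.IsHermitian) {l : List ℝ} {E : ℝ}
    (hE : ∀ x ∈ l, x ≠ E) (hl : ∀ i, hK.eigenvalues i = E ∨ hK.eigenvalues i ∈ l) :
    energyProj hK E = (l.map fun x => ((E - x)⁻¹ : ℝ) • (K - ((x : ℂ) • (1 : Matrix n n ℂ)))).prod := by
  set U : Matrix n n ℂ := (hK.eigenvectorUnitary : Matrix n n ℂ) with hU
  have h1 : Uᴴ * U = 1 := Unitary.coe_star_mul_self _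
  have h2 : U * Uᴴ = 1 := Unitary.coe_mul_star_self _
  have h3 : K = U * Matrix.diagonal (fun i => (hK.eigenvalues i : ℂ)) * Uᴴ := by
    conv_lhs => rw [hK.spectral_theorem, Unitary.conjStarAlgAut_apply]
    rfl
  have h4 : ∀ x : ℝ, ((E - x)⁻¹ : ℝ) • (K - ((x : ℂ) • (1 : Matrix n n ℂ))) =
      U * Matrix.diagonal (fun i => (((E - x)⁻¹ * (hK.eigenvalues i - x) : ℝ) : ℂ)) * Uᴴ := fun x => by
    have h5 : Matrix.diagonal (fun i => (((E - x)⁻¹ * (hK.eigenvalues i - x) : ℝ) : ℂ)) =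
        ((E - x)⁻¹ : ℝ) • (Matrix.diagonal (fun i => (hK.eigenvalues i : ℂ)) - (x : ℂ) • 1) := by
      ext i j
      by_cases hij : i = j
      · subst hij; simp
      · simp [hij]
    rw [h5, Matrix.mul_smul, Matrix.smul_mul, Matrix.mul_sub, Matrix.sub_mul, ← h3, Matrix.mul_smul,
      Matrix.smul_mul, Matrix.mul_one, h2]
  have h5 : ∀ l : List ℝ, (l.map fun x => ((E - x)⁻¹ : ℝ) • (K - ((x : ℂ) • (1 : Matrix n n ℂ)))).prod =
      U * Matrix.diagonal (fun i =>
        (((l.map fun x => (E - x)⁻¹ * (hK.eigenvalues i - x)).prod : ℝ) : ℂ)) * Uᴴ := fun l => by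
    induction l with
    | nil => simp [h2]
    | cons x l ih =>
      rw [List.map_cons, List.prod_cons, ih, h4, show ∀ D D' : Matrix n n ℂ,
        U * D * Uᴴ * (U * D' * Uᴴ) = U * (D * (Uᴴ * U) * D') * Uᴴ from fun D D' => by
          simp only [Matrix.mul_assoc], h1, Matrix.mul_one, Matrix.diagonal_mul_diagonal]
      simp only [List.map_cons, List.prod_cons, Complex.ofReal_mul]
  rw [h5, energyProj, ← hU]
  congr 3
  ext i
  split_ifs with hi
  · rw [hi, List.map_congr_left (g := fun _ => (1 : ℝ)) fun x hx => ?_]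
    · simp
    · exact inv_mul_cancel₀ (sub_ne_zero.2 (hE x hx).symm)
  · rw [eq_comm, Complex.ofReal_eq_zero, List.prod_eq_zero_iff, List.mem_map]
    exact ⟨_, (hl i).resolve_left hi, by simp⟩

variable {h : ℝ → Matrix n n ℂ} {hh : ∀ s, (h s).IsHermitian} {k : ℕ}

theorem SmoothFlat.list_prod {κ 𝔸 : Type*} [NormedRing 𝔸] [NormedAlgebra ℝ 𝔸] {f : κ → ℝ → 𝔸} {l : List κ}
    (hf : ∀ a ∈ l, SmoothFlat k (f a)) : SmoothFlat k fun s => (l.map fun a => f a s).prod := by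
  induction l with
  | nil => simpa using SmoothFlat.const (1 : 𝔸)
  | cons a l ih =>
    simp only [List.map_cons, List.prod_cons]
    exact (hf a (by simp)).comp₂ (ih fun b hb => hf b (by simp [hb])) (Ψ := fun x y : 𝔸 => x * y)
      (by fun_prop)

theorem smoothFlat_energyProj (hflat : SmoothFlat k h) (hlevels : ConstantLevelDegeneracy hh)
    (i : Fin (Fintype.card n)) : SmoothFlat k fun s => energyProj (hh s) (energy (h s) (hh s) i) := by
  classical
  set l := (Finset.univ.filter fun j => energy (h 0) (hh 0) j ≠ energy (h 0) (hh 0) i).toList with hl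
  have hml : ∀ s ∈ Icc (0 : ℝ) 1, ∀ j, j ∈ l ↔ energy (h s) (hh s) j ≠ energy (h s) (hh s) i :=
    fun s hs j => by simp [hl, hlevels s hs j i]
  have h1 : SmoothFlat k fun s => (l.map fun j => ((energy (h s) (hh s) i - energy (h s) (hh s) j)⁻¹ : ℝ) •
      (h s - (((energy (h s) (hh s) j : ℝ) : ℂ) • (1 : Matrix n n ℂ)))).prod := by
    refine SmoothFlat.list_prod fun j hj => ?_
    have h2 : SmoothFlat k fun s => (energy (h s) (hh s) i - energy (h s) (hh s) j)⁻¹ :=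
      ((smoothFlat_energy hflat hlevels i).prodMk (smoothFlat_energy hflat hlevels j)).comp
        (Ψ := fun p : ℝ × ℝ => (p.1 - p.2)⁻¹) fun s hs =>
          ContDiffAt.inv (by fun_prop) (sub_ne_zero.2 ((hml s hs j).1 hj).symm)
    have h3 : SmoothFlat k fun s => h s - (((energy (h s) (hh s) j : ℝ) : ℂ) • (1 : Matrix n n ℂ)) :=
      hflat.comp₂ (smoothFlat_energy hflat hlevels j)
        (Ψ := fun (X : Matrix n n ℂ) (x : ℝ) => X - ((x : ℂ) • (1 : Matrix n n ℂ))) (by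
          simp only [Complex.coe_smul]; fun_prop)
    exact h2.comp₂ h3 (Ψ := fun (x : ℝ) (X : Matrix n n ℂ) => x • X) (by fun_prop)
  refine h1.congr fun s hs => ?_
  rw [energyProj_eq_list_prod (hh s) (l := l.map fun j => energy (h s) (hh s) j), List.map_map]
  · rfl
  · intro x hx
    obtain ⟨j, hj, rfl⟩ := List.mem_map.1 hx
    exact (hml s hs j).1 hj
  · intro j
    by_cases hj : (hh s).eigenvalues j = energy (h s) (hh s) i
    · exact Or.inl hj
    · exact Or.inr (List.mem_map.2 ⟨_, (hml s hs _).2 hj, rfl⟩)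

end Projections
end Davies

/-! ### Smoothness of jump operators, Lamb shift and generator -/

namespace Davies

set_option linter.unusedSectionVars false

open scoped ContDiff

section Sums

variable {n : Type*} [Fintype n] [DecidableEq n] {K : Matrix n n ℂ} (hK : K.IsHermitian)

theorem levels_eq_image_energy {R : Finset (Fin (Fintype.card n))}
    (hc : ∀ i, ∃ b ∈ R, energy K hK i = energy K hK b) : levels hK = R.image (energy K hK) := by
  ext x
  simp only [levels, Finset.mem_image, Finset.mem_univ, true_and]
  constructor
  · rintro ⟨i, rfl⟩
    obtain ⟨b, hb, h⟩ := hc ((Fintype.equivOfCardEq (Fintype.card_fin _)).symm i)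
    exact ⟨b, hb, h.symm⟩
  · rintro ⟨b, -, rfl⟩
    exact ⟨Fintype.equivOfCardEq (Fintype.card_fin _) b, by
      simp [Matrix.IsHermitian.eigenvalues, energy]⟩

/-- Replaces a sum over the levels, a set that moves with `s`, by one over fixed indices;
`sum_bohrFreqs` does the same for the frequencies. -/
theorem jumpOp_eq_sum {R : Finset (Fin (Fintype.card n))}
    (hinj : ∀ x ∈ R, ∀ y ∈ R, energy K hK x = energy K hK y → x = y)
    (hc : ∀ i, ∃ b ∈ R, energy K hK i = energy K hK b) (A : Matrix n n ℂ) (w : ℝ) :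
    jumpOp K hK A w = ∑ p ∈ R ×ˢ R with bohr K hK p.1 p.2 = w,
      energyProj hK (energy K hK p.1) * A * energyProj hK (energy K hK p.2) := by
  rw [jumpOp, levels_eq_image_energy hK hc, ← Finset.prodMap_image_product, Finset.filter_image, Finset.sum_image]
  · rfl
  · intro x hx y hy hxy
    have hx' := Finset.mem_product.1 (Finset.mem_filter.1 hx).1
    have hy' := Finset.mem_product.1 (Finset.mem_filter.1 hy).1
    exact Prod.ext (hinj _ hx'.1 _ hy'.1 (congrArg Prod.fst hxy)) (hinj _ hx'.2 _ hy'.2 (congrArg Prod.snd hxy))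

theorem sum_bohrFreqs {M : Type*} [AddCommMonoid M] {Q : Finset (Fin (Fintype.card n) × Fin (Fintype.card n))}
    (hinj : ∀ p ∈ Q, ∀ q ∈ Q, bohr K hK p.1 p.2 = bohr K hK q.1 q.2 → p = q)
    (hc : ∀ p : Fin (Fintype.card n) × Fin (Fintype.card n), ∃ b ∈ Q, bohr K hK p.1 p.2 = bohr K hK b.1 b.2)
    (F : ℝ → M) : ∑ w ∈ bohrFreqs hK, F w = ∑ p ∈ Q, F (bohr K hK p.1 p.2) := by
  have h1 : bohrFreqs hK = Q.image fun p => bohr K hK p.1 p.2 := by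
    rw [bohrFreqs, levels_eq_image_energy hK (R := Finset.univ) fun i => ⟨i, Finset.mem_univ _, rfl⟩]
    ext x
    simp only [Finset.mem_image, Finset.mem_product, Finset.mem_univ, true_and]
    constructor
    · rintro ⟨⟨x, y⟩, ⟨⟨i, rfl⟩, ⟨j, rfl⟩⟩, rfl⟩
      obtain ⟨b, hb, h⟩ := hc (i, j)
      exact ⟨b, hb, h.symm⟩
    · rintro ⟨b, -, rfl⟩
      exact ⟨(_, _), ⟨⟨_, rfl⟩, ⟨_, rfl⟩⟩, rfl⟩
  rw [h1, Finset.sum_image fun x hx y hy hxy => hinj x hx y hy hxy]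

end Sums

theorem SmoothFlat.of_apply {E : Type*} [NormedAddCommGroup E] [NormedSpace ℂ E] [FiniteDimensional ℂ E]
    {k : ℕ} {L : ℝ → E →L[ℂ] E} (hL : ∀ x, SmoothFlat k fun s => L s x) : SmoothFlat k L := by
  set b := Module.finBasis ℂ E
  have h1 : SmoothFlat k fun s => ∑ i, (LinearMap.toContinuousLinearMap (b.coord i)).smulRight (L s (b i)) :=
    SmoothFlat.sum fun i _ => (hL (b i)).comp
      (Ψ := fun v : E => (LinearMap.toContinuousLinearMap (b.coord i)).smulRight v) fun s _ =>
        (((ContinuousLinearMap.smulRightL ℂ E E (LinearMap.toContinuousLinearMap (b.coord i))).restrictScalars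
          ℝ).contDiff).contDiffAt
  refine h1.congr fun s _ => ?_
  refine ContinuousLinearMap.coe_injective (b.ext fun j => ?_)
  simp [Finsupp.single_apply]

section Smoothness

variable {n : Type*} [Fintype n] [DecidableEq n] {k : ℕ}

theorem SmoothFlat.matrix_mul {X Y : ℝ → Matrix n n ℂ} (hX : SmoothFlat k X) (hY : SmoothFlat k Y) :
    SmoothFlat k fun s => X s * Y s :=
  hX.comp₂ hY (Ψ := fun x y : Matrix n n ℂ => x * y) (by fun_prop)

theorem SmoothFlat.smul {E : Type*} [NormedAddCommGroup E] [NormedSpace ℂ E] {c : ℝ → ℂ} {X : ℝ → E}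
    (hc : SmoothFlat k c) (hX : SmoothFlat k X) : SmoothFlat k fun s => c s • X s :=
  hc.comp₂ hX (Ψ := fun (c : ℂ) (x : E) => c • x) (by fun_prop)

theorem SmoothFlat.sub {E : Type*} [NormedAddCommGroup E] [NormedSpace ℝ E] {X Y : ℝ → E}
    (hX : SmoothFlat k X) (hY : SmoothFlat k Y) : SmoothFlat k fun s => X s - Y s :=
  hX.comp₂ hY (Ψ := fun x y : E => x - y) (by fun_prop)

theorem SmoothFlat.conjTranspose {X : ℝ → Matrix n n ℂ} (hX : SmoothFlat k X) :
    SmoothFlat k fun s => (X s)ᴴ := by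
  refine hX.comp (Ψ := fun x : Matrix n n ℂ => xᴴ) fun s _ => ?_
  let T : Matrix n n ℂ →ₗ[ℝ] Matrix n n ℂ :=
    { toFun := fun x => xᴴ
      map_add' := Matrix.conjTranspose_add
      map_smul' := fun c x => by simp }
  exact (LinearMap.toContinuousLinearMap T).contDiff.contDiffAt

variable {h : ℝ → Matrix n n ℂ} {hh : ∀ s, (h s).IsHermitian}

/-- `E_j - E_i` vanishes exactly when two levels coincide, hence for all `s` or for none. In the
first case the composite is constant, so `f` may be singular at zero. -/
theorem smoothFlat_comp_bohr (hflat : SmoothFlat k h) (hlevels : ConstantLevelDegeneracy hh)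
    {f : ℝ → ℂ} (hf : ∀ w ≠ 0, ContDiffAt ℝ ∞ f w) (i j : Fin (Fintype.card n)) :
    SmoothFlat k fun s => f (bohr (h s) (hh s) i j) := by
  have h0 : ∀ s ∈ Icc (0 : ℝ) 1, bohr (h s) (hh s) i j = 0 ↔ bohr (h 0) (hh 0) i j = 0 := fun s hs => by
    simpa only [bohr, sub_eq_zero] using hlevels s hs j i
  by_cases hz : bohr (h 0) (hh 0) i j = 0
  · exact (SmoothFlat.const (f 0)).congr fun s hs => by rw [(h0 s hs).2 hz]
  · exact (smoothFlat_bohr hflat hlevels i j).comp fun s hs => hf _ (mt (h0 s hs).1 hz)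

theorem smoothFlat_jumpOp (hflat : SmoothFlat k h) (hlevels : ConstantLevelDegeneracy hh)
    (hbohr : ConstantBohrDegeneracy hh) (A : Matrix n n ℂ) (i j : Fin (Fintype.card n)) :
    SmoothFlat k fun s => jumpOp (h s) (hh s) A (bohr (h s) (hh s) i j) := by
  obtain ⟨R, hinj, hcov⟩ := exists_representatives (f := fun s => energy (h s) (hh s)) hlevels
  have h1 : SmoothFlat k fun s => ∑ p ∈ R ×ˢ R with bohr (h 0) (hh 0) p.1 p.2 = bohr (h 0) (hh 0) i j,
      energyProj (hh s) (energy (h s) (hh s) p.1) * A * energyProj (hh s) (energy (h s) (hh s) p.2) :=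
    SmoothFlat.sum fun p _ => ((smoothFlat_energyProj hflat hlevels p.1).matrix_mul (SmoothFlat.const A)).matrix_mul
      (smoothFlat_energyProj hflat hlevels p.2)
  refine h1.congr fun s hs => ?_
  rw [jumpOp_eq_sum (hh s) (hinj s hs) fun x => (hcov x).imp fun b hb => ⟨hb.1, hb.2 s hs⟩]
  -- The selection of the pairs that share the frequency is frozen at `s = 0`.
  simp only [hbohr s hs]

theorem exists_bohr_representatives (hbohr : ConstantBohrDegeneracy hh) :
    ∃ Q : Finset (Fin (Fintype.card n) × Fin (Fintype.card n)), ∀ s ∈ Icc (0 : ℝ) 1,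
      (∀ p ∈ Q, ∀ q ∈ Q, bohr (h s) (hh s) p.1 p.2 = bohr (h s) (hh s) q.1 q.2 → p = q) ∧
      ∀ p : Fin (Fintype.card n) × Fin (Fintype.card n),
        ∃ b ∈ Q, bohr (h s) (hh s) p.1 p.2 = bohr (h s) (hh s) b.1 b.2 := by
  obtain ⟨Q, hinj, hcov⟩ := exists_representatives (f := fun s (p : Fin (Fintype.card n) × Fin (Fintype.card n)) =>
    bohr (h s) (hh s) p.1 p.2) (S := Icc (0 : ℝ) 1) fun s hs p q => hbohr s hs p.1 p.2 q.1 q.2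
  exact ⟨Q, fun s hs => ⟨hinj s hs, fun p => (hcov p).imp fun b hb => ⟨hb.1, hb.2 s hs⟩⟩⟩

variable {ι 𝒜 : Type*} [Fintype ι] [Ring 𝒜] [StarRing 𝒜] [Algebra ℂ 𝒜] {bath : Bath ι 𝒜} {g : ℝ}

theorem smoothFlat_lambShift (hflat : SmoothFlat k h) (hlevels : ConstantLevelDegeneracy hh)
    (hbohr : ConstantBohrDegeneracy hh) (A : ι → Matrix n n ℂ)
    (hS : ∀ α β, ∀ w ≠ 0, ContDiffAt ℝ ∞ (bath.lambCoeff g α β) w) :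
    SmoothFlat k fun s => lambShift bath g A (h s) (hh s) := by
  obtain ⟨Q, hQ⟩ := exists_bohr_representatives hbohr
  have h1 : SmoothFlat k fun s => ∑ α, ∑ β, ∑ p ∈ Q, bath.lambCoeff g α β (bohr (h s) (hh s) p.1 p.2) •
      ((jumpOp (h s) (hh s) (A α) (bohr (h s) (hh s) p.1 p.2))ᴴ *
        jumpOp (h s) (hh s) (A β) (bohr (h s) (hh s) p.1 p.2)) :=
    SmoothFlat.sum fun α _ => SmoothFlat.sum fun β _ => SmoothFlat.sum fun p _ =>
      (smoothFlat_comp_bohr hflat hlevels (hS α β) _ _).smul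
        ((smoothFlat_jumpOp hflat hlevels hbohr _ _ _).conjTranspose.matrix_mul
          (smoothFlat_jumpOp hflat hlevels hbohr _ _ _))
  refine h1.congr fun s hs => ?_
  simp only [lambShift, sum_bohrFreqs (hh s) (hQ s hs).1 (hQ s hs).2]

theorem generator_apply (A : ι → Matrix n n ℂ) {K : Matrix n n ℂ} (hK : K.IsHermitian) (X : Matrix n n ℂ) :
    generator bath g A K hK X =
      (-Complex.I) • ((K + lambShift bath g A K hK) * X - X * (K + lambShift bath g A K hK)) +
      ∑ α, ∑ β, ∑ w ∈ bohrFreqs hK, bath.rate g α β w •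
        (jumpOp K hK (A β) w * (X * (jumpOp K hK (A α) w)ᴴ) -
          (1 / 2 : ℂ) • ((jumpOp K hK (A α) w)ᴴ * jumpOp K hK (A β) w * X +
            X * ((jumpOp K hK (A α) w)ᴴ * jumpOp K hK (A β) w))) := by
  simp [generator, hamiltonianPart, dissipator, dissipatorPart, Matrix.mul_assoc]

theorem smoothFlat_generator (hflat : SmoothFlat k h) (hlevels : ConstantLevelDegeneracy hh)
    (hbohr : ConstantBohrDegeneracy hh) (A : ι → Matrix n n ℂ)
    (hγ : ∀ α β, ∀ w ≠ 0, ContDiffAt ℝ ∞ (bath.rate g α β) w)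
    (hS : ∀ α β, ∀ w ≠ 0, ContDiffAt ℝ ∞ (bath.lambCoeff g α β) w) :
    SmoothFlat k fun s => generator bath g A (h s) (hh s) := by
  obtain ⟨Q, hQ⟩ := exists_bohr_representatives hbohr
  refine SmoothFlat.of_apply (E := Matrix n n ℂ) fun X => ?_
  have hK := hflat.add (smoothFlat_lambShift hflat hlevels hbohr A hS)
  have hX : SmoothFlat k fun _ : ℝ => X := SmoothFlat.const X
  have hJ := fun α (p : Fin (Fintype.card n) × Fin (Fintype.card n)) =>
    smoothFlat_jumpOp hflat hlevels hbohr (A α) p.1 p.2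
  have h1 : SmoothFlat k fun s =>
      (-Complex.I) • ((h s + lambShift bath g A (h s) (hh s)) * X - X * (h s + lambShift bath g A (h s) (hh s))) +
      ∑ α, ∑ β, ∑ p ∈ Q, bath.rate g α β (bohr (h s) (hh s) p.1 p.2) •
        (jumpOp (h s) (hh s) (A β) (bohr (h s) (hh s) p.1 p.2) *
            (X * (jumpOp (h s) (hh s) (A α) (bohr (h s) (hh s) p.1 p.2))ᴴ) -
          (1 / 2 : ℂ) • ((jumpOp (h s) (hh s) (A α) (bohr (h s) (hh s) p.1 p.2))ᴴ *
              jumpOp (h s) (hh s) (A β) (bohr (h s) (hh s) p.1 p.2) * X +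
            X * ((jumpOp (h s) (hh s) (A α) (bohr (h s) (hh s) p.1 p.2))ᴴ *
              jumpOp (h s) (hh s) (A β) (bohr (h s) (hh s) p.1 p.2)))) :=
    ((SmoothFlat.const (-Complex.I)).smul ((hK.matrix_mul hX).sub (hX.matrix_mul hK))).add
      (SmoothFlat.sum fun α _ => SmoothFlat.sum fun β _ => SmoothFlat.sum fun p _ =>
        (smoothFlat_comp_bohr hflat hlevels (hγ α β) _ _).smul
          (((hJ β p).matrix_mul (hX.matrix_mul (hJ α p).conjTranspose)).sub
            ((SmoothFlat.const (1 / 2 : ℂ)).smul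
              ((((hJ α p).conjTranspose.matrix_mul (hJ β p)).matrix_mul hX).add
                (hX.matrix_mul ((hJ α p).conjTranspose.matrix_mul (hJ β p)))))))
  refine h1.congr fun s hs => ?_
  rw [generator_apply]
  simp only [sum_bohrFreqs (hh s) (hQ s hs).1 (hQ s hs).2]

end Smoothness
end Davies

/-! ### Functions of positive type -/

namespace Davies

set_option linter.unusedSectionVars false

section PositiveType

theorem integral_step {ψ : ℕ → ℂ} {N : ℕ} (hN : 0 < N) :
    ∫ x in (0 : ℝ)..1, ψ ⌈N * x⌉₊ = (N : ℂ)⁻¹ * ∑ j ∈ Finset.range N, ψ (j + 1) := by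
  have hN' : (0 : ℝ) < N := by exact_mod_cast hN
  have h1 : ∀ j : ℕ, EqOn (fun x : ℝ => ψ ⌈N * x⌉₊) (fun _ => ψ (j + 1))
      (uIoc ((j : ℝ) / N) (((j + 1 : ℕ) : ℝ) / N)) := fun j x hx => by
    rw [uIoc_of_le (by gcongr; simp)] at hx
    have h2 : ⌈N * x⌉₊ = j + 1 := by
      rw [Nat.ceil_eq_iff (by omega)]
      have h3 := hx.1
      have h4 := hx.2
      rw [div_lt_iff₀ hN'] at h3
      rw [le_div_iff₀ hN'] at h4
      push_cast at h4 ⊢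
      constructor <;> linarith
    simp only [h2]
  have h5 := intervalIntegral.sum_integral_adjacent_intervals (μ := volume) (f := fun x : ℝ => ψ ⌈N * x⌉₊)
    (a := fun j : ℕ => (j : ℝ) / N) (n := N) fun j _ =>
      (intervalIntegrable_const (c := ψ (j + 1))).congr (fun x hx => (h1 j hx).symm)
  simp only [Nat.cast_zero, zero_div, div_self hN'.ne'] at h5
  rw [← h5, Finset.mul_sum]
  refine Finset.sum_congr rfl fun j _ => ?_
  rw [intervalIntegral.integral_congr_ae (ae_of_all _ fun x hx => h1 j hx), intervalIntegral.integral_const, ← sub_div,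
    ← Complex.coe_smul]
  push_cast
  simp

theorem tendsto_ceil_div (x : ℝ) (hx : 0 ≤ x) :
    Tendsto (fun N : ℕ => (⌈(N : ℝ) * x⌉₊ : ℝ) / N) atTop (𝓝 x) := by
  have := (tendsto_nat_ceil_mul_div_atTop hx).comp tendsto_natCast_atTop_atTop
  simpa [Function.comp_def, mul_comm] using this

variable {f : ℝ → ℂ}

/-- Riemann sums: sampling at `⌈N x⌉ / N` turns the double integral into `N⁻²` times a positive type
sum, and dominated convergence, applied twice, takes the limit. -/
theorem integral_integral_nonneg_of_sum_nonneg (hc : Continuous f)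
    (hpos : ∀ (N : ℕ) (t : ℕ → ℝ), 0 ≤ ∑ j ∈ Finset.range N, ∑ l ∈ Finset.range N, f (t j - t l)) :
    0 ≤ ∫ x in (0 : ℝ)..1, ∫ y in (0 : ℝ)..1, f (x - y) := by
  obtain ⟨M, hM⟩ := (isCompact_Icc (a := (-1 : ℝ)) (b := 1)).exists_bound_of_continuousOn hc.continuousOn
  have hmem : ∀ N : ℕ, ∀ x ∈ uIoc (0 : ℝ) 1, (⌈(N : ℝ) * x⌉₊ : ℝ) / N ∈ Icc (0 : ℝ) 1 := fun N x hx => by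
    rw [uIoc_of_le zero_le_one] at hx
    refine ⟨by positivity, div_le_one_of_le₀ ?_ (by positivity)⟩
    have : ⌈(N : ℝ) * x⌉₊ ≤ N := Nat.ceil_le.2 (mul_le_of_le_one_right (by positivity) hx.2)
    exact_mod_cast this
  have hbd : ∀ a ∈ Icc (0 : ℝ) 1, ∀ b ∈ Icc (0 : ℝ) 1, ‖f (a - b)‖ ≤ M := fun a ha b hb =>
    hM _ ⟨by linarith [ha.1, hb.2], by linarith [ha.2, hb.1]⟩
  have hmeas : ∀ N : ℕ, ∀ ψ : ℕ → ℂ, Measurable fun x : ℝ => ψ ⌈(N : ℝ) * x⌉₊ := fun N ψ =>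
    (measurable_from_nat (f := ψ)).comp (Nat.measurable_ceil.comp (by fun_prop))
  have hlim : Tendsto (fun N : ℕ => ∫ x in (0 : ℝ)..1, ∫ y in (0 : ℝ)..1,
      f ((⌈(N : ℝ) * x⌉₊ : ℝ) / N - (⌈(N : ℝ) * y⌉₊ : ℝ) / N)) atTop
      (𝓝 (∫ x in (0 : ℝ)..1, ∫ y in (0 : ℝ)..1, f (x - y))) := by
    refine intervalIntegral.tendsto_integral_filter_of_dominated_convergence (fun _ => M)
      (Eventually.of_forall fun N => ?_) (Eventually.of_forall fun N => ae_of_all _ fun x hx => ?_)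
      intervalIntegrable_const (ae_of_all _ fun x hx => ?_)
    · exact (hmeas N fun j => ∫ y in (0 : ℝ)..1, f ((j : ℝ) / N - (⌈(N : ℝ) * y⌉₊ : ℝ) / N)).aestronglyMeasurable
    · refine (intervalIntegral.norm_integral_le_of_norm_le_const fun y hy =>
        hbd _ (hmem N x hx) _ (hmem N y hy)).trans ?_
      simp
    · refine intervalIntegral.tendsto_integral_filter_of_dominated_convergence (fun _ => M)
        (Eventually.of_forall fun N => ?_) (Eventually.of_forall fun N => ae_of_all _ fun y hy => ?_)
        intervalIntegrable_const (ae_of_all _ fun y hy => ?_)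
      · exact (hmeas N fun j => f ((⌈(N : ℝ) * x⌉₊ : ℝ) / N - (j : ℝ) / N)).aestronglyMeasurable
      · exact hbd _ (hmem N x hx) _ (hmem N y hy)
      · rw [uIoc_of_le zero_le_one] at hx hy
        exact (hc.tendsto _).comp ((tendsto_ceil_div x hx.1.le).sub (tendsto_ceil_div y hy.1.le))
  refine ge_of_tendsto hlim ?_
  filter_upwards [eventually_gt_atTop 0] with N hN
  rw [integral_step hN (ψ := fun j => ∫ y in (0 : ℝ)..1, f ((j : ℝ) / N - (⌈(N : ℝ) * y⌉₊ : ℝ) / N))]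
  have h1 : ∀ j : ℕ, ∫ y in (0 : ℝ)..1, f (((j + 1 : ℕ) : ℝ) / N - (⌈(N : ℝ) * y⌉₊ : ℝ) / N) =
      (N : ℂ)⁻¹ * ∑ l ∈ Finset.range N, f (((j + 1 : ℕ) : ℝ) / N - ((l + 1 : ℕ) : ℝ) / N) := fun j =>
    integral_step hN (ψ := fun l => f (((j + 1 : ℕ) : ℝ) / N - (l : ℝ) / N))
  simp only [h1]
  rw [← Finset.mul_sum, ← mul_assoc]
  refine mul_nonneg ?_ (hpos N fun j => ((j + 1 : ℕ) : ℝ) / N)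
  rw [← Complex.ofReal_natCast, ← Complex.ofReal_inv, ← Complex.ofReal_mul]
  exact Complex.zero_le_real.2 (by positivity)

/-- An integrable continuous function of positive type has nonnegative integral. -/
theorem integral_nonneg_of_sum_nonneg (hc : Continuous f) (hi : Integrable f)
    (hpos : ∀ (N : ℕ) (t : ℕ → ℝ), 0 ≤ ∑ j ∈ Finset.range N, ∑ l ∈ Finset.range N, f (t j - t l)) :
    0 ≤ ∫ t, f t := by
  -- The average of `f (T (x - y))` over the unit square, times `T`, integrates `f` over windows
  -- that exhaust the line for `0 < x < 1`.
  have h1 : ∀ T : ℝ, 0 < T → (T : ℂ) * ∫ x in (0 : ℝ)..1, ∫ y in (0 : ℝ)..1, f (T * (x - y)) =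
      ∫ x in (0 : ℝ)..1, ∫ u in (T * x - T)..(T * x), f u := fun T hT => by
    rw [← intervalIntegral.integral_const_mul]
    refine intervalIntegral.integral_congr fun x _ => ?_
    have h2 := intervalIntegral.smul_integral_comp_sub_mul f T (T * x) (a := 0) (b := 1)
    rw [mul_one, mul_zero, sub_zero, ← Complex.coe_smul, smul_eq_mul] at h2
    simp only [← h2, mul_sub]
  have hlim : Tendsto (fun T : ℝ => ∫ x in (0 : ℝ)..1, ∫ u in (T * x - T)..(T * x), f u) atTop
      (𝓝 (∫ x in (0 : ℝ)..1, ∫ t, f t)) := by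
    refine intervalIntegral.tendsto_integral_filter_of_dominated_convergence (fun _ => ∫ t, ‖f t‖)
      (Eventually.of_forall fun T => ?_) ?_ intervalIntegrable_const ?_
    · have : Continuous fun x : ℝ => ∫ u in (T * x - T)..(T * x), f u := by
        have h3 : (fun x : ℝ => ∫ u in (T * x - T)..(T * x), f u) = fun x =>
            (∫ u in (0 : ℝ)..(T * x), f u) - ∫ u in (0 : ℝ)..(T * x - T), f u := by
          ext x
          rw [intervalIntegral.integral_interval_sub_left hi.intervalIntegrable hi.intervalIntegrable]
        rw [h3]
        have h4 : Continuous fun b : ℝ => ∫ u in (0 : ℝ)..b, f u :=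
          intervalIntegral.continuous_primitive (fun _ _ => hi.intervalIntegrable) 0
        exact (h4.comp (by fun_prop : Continuous fun x : ℝ => T * x)).sub
          (h4.comp (by fun_prop : Continuous fun x : ℝ => T * x - T))
      exact this.aestronglyMeasurable
    · refine Eventually.of_forall fun T => ae_of_all _ fun x _ => ?_
      exact (intervalIntegral.norm_integral_le_integral_norm_uIoc).trans
        (setIntegral_le_integral hi.norm (ae_of_all _ fun _ => norm_nonneg _))
    · have hne : ∀ᵐ x : ℝ, x ≠ 1 := by simp [ae_iff, measure_singleton]
      filter_upwards [hne] with x hx1 hx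
      rw [uIoc_of_le zero_le_one] at hx
      refine intervalIntegral_tendsto_integral hi ?_ (tendsto_id.atTop_mul_const hx.1)
      have h5 : (fun T : ℝ => T * x - T) = fun T => T * (x - 1) := by ext; ring
      rw [h5]
      exact tendsto_id.atTop_mul_const_of_neg (by linarith [lt_of_le_of_ne hx.2 hx1])
  rw [intervalIntegral.integral_const, sub_zero, one_smul] at hlim
  refine ge_of_tendsto hlim ?_
  filter_upwards [eventually_gt_atTop 0] with T hT
  rw [← h1 T hT]
  refine mul_nonneg (Complex.zero_le_real.2 hT.le) ?_
  refine integral_integral_nonneg_of_sum_nonneg (f := fun t => f (T * t)) (by fun_prop) fun N t => ?_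
  have := hpos N fun j => T * t j
  simpa only [mul_sub] using this

end PositiveType

/-! ### Positivity of the bath rates -/

section BathRates

variable {ι 𝒜 : Type*} [Ring 𝒜] [StarRing 𝒜] [Algebra ℂ 𝒜] [StarModule ℂ 𝒜] (bath : Bath ι 𝒜) (g : ℝ)

/-- Positivity on `1 + c • a` makes `c ⟨a⟩ + c̄ ⟨a*⟩` real; `c = 1` and `c = i` give the imaginary
and real parts. -/
theorem Bath.state_star (a : 𝒜) : bath.state (star a) = star (bath.state a) := by
  have h : ∀ c : ℂ, (c * bath.state a + star c * bath.state (star a)).im = 0 := fun c => by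
    have h1 := bath.state_nonneg (1 + c • a)
    have h2 := bath.state_nonneg a
    have h3 : bath.state (star (1 + c • a) * (1 + c • a)) =
        1 + (c * bath.state a + star c * bath.state (star a)) + (star c * c) * bath.state (star a * a) := by
      simp only [star_add, star_one, star_smul, add_mul, mul_add, mul_one, one_mul, smul_mul_smul_comm, map_add,
        map_smul, smul_eq_mul, bath.state_one]
      ring
    rw [h3] at h1
    have h4 := (Complex.nonneg_iff.1 h1).2
    have h5 := (Complex.nonneg_iff.1 h2).2
    have h6 : (star c * c).im = 0 := by simp; ring
    simp only [Complex.add_im, Complex.one_im, zero_add, Complex.mul_im (star c * c), ← h5, h6, mul_zero,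
      zero_mul, add_zero] at h4
    rw [Complex.add_im]
    exact h4.symm
  have h1 := h 1
  have h2 := h Complex.I
  simp at h1 h2
  apply Complex.ext
  · simp; linarith
  · simp; linarith

theorem Bath.star_corr (α β : ι) (t : ℝ) : star (bath.corr g α β t) = bath.corr g β α (-t) := by
  have h := bath.corr₂_eq_corr g β α 0 t
  rw [zero_sub] at h
  rw [← h, Bath.corr, Bath.corr₂, Bath.corr₂, star_mul', ← bath.state_star, star_mul, ← map_star, ← map_star,
    (bath.isSelfAdjoint_B α).star_eq, (bath.isSelfAdjoint_B β).star_eq]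
  congr 1
  simp

theorem Bath.star_rate (α β : ι) (ω : ℝ) : star (bath.rate g α β ω) = bath.rate g β α ω := by
  rw [Bath.rate, Bath.rate, Complex.star_def, ← integral_conj, ← integral_neg_eq_self]
  refine integral_congr_ae (ae_of_all _ fun t => ?_)
  simp only
  rw [map_mul, ← Complex.exp_conj, ← Complex.star_def, bath.star_corr, neg_neg]
  congr 2
  simp

/-- The rates form a positive semidefinite matrix. -/
theorem Bath.posSemidef_rate [Fintype ι] (hbath : bath.Regular g) (ω : ℝ) :
    (Matrix.of fun α β => bath.rate g α β ω).PosSemidef := by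
  refine Matrix.PosSemidef.of_dotProduct_mulVec_nonneg ?_ fun v => ?_
  · ext α β
    exact bath.star_rate g β α ω
  set F : ℝ → ℂ := fun t => ∑ α, ∑ β, star (v α) * v β * bath.corr g α β t with hF
  have hFc : Continuous F := by
    have := hbath.continuous_corr
    fun_prop
  have hFi : Integrable F := integrable_finsetSum _ fun α _ => integrable_finsetSum _ fun β _ =>
    (hbath.integrable_corr α β).const_mul _
  have hnorm : ∀ t : ℝ, ‖Complex.exp (Complex.I * ω * t)‖ = 1 := fun t => by
    rw [Complex.norm_exp]; simp
  have hi : ∀ α β, Integrable fun t : ℝ => Complex.exp (Complex.I * ω * t) * bath.corr g α β t := fun α β =>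
    (hbath.integrable_corr α β).bdd_mul (c := 1) (by fun_prop) (ae_of_all _ fun t => (hnorm t).le)
  have h1 : star v ⬝ᵥ (Matrix.of fun α β => bath.rate g α β ω) *ᵥ v =
      ∫ t : ℝ, Complex.exp (Complex.I * ω * t) * F t := by
    have h2 : ∀ t : ℝ, Complex.exp (Complex.I * ω * t) * F t = ∑ α, ∑ β, star (v α) * v β *
        (Complex.exp (Complex.I * ω * t) * bath.corr g α β t) := fun t => by
      simp only [hF, Finset.mul_sum]
      exact Finset.sum_congr rfl fun α _ => Finset.sum_congr rfl fun β _ => by ring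
    simp only [h2]
    rw [integral_finsetSum _ fun α _ => integrable_finsetSum _ fun β _ => (hi α β).const_mul _]
    simp only [dotProduct, Matrix.mulVec, Finset.mul_sum]
    refine Finset.sum_congr rfl fun α _ => ?_
    rw [integral_finsetSum _ fun β _ => (hi α β).const_mul _]
    refine Finset.sum_congr rfl fun β _ => ?_
    rw [integral_const_mul]
    simp only [Matrix.of_apply, Bath.rate, Pi.star_apply]
    ring
  rw [h1]
  refine integral_nonneg_of_sum_nonneg (by fun_prop)
    (hFi.bdd_mul (c := 1) (by fun_prop) (ae_of_all _ fun t => (hnorm t).le)) fun N t => ?_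
  -- With phases absorbed, the positive type sum is `g² ⟨b* b⟩`; stationarity turns two-time
  -- correlations into functions of the difference.
  set b : 𝒜 := ∑ j ∈ Finset.range N, Complex.exp (-(Complex.I * ω * t j)) •
    ∑ β, v β • bath.evol (t j) (bath.B β) with hb
  have h3 : (g : ℂ) ^ 2 * bath.state (star b * b) = ∑ j ∈ Finset.range N, ∑ l ∈ Finset.range N,
      Complex.exp (Complex.I * ω * ((t j - t l : ℝ) : ℂ)) * F (t j - t l) := by
    simp only [hb, star_sum, star_smul]
    rw [Finset.sum_mul_sum, map_sum, Finset.mul_sum]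
    refine Finset.sum_congr rfl fun j _ => ?_
    rw [map_sum, Finset.mul_sum]
    refine Finset.sum_congr rfl fun l _ => ?_
    rw [smul_mul_smul_comm, map_smul, Finset.sum_mul_sum]
    simp only [hF, ← bath.corr₂_eq_corr, Bath.corr₂, Finset.mul_sum, map_sum, smul_mul_smul_comm, map_smul,
      smul_eq_mul, ← map_star, (bath.isSelfAdjoint_B _).star_eq]
    refine Finset.sum_congr rfl fun α _ => Finset.sum_congr rfl fun β _ => ?_
    have h4 : Complex.exp (Complex.I * ω * ((t j - t l : ℝ) : ℂ)) =
        star (Complex.exp (-(Complex.I * ω * t j))) * Complex.exp (-(Complex.I * ω * t l)) := by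
      rw [Complex.star_def, ← Complex.exp_conj, ← Complex.exp_add]
      congr 1
      simp
      ring
    rw [h4]
    ring
  rw [← h3]
  refine mul_nonneg ?_ (bath.state_nonneg b)
  rw [← Complex.ofReal_pow]
  exact Complex.zero_le_real.2 (by positivity)

end BathRates
end Davies

/-! ### Principal values -/

namespace Davies

set_option linter.unusedSectionVars false

section PrincipalValue

/-- The truncated principal value integral of `φ y / y`. -/
noncomputable def pvTrunc (φ : ℝ → ℂ) (ε : ℝ) : ℂ := ∫ y in {y : ℝ | ε < |y|}, φ y * ((1 / y : ℝ) : ℂ)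

theorem measurableSet_lt_abs (ε : ℝ) : MeasurableSet {y : ℝ | ε < |y|} :=
  measurableSet_lt measurable_const measurable_norm

theorem integral_div_sub_eq_pvTrunc (f : ℝ → ℂ) (ω ε : ℝ) :
    ∫ x in {x : ℝ | ε < |ω - x|}, f x * ((1 / (ω - x) : ℝ) : ℂ) = pvTrunc (fun y => f (ω - y)) ε := by
  have h := (Measure.measurePreserving_sub_left volume ω).setIntegral_preimage_emb
    (MeasurableEquiv.subLeft ω).measurableEmbedding
    (fun y => f (ω - y) * ((1 / y : ℝ) : ℂ)) {y : ℝ | ε < |y|}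
  simpa [pvTrunc] using h

variable {φ : ℝ → ℂ} {ε : ℝ}

theorem integrableOn_lt_abs (hφ : Continuous φ)
    (h1 : IntegrableOn (fun y => φ y * ((1 / y : ℝ) : ℂ)) {y | 1 < |y|}) (hε : 0 < ε) :
    IntegrableOn (fun y => φ y * ((1 / y : ℝ) : ℂ)) {y | ε < |y|} := by
  have h2 : IntegrableOn (fun y => φ y * ((1 / y : ℝ) : ℂ)) (Icc ε 1 ∪ Icc (-1) (-ε)) := by
    refine ContinuousOn.integrableOn_compact (isCompact_Icc.union isCompact_Icc) ?_
    refine hφ.continuousOn.mul (Complex.continuous_ofReal.comp_continuousOn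
      (ContinuousOn.div continuousOn_const continuousOn_id ?_))
    rintro y (hy | hy)
    · exact (hε.trans_le hy.1).ne'
    · exact (hy.2.trans_lt (neg_lt_zero.2 hε)).ne
  refine (h1.union h2).mono_set fun y hy => ?_
  rw [Set.mem_ofPred_eq] at hy
  rcases lt_or_ge 1 |y| with h | h
  · exact Or.inl h
  · refine Or.inr ?_
    rcases le_total 0 y with h0 | h0
    · rw [abs_of_nonneg h0] at h hy; exact Or.inl ⟨hy.le, h⟩
    · rw [abs_of_nonpos h0] at h hy; exact Or.inr ⟨by linarith, by linarith⟩

theorem lt_abs_eq_union (ε : ℝ) : {y : ℝ | ε < |y|} = Iio (-ε) ∪ Ioi ε := by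
  ext y
  simp [lt_abs, lt_neg, or_comm]

theorem integrableOn_symm_Ioi
    (h : IntegrableOn (fun y => φ y * ((1 / y : ℝ) : ℂ)) {y | ε < |y|}) :
    IntegrableOn (fun y => (φ y - φ (-y)) * ((1 / y : ℝ) : ℂ)) (Ioi ε) := by
  rw [lt_abs_eq_union ε, integrableOn_union] at h
  have h2 : IntegrableOn (fun y => φ (-y) * ((1 / (-y) : ℝ) : ℂ)) (Ioi ε) := by
    have := (Measure.measurePreserving_neg (volume : Measure ℝ)).integrableOn_comp_preimage
      (MeasurableEquiv.neg ℝ).measurableEmbedding (f := fun y => φ y * ((1 / y : ℝ) : ℂ)) (s := Iio (-ε))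
    simpa [Function.comp_def] using this.2 h.1
  refine (h.2.add h2).congr (ae_of_all _ fun y => ?_)
  simp only [Pi.add_apply]
  push_cast
  rw [div_neg]
  ring

/-- Folding along `y ↦ -y` exhibits the cancellation at the singularity as an odd difference. -/
theorem pvTrunc_eq_integral_Ioi (hε : 0 ≤ ε)
    (h : IntegrableOn (fun y => φ y * ((1 / y : ℝ) : ℂ)) {y | ε < |y|}) :
    pvTrunc φ ε = ∫ y in Ioi ε, (φ y - φ (-y)) * ((1 / y : ℝ) : ℂ) := by
  have h' := h
  rw [lt_abs_eq_union ε, integrableOn_union] at h'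
  have h2 : IntegrableOn (fun y => φ (-y) * ((1 / (-y) : ℝ) : ℂ)) (Ioi ε) := by
    have := (Measure.measurePreserving_neg (volume : Measure ℝ)).integrableOn_comp_preimage
      (MeasurableEquiv.neg ℝ).measurableEmbedding (f := fun y => φ y * ((1 / y : ℝ) : ℂ)) (s := Iio (-ε))
    simpa [Function.comp_def] using this.2 h'.1
  rw [pvTrunc, lt_abs_eq_union ε, setIntegral_union _ measurableSet_Ioi h'.1 h'.2, ← integral_Iic_eq_integral_Iio,
    ← integral_comp_neg_Ioi, add_comm, ← integral_add h'.2 h2]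
  · refine integral_congr_ae (ae_of_all _ fun y => ?_)
    simp only
    push_cast
    rw [div_neg]
    ring
  · exact disjoint_left.2 fun y hy hy' => by
      rw [mem_Iio] at hy; rw [mem_Ioi] at hy'; linarith

/-- Integrability at infinity is not assumed; without it the integral takes its default value `0`
for all small `ε`, and so does the principal value. -/
theorem pvTrunc_eq_zero_of_not_integrableOn
    (h : ¬ IntegrableOn (fun y => φ y * ((1 / y : ℝ) : ℂ)) {y | 1 < |y|}) (hε : ε ≤ 1) : pvTrunc φ ε = 0 :=
  integral_undef fun h' => h (IntegrableOn.mono_set h' fun _ hy => hε.trans_lt hy)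

end PrincipalValue

/-! ### Boundedness of the sine integral -/

section SineIntegral

theorem hasDerivAt_integral_sinc (x : ℝ) :
    HasDerivAt (fun x => ∫ u in (0 : ℝ)..x, Real.sinc u) (Real.sinc x) x :=
  intervalIntegral.integral_hasDerivAt_right (Real.continuous_sinc.intervalIntegrable _ _)
    (Real.continuous_sinc.stronglyMeasurableAtFilter _ _) Real.continuous_sinc.continuousAt

theorem continuous_integral_sinc : Continuous fun x => ∫ u in (0 : ℝ)..x, Real.sinc u :=
  continuous_iff_continuousAt.2 fun x => (hasDerivAt_integral_sinc x).continuousAt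

/-- For `c = ±1` the derivative `-(cos y + c) / y²` of `Si y + cos y / y + c / y` has constant sign,
which compares `Si x` with `Si 1` for `x ≥ 1`. Only some uniform bound is needed. -/
theorem abs_integral_sinc_le_of_nonneg {x : ℝ} (hx : 0 ≤ x) : |∫ u in (0 : ℝ)..x, Real.sinc u| ≤ 5 := by
  have hb : ∀ y : ℝ, |∫ u in (0 : ℝ)..y, Real.sinc u| ≤ |y| := fun y => by
    have := intervalIntegral.norm_integral_le_of_norm_le_const (a := 0) (b := y) (C := 1)
      (f := Real.sinc) fun u _ => by rw [Real.norm_eq_abs]; exact Real.abs_sinc_le_one u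
    simpa using this
  rcases le_total x 1 with h | h
  · exact (hb x).trans (by rw [abs_of_nonneg hx]; linarith)
  have hd : ∀ c : ℝ, ∀ y : ℝ, 0 < y → HasDerivAt
      (fun y => (∫ u in (0 : ℝ)..y, Real.sinc u) + Real.cos y / y + c / y)
      (-(Real.cos y + c) / y ^ 2) y := fun c y hy => by
    have h1 := ((hasDerivAt_integral_sinc y).add ((Real.hasDerivAt_cos y).div (hasDerivAt_id y) hy.ne')).add
      ((hasDerivAt_const y c).div (hasDerivAt_id y) hy.ne')
    convert! h1 using 1
    rw [Real.sinc_of_ne_zero hy.ne']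
    simp only [id]
    field_simp
    ring
  have hanti : AntitoneOn (fun y => (∫ u in (0 : ℝ)..y, Real.sinc u) + Real.cos y / y + 1 / y) (Ici 1) := by
    refine antitoneOn_of_hasDerivWithinAt_nonpos (convex_Ici 1) (f' := fun y => -(Real.cos y + 1) / y ^ 2)
      (fun y hy => (hd 1 y (one_pos.trans_le hy)).continuousAt.continuousWithinAt) (fun y hy => ?_) fun y hy => ?_
    · rw [interior_Ici] at hy
      exact (hd 1 y (one_pos.trans hy)).hasDerivWithinAt
    · exact div_nonpos_of_nonpos_of_nonneg (by linarith [Real.neg_one_le_cos y]) (by positivity)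
  have hmono : MonotoneOn (fun y => (∫ u in (0 : ℝ)..y, Real.sinc u) + Real.cos y / y + (-1) / y) (Ici 1) := by
    refine monotoneOn_of_hasDerivWithinAt_nonneg (convex_Ici 1) (f' := fun y => -(Real.cos y + (-1)) / y ^ 2)
      (fun y hy => (hd (-1) y (one_pos.trans_le hy)).continuousAt.continuousWithinAt) (fun y hy => ?_) fun y hy => ?_
    · rw [interior_Ici] at hy
      exact (hd (-1) y (one_pos.trans hy)).hasDerivWithinAt
    · exact div_nonneg (by linarith [Real.cos_le_one y]) (by positivity)
  have h1 := hanti (mem_Ici.2 le_rfl) (mem_Ici.2 h) h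
  have h2 := hmono (mem_Ici.2 le_rfl) (mem_Ici.2 h) h
  have h3 := abs_le.1 (hb 1)
  simp only [div_one, abs_one] at h1 h2 h3
  have hx0 : 0 < x := one_pos.trans_le h
  have h4 : |Real.cos x / x| ≤ 1 := by
    rw [abs_div, abs_of_pos hx0]
    exact div_le_one_of_le₀ ((Real.abs_cos_le_one x).trans h) hx0.le
  have h5 : 1 / x ≤ 1 := div_le_one_of_le₀ h hx0.le
  have h6 : 0 ≤ 1 / x := by positivity
  rw [neg_div] at h2
  have h7 := abs_le.1 h4
  have h8 := Real.cos_le_one 1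
  have h9 := Real.neg_one_le_cos 1
  have h10 := Real.cos_one_pos
  rw [abs_le]
  constructor <;> linarith

theorem abs_integral_sinc_le (x : ℝ) : |∫ u in (0 : ℝ)..x, Real.sinc u| ≤ 5 := by
  rcases le_total 0 x with hx | hx
  · exact abs_integral_sinc_le_of_nonneg hx
  · have h := intervalIntegral.integral_comp_neg (a := 0) (b := -x) Real.sinc
    simp only [Real.sinc_neg, neg_neg, neg_zero] at h
    rw [intervalIntegral.integral_symm, abs_neg, ← h]
    exact abs_integral_sinc_le_of_nonneg (neg_nonneg.2 hx)

theorem integral_mul_sinc (t a b : ℝ) : ∫ y in a..b, t * Real.sinc (t * y) =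
    (∫ u in (0 : ℝ)..(t * b), Real.sinc u) - ∫ u in (0 : ℝ)..(t * a), Real.sinc u := by
  rw [intervalIntegral.integral_const_mul, intervalIntegral.mul_integral_comp_mul_left,
    intervalIntegral.integral_interval_sub_left (Real.continuous_sinc.intervalIntegrable _ _)
      (Real.continuous_sinc.intervalIntegrable _ _)]

theorem mul_sinc_mul (t : ℝ) {y : ℝ} (hy : y ≠ 0) : t * Real.sinc (t * y) = Real.sin (t * y) / y := by
  rcases eq_or_ne t 0 with rfl | ht
  · simp
  · rw [Real.sinc_of_ne_zero (mul_ne_zero ht hy)]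
    field_simp

end SineIntegral

/-! ### Principal value of a Fourier integral -/

section FourierPV

variable {G : ℝ → ℂ}

theorem norm_exp_I_mul (x t : ℝ) : ‖Complex.exp (Complex.I * x * t)‖ = 1 := by
  rw [Complex.norm_exp]; simp

theorem integrable_exp_mul (hi : Integrable G) (x : ℝ) :
    Integrable fun t : ℝ => Complex.exp (Complex.I * x * t) * G t :=
  hi.bdd_mul (c := 1) (by fun_prop) (ae_of_all _ fun t => (norm_exp_I_mul x t).le)

theorem continuous_integral_exp_mul (hi : Integrable G) :
    Continuous fun x : ℝ => ∫ t : ℝ, Complex.exp (Complex.I * x * t) * G t := by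
  refine continuous_of_dominated (bound := fun t => ‖G t‖)
    (fun x => (integrable_exp_mul hi x).aestronglyMeasurable) (fun x => ae_of_all _ fun t => ?_) hi.norm
    (ae_of_all _ fun t => by fun_prop)
  rw [norm_mul, norm_exp_I_mul, one_mul]

/-- The difference of the phases is `-2i exp (i ω t) sin (t y)`; writing `sin (t y) / y` through
`sinc` removes the singularity at `y = 0`. -/
theorem symm_difference_eq_integral (hi : Integrable G) (ω : ℝ) {y : ℝ} (hy : y ≠ 0) :
    ((∫ t : ℝ, Complex.exp (Complex.I * ((ω - y : ℝ) : ℂ) * t) * G t) -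
        ∫ t : ℝ, Complex.exp (Complex.I * ((ω - -y : ℝ) : ℂ) * t) * G t) * ((1 / y : ℝ) : ℂ) =
      ∫ t : ℝ, (-2 * Complex.I) * (Complex.exp (Complex.I * ω * t) * G t) *
        ((t * Real.sinc (t * y) : ℝ) : ℂ) := by
  rw [← integral_sub (integrable_exp_mul hi _) (integrable_exp_mul hi _), ← integral_mul_const]
  refine integral_congr_ae (ae_of_all _ fun t => ?_)
  simp only
  rw [mul_sinc_mul t hy]
  have h1 : Complex.exp (Complex.I * ((ω - y : ℝ) : ℂ) * t) =
      Complex.exp (Complex.I * ω * t) * (Complex.cos (t * y) - Complex.sin (t * y) * Complex.I) := by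
    have h3 : Complex.cos (t * y) - Complex.sin (t * y) * Complex.I = Complex.exp (-(t * y) * Complex.I) := by
      rw [Complex.exp_mul_I, Complex.cos_neg, Complex.sin_neg]
      ring
    rw [h3, ← Complex.exp_add]
    congr 1
    push_cast
    ring
  have h2 : Complex.exp (Complex.I * ((ω - -y : ℝ) : ℂ) * t) =
      Complex.exp (Complex.I * ω * t) * (Complex.cos (t * y) + Complex.sin (t * y) * Complex.I) := by
    rw [← Complex.exp_mul_I, ← Complex.exp_add]
    congr 1
    push_cast
    ring
  rw [h1, h2]
  push_cast
  ring

/-- The principal value integral of an absolutely convergent Fourier integral exists. -/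
theorem exists_tendsto_pvTrunc (hi : Integrable G) (ω : ℝ) :
    ∃ c, Tendsto (pvTrunc fun y => ∫ t : ℝ, Complex.exp (Complex.I * ((ω - y : ℝ) : ℂ) * t) * G t)
      (𝓝[>] 0) (𝓝 c) := by
  set φ : ℝ → ℂ := fun y => ∫ t : ℝ, Complex.exp (Complex.I * ((ω - y : ℝ) : ℂ) * t) * G t with hφ
  have hφc : Continuous φ :=
    (continuous_integral_exp_mul hi).comp (by fun_prop : Continuous fun y : ℝ => ω - y)
  by_cases h1 : IntegrableOn (fun y => φ y * ((1 / y : ℝ) : ℂ)) {y | 1 < |y|}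
  swap
  · refine ⟨0, tendsto_const_nhds.congr' ?_⟩
    filter_upwards [Ioc_mem_nhdsGT one_pos] with ε hε
    exact (pvTrunc_eq_zero_of_not_integrableOn h1 hε.2).symm
  have hEm := integrable_exp_mul hi ω
  -- After Fubini the integral over `ε < y < 1` becomes a difference of sine integrals. Their
  -- uniform bound dominates `J` by a multiple of `‖G‖`, so the limit exists with no smoothness of
  -- the rate.
  set J : ℝ → ℝ → ℂ := fun ε t => (-2 * Complex.I) * (Complex.exp (Complex.I * ω * t) * G t) *
    (((∫ u in (0 : ℝ)..t, Real.sinc u) - ∫ u in (0 : ℝ)..(t * ε), Real.sinc u : ℝ) : ℂ) with hJ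
  have hJm : ∀ ε, AEStronglyMeasurable (J ε) := fun ε => by
    have := continuous_integral_sinc.comp (by fun_prop : Continuous fun t : ℝ => t * ε)
    refine (hEm.aestronglyMeasurable.const_mul _).mul (Continuous.aestronglyMeasurable ?_)
    exact Complex.continuous_ofReal.comp (continuous_integral_sinc.sub this)
  have key : ∀ ε ∈ Ioc (0 : ℝ) 1, pvTrunc φ ε =
      (∫ t, J ε t) + ∫ y in Ioi (1 : ℝ), (φ y - φ (-y)) * ((1 / y : ℝ) : ℂ) := fun ε hε => by
    have h2 := integrableOn_lt_abs hφc h1 hε.1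
    have h3 := integrableOn_symm_Ioi h2
    rw [pvTrunc_eq_integral_Ioi hε.1.le h2, ← intervalIntegral.integral_interval_add_Ioi h3
      (integrableOn_symm_Ioi h1)]
    congr 1
    rw [intervalIntegral.integral_congr_ae (g := fun y => ∫ t : ℝ, (-2 * Complex.I) *
      (Complex.exp (Complex.I * ω * t) * G t) * ((t * Real.sinc (t * y) : ℝ) : ℂ))
      (ae_of_all _ fun y hy => ?_), intervalIntegral_integral_swap]
    · refine integral_congr_ae (ae_of_all _ fun t => ?_)
      simp only [hJ]
      rw [intervalIntegral.integral_const_mul, intervalIntegral.integral_ofReal, integral_mul_sinc, mul_one]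
    · have hb : Integrable (fun p : ℝ × ℝ => (1 : ℂ) * ((-2 * Complex.I) *
          (Complex.exp (Complex.I * ω * p.2) * G p.2))) ((volume.restrict (uIoc ε 1)).prod volume) := by
        rw [uIoc_of_le hε.2]
        exact (integrable_const (1 : ℂ)).mul_prod (hEm.const_mul _)
      have hb' := (hb.norm.const_mul ε⁻¹)
      refine hb'.mono' ?_ ?_
      · have hm : Continuous fun p : ℝ × ℝ => ((p.2 * Real.sinc (p.2 * p.1) : ℝ) : ℂ) := by
          have := Real.continuous_sinc.comp (by fun_prop : Continuous fun p : ℝ × ℝ => p.2 * p.1)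
          exact Complex.continuous_ofReal.comp (continuous_snd.mul this)
        have := hb.aestronglyMeasurable.mul hm.aestronglyMeasurable
        refine this.congr (ae_of_all _ fun p => ?_)
        simp only [Pi.mul_apply, one_mul, Function.uncurry]
      · have hae : ∀ᵐ p ∂((volume.restrict (uIoc ε 1)).prod (volume : Measure ℝ)), p.1 ∈ uIoc ε 1 :=
          Measure.quasiMeasurePreserving_fst.ae (ae_restrict_mem measurableSet_uIoc)
        filter_upwards [hae] with p hp
        rw [uIoc_of_le hε.2] at hp
        have hp0 : 0 < p.1 := hε.1.trans hp.1
        rw [Function.uncurry, one_mul, norm_mul, mul_comm ε⁻¹]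
        refine mul_le_mul_of_nonneg_left ?_ (norm_nonneg _)
        rw [mul_sinc_mul _ hp0.ne', Complex.norm_real, norm_div, Real.norm_of_nonneg hp0.le, Real.norm_eq_abs,
          div_eq_mul_inv]
        refine (mul_le_mul (Real.abs_sin_le_one _) (inv_anti₀ hε.1 hp.1.le) (by positivity) zero_le_one).trans ?_
        rw [one_mul]
    · rw [uIoc_of_le hε.2] at hy
      exact symm_difference_eq_integral hi ω (hε.1.trans hy.1).ne'
  have hlim : Tendsto (fun ε => ∫ t, J ε t) (𝓝[>] 0) (𝓝 (∫ t, J 0 t)) := by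
    refine tendsto_integral_filter_of_dominated_convergence
      (fun t => ‖(-2 * Complex.I) * (Complex.exp (Complex.I * ω * t) * G t)‖ * 10)
      (Eventually.of_forall hJm) (Eventually.of_forall fun ε => ae_of_all _ fun t => ?_)
      ((hEm.const_mul _).norm.mul_const _) (ae_of_all _ fun t => ?_)
    · simp only [hJ]
      rw [norm_mul, Complex.norm_real]
      gcongr
      refine (norm_sub_le _ _).trans ?_
      have h2 := abs_integral_sinc_le t
      have h3 := abs_integral_sinc_le (t * ε)
      simp only [Real.norm_eq_abs]
      linarith
    · have h2 : Continuous fun ε => J ε t := by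
        have := continuous_integral_sinc.comp (by fun_prop : Continuous fun ε : ℝ => t * ε)
        exact continuous_const.mul (Complex.continuous_ofReal.comp (continuous_const.sub this))
      exact (h2.tendsto 0).mono_left nhdsWithin_le_nhds
  refine ⟨_, (hlim.add_const (∫ y in Ioi (1 : ℝ), (φ y - φ (-y)) * ((1 / y : ℝ) : ℂ))).congr' ?_⟩
  filter_upwards [Ioc_mem_nhdsGT one_pos] with ε hε
  exact (key ε hε).symm

end FourierPV

/-! ### Lamb coefficients: existence and conjugation -/

section LambCoefficients

variable {ι 𝒜 : Type*} [Ring 𝒜] [StarRing 𝒜] [Algebra ℂ 𝒜] (bath : Bath ι 𝒜) (g : ℝ)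

theorem Bath.lambCoeff_eq (α β : ι) (ω : ℝ) :
    bath.lambCoeff g α β ω = limUnder (𝓝[>] 0) (pvTrunc fun y => bath.rate g α β (ω - y)) := by
  simp only [Bath.lambCoeff, integral_div_sub_eq_pvTrunc]

theorem Bath.tendsto_lambCoeff (hbath : bath.Regular g) (α β : ι) (ω : ℝ) :
    Tendsto (pvTrunc fun y => bath.rate g α β (ω - y)) (𝓝[>] 0) (𝓝 (bath.lambCoeff g α β ω)) := by
  rw [bath.lambCoeff_eq]
  exact tendsto_nhds_limUnder (exists_tendsto_pvTrunc (hbath.integrable_corr α β) ω)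

/-- Used also at `ω = 0`, where the rate is only continuous; hence existence of the limit is drawn
from integrability of the correlations. -/
theorem Bath.star_lambCoeff [StarModule ℂ 𝒜] (hbath : bath.Regular g) (α β : ι) (ω : ℝ) :
    star (bath.lambCoeff g α β ω) = bath.lambCoeff g β α ω := by
  refine tendsto_nhds_unique ?_ (bath.tendsto_lambCoeff g hbath β α ω)
  refine ((continuous_star.tendsto _).comp (bath.tendsto_lambCoeff g hbath α β ω)).congr fun ε => ?_
  simp only [Function.comp, pvTrunc, Complex.star_def]
  rw [← integral_conj]
  refine integral_congr_ae (ae_of_all _ fun y => ?_)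
  simp only
  rw [map_mul, Complex.conj_ofReal, ← Complex.star_def, bath.star_rate]

end LambCoefficients
end Davies

/-! ### Principal values of smooth densities: the logarithmic kernel -/

namespace Davies

set_option linter.unusedSectionVars false

open scoped ContDiff

section LogKernel

theorem locallyIntegrable_log : LocallyIntegrable Real.log := fun x => by
  have h : IntervalIntegrable Real.log volume (x - 1) (x + 1) := intervalIntegral.intervalIntegrable_log'
  rw [intervalIntegrable_iff_integrableOn_Icc_of_le (by linarith)] at h
  exact ⟨_, Icc_mem_nhds (by linarith) (by linarith), h⟩

theorem integrableOn_div_of_integrable {φ : ℝ → ℂ} {ε : ℝ} (hφ : Integrable φ) (hε : 0 < ε) :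
    IntegrableOn (fun y => φ y * ((1 / y : ℝ) : ℂ)) {y | ε < |y|} := by
  refine hφ.integrableOn.mul_bdd (c := ε⁻¹) ?_ ?_
  · exact (Complex.measurable_ofReal.comp (by fun_prop)).aestronglyMeasurable
  · filter_upwards [ae_restrict_mem (measurableSet_lt_abs ε)] with y hy
    rw [Complex.norm_real, one_div, norm_inv, Real.norm_eq_abs]
    exact inv_anti₀ hε (le_of_lt hy)

/-- The principal value integral of a test function, by partial integration. -/
theorem tendsto_pvTrunc_of_hasCompactSupport {φ : ℝ → ℂ} (hφ : ContDiff ℝ 1 φ) (hs : HasCompactSupport φ) :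
    Tendsto (pvTrunc φ) (𝓝[>] 0) (𝓝 (-∫ y, Real.log y • deriv φ y)) := by
  set ψ : ℝ → ℂ := fun y => Real.log y • deriv φ y with hψ
  have hψi : Integrable ψ := locallyIntegrable_log.integrable_smul_right_of_hasCompactSupport
    (hφ.continuous_deriv le_rfl) hs.deriv
  have hψi' : Integrable fun y => ψ y + ψ (-y) := hψi.add hψi.comp_neg
  set u : ℝ → ℂ := fun y => φ y - φ (-y) with hu
  have hφd : ∀ y, HasDerivAt φ (deriv φ y) y := fun y => (hφ.differentiable (by simp) y).hasDerivAt
  have hud : ∀ y, HasDerivAt u (deriv φ y + deriv φ (-y)) y := fun y => by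
    have h1 := (hφd (-y)).scomp y (hasDerivAt_neg y)
    have h2 := (hφd y).sub h1
    convert! h2 using 1
    simp
  have hlog : ∀ y : ℝ, 0 < y → HasDerivAt (fun y : ℝ => ((Real.log y : ℝ) : ℂ)) ((1 / y : ℝ) : ℂ) y :=
    fun y hy => by
      rw [one_div]
      exact (Real.hasDerivAt_log hy.ne').ofReal_comp
  -- Partial integration of the folded integral. The boundary term is `O(ε log ε)`, because `u` is
  -- differentiable and vanishes at `0`.
  have key : ∀ ε : ℝ, 0 < ε → pvTrunc φ ε = -(u ε * ((Real.log ε : ℝ) : ℂ)) -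
      ((∫ y in Ioi (0 : ℝ), (ψ y + ψ (-y))) - ∫ y in (0 : ℝ)..ε, (ψ y + ψ (-y))) := fun ε hε => by
    have h1 := integrableOn_div_of_integrable (hφ.continuous.integrable_of_hasCompactSupport hs) hε
    have h2 : ∀ y, (deriv φ y + deriv φ (-y)) * ((Real.log y : ℝ) : ℂ) = ψ y + ψ (-y) := fun y => by
      simp only [hψ, Real.log_neg_eq_log, Complex.real_smul]
      ring
    rw [pvTrunc_eq_integral_Ioi hε.le h1,
      ← intervalIntegral.integral_interval_add_Ioi (a := 0) (b := ε) hψi'.integrableOn hψi'.integrableOn,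
      add_sub_cancel_left, integral_Ioi_mul_deriv_eq_deriv_mul (a := ε) (u := u) (a' := u ε * ((Real.log ε : ℝ) : ℂ))
        (b' := 0) (u' := fun y => deriv φ y + deriv φ (-y)) (v := fun y : ℝ => ((Real.log y : ℝ) : ℂ))
        (fun y _ => hud y) (fun y hy => hlog y (hε.trans hy)) (integrableOn_symm_Ioi h1) ?_ ?_ ?_]
    · simp only [h2]
      ring
    · refine hψi'.integrableOn.congr (ae_of_all _ fun y => ?_)
      exact (h2 y).symm
    · exact (((hud ε).continuousAt.mul (hlog ε hε).continuousAt).tendsto).mono_left nhdsWithin_le_nhds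
    · have h3 := hasCompactSupport_iff_eventuallyEq.1 hs
      rw [coclosedCompact_eq_cocompact, cocompact_eq_atBot_atTop] at h3
      have h4 : ∀ᶠ y in atTop, φ y = 0 := h3.filter_mono le_sup_right
      have h5 : ∀ᶠ y in atTop, φ (-y) = 0 := tendsto_neg_atTop_atBot.eventually (h3.filter_mono le_sup_left)
      refine tendsto_const_nhds.congr' ?_
      filter_upwards [h4, h5] with y h6 h7
      simp [hu, h6, h7]
  have hfull : ∫ y in Ioi (0 : ℝ), (ψ y + ψ (-y)) = ∫ y, ψ y := by
    rw [integral_add hψi.integrableOn hψi.comp_neg.integrableOn, integral_comp_neg_Ioi, neg_zero, add_comm]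
    exact intervalIntegral.integral_Iic_add_Ioi hψi.integrableOn hψi.integrableOn
  have hl1 : Tendsto (fun ε => u ε * ((Real.log ε : ℝ) : ℂ)) (𝓝[>] 0) (𝓝 0) := by
    have h1 := (hud 0).isBigO_sub
    simp only [hu, neg_zero, sub_self, sub_zero] at h1
    have h2 : Tendsto (fun x : ℝ => x * Real.log x) (𝓝 0) (𝓝 0) := by
      simpa using Real.continuous_mul_log.tendsto 0
    have h4 : Tendsto (fun x : ℝ => ((x : ℂ)) * ((Real.log x : ℝ) : ℂ)) (𝓝 0) (𝓝 0) := by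
      have := (Complex.continuous_ofReal.tendsto 0).comp h2
      simpa [Function.comp_def] using this
    have h5 : (fun x : ℝ => u x * ((Real.log x : ℝ) : ℂ)) =O[𝓝 0] fun x : ℝ => (x : ℂ) * ((Real.log x : ℝ) : ℂ) := by
      refine Asymptotics.IsBigO.mul (h1.trans (Asymptotics.isBigO_of_le _ fun x => by simp))
        (Asymptotics.isBigO_refl _ _)
    exact (h5.trans_tendsto h4).mono_left nhdsWithin_le_nhds
  have hl2 : Tendsto (fun ε => ∫ y in (0 : ℝ)..ε, (ψ y + ψ (-y))) (𝓝[>] 0) (𝓝 0) := by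
    have h1 : Continuous fun ε => ∫ y in (0 : ℝ)..ε, (ψ y + ψ (-y)) :=
      intervalIntegral.continuous_primitive (fun _ _ => hψi'.intervalIntegrable) 0
    have h2 := h1.tendsto 0
    rw [intervalIntegral.integral_same] at h2
    exact h2.mono_left nhdsWithin_le_nhds
  have hl := hl1.neg.sub ((tendsto_const_nhds (x := ∫ y, ψ y)).sub hl2)
  rw [neg_zero, sub_zero, zero_sub] at hl
  refine hl.congr' ?_
  filter_upwards [self_mem_nhdsWithin] with ε hε
  rw [key ε hε, hfull]

/-- The integral is the convolution of `log |y|`, locally integrable, with the test function `f'`.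
-/
theorem contDiff_integral_log_mul {f : ℝ → ℂ} (hf : ContDiff ℝ ∞ f) (hs : HasCompactSupport f) :
    ContDiff ℝ ∞ fun x => -∫ y, Real.log y • deriv (fun y => f (x - y)) y := by
  have h1 : ContDiff ℝ ∞ (convolution Real.log (deriv f) (ContinuousLinearMap.lsmul ℝ ℝ) volume) :=
    hs.deriv.contDiff_convolution_right _ locallyIntegrable_log
      (contDiff_infty_iff_deriv.1 hf).2
  convert! h1 using 1
  ext x
  rw [convolution, ← integral_neg]
  refine integral_congr_ae (ae_of_all _ fun y => ?_)
  simp only [ContinuousLinearMap.lsmul_apply, deriv_comp_const_sub, smul_neg, neg_neg]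

end LogKernel

/-! ### Cauchy transforms away from the support -/

section Weighted

variable {φ : ℝ → ℂ}

/-- Together with the converse below, this makes integrability of the tail independent of `w`. -/
theorem integrableOn_div_sub_of_weighted (hφ : Continuous φ)
    (hA : Integrable fun x => φ x * ((1 / (1 + |x|) : ℝ) : ℂ)) (w : ℝ) :
    IntegrableOn (fun y => φ (w - y) * ((1 / y : ℝ) : ℂ)) {y | 1 < |y|} := by
  have h1 := ((hA.comp_sub_left w).norm.const_mul (2 + |w|)).integrableOn (s := {y : ℝ | 1 < |y|})
  refine h1.mono' ?_ ?_
  · refine (hφ.comp (by fun_prop)).aestronglyMeasurable.mul ?_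
    exact (Complex.measurable_ofReal.comp (by fun_prop)).aestronglyMeasurable
  · filter_upwards [ae_restrict_mem (measurableSet_lt_abs 1)] with y hy
    rw [norm_mul, norm_mul, Complex.norm_real, Complex.norm_real, ← mul_assoc, mul_comm (2 + |w|), mul_assoc]
    refine mul_le_mul_of_nonneg_left ?_ (norm_nonneg _)
    rw [norm_div, norm_div, norm_one, Real.norm_eq_abs, Real.norm_of_nonneg (by positivity), mul_one_div]
    have hy' : 1 < |y| := hy
    have h2 : |w - y| ≤ |w| + |y| := abs_sub _ _
    rw [div_le_div_iff₀ (by positivity) (by positivity)]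
    nlinarith [abs_nonneg w]

theorem weighted_of_integrableOn_div_sub (hφ : Continuous φ) (w : ℝ)
    (h : IntegrableOn (fun y => φ (w - y) * ((1 / y : ℝ) : ℂ)) {y | 1 < |y|}) :
    Integrable fun x => φ x * ((1 / (1 + |x|) : ℝ) : ℂ) := by
  have hc : Continuous fun x => φ x * ((1 / (1 + |x|) : ℝ) : ℂ) := by
    refine hφ.mul (Complex.continuous_ofReal.comp (Continuous.div (by fun_prop) (by fun_prop) fun x => ?_))
    positivity
  have hc' : Continuous fun y => φ (w - y) * ((1 / (1 + |w - y|) : ℝ) : ℂ) :=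
    hc.comp (by fun_prop : Continuous fun y : ℝ => w - y)
  have h1 : IntegrableOn (fun y => φ (w - y) * ((1 / (1 + |w - y|) : ℝ) : ℂ)) {y | 1 < |y|} := by
    refine (h.norm.const_mul (1 + |w|)).mono' hc'.aestronglyMeasurable ?_
    filter_upwards [ae_restrict_mem (measurableSet_lt_abs 1)] with y hy
    rw [norm_mul, norm_mul, Complex.norm_real, Complex.norm_real, ← mul_assoc, mul_comm (1 + |w|), mul_assoc]
    refine mul_le_mul_of_nonneg_left ?_ (norm_nonneg _)
    rw [norm_div, norm_div, norm_one, Real.norm_eq_abs y, Real.norm_of_nonneg (by positivity), mul_one_div]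
    have hy' : 1 < |y| := hy
    have h2 : |y| ≤ |w| + |w - y| := by
      have := abs_sub w (w - y)
      rwa [sub_sub_cancel] at this
    rw [div_le_div_iff₀ (by positivity) (by positivity)]
    nlinarith [abs_nonneg w, abs_nonneg (w - y)]
  have h2 : IntegrableOn (fun y => φ (w - y) * ((1 / (1 + |w - y|) : ℝ) : ℂ)) (Icc (-1) 1) :=
    hc'.continuousOn.integrableOn_compact isCompact_Icc
  have h3 := h1.union h2
  have h4 : {y : ℝ | 1 < |y|} ∪ Icc (-1) 1 = univ := by
    ext y
    simp only [mem_union, Set.mem_ofPred_eq, mem_Icc, mem_univ, iff_true, ← abs_le]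
    exact lt_or_ge 1 |y|
  rw [h4, integrableOn_univ] at h3
  simpa using h3.comp_sub_left w

/-- The Cauchy transform is smooth off the support. -/
theorem contDiffAt_integral_div_sub (hφ : Continuous φ)
    (hA : Integrable fun x => φ x * ((1 / (1 + |x|) : ℝ) : ℂ)) {w₀ r : ℝ} (hr : 0 < r)
    (h0 : ∀ x, |x - w₀| < r → φ x = 0) :
    ContDiffAt ℝ ∞ (fun w : ℝ => ∫ x, φ x * ((1 / (w - x) : ℝ) : ℂ)) w₀ := by
  -- Chosen so that `1 + |x| ≤ K |x - w₀|` on the support of `φ`; for `z` in the half ball, `|z -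
  -- x|` is at least `|x - w₀| / 2`.
  set K : ℝ := (1 + |w₀|) / r + 1 with hK
  have hKp : 0 < K := by positivity
  have hden : ∀ z ∈ Metric.ball (w₀ : ℂ) (r / 2), ∀ x : ℝ, φ x ≠ 0 →
      z - x ≠ 0 ∧ ‖(z - x)⁻¹‖ ≤ 2 * K * (1 / (1 + |x|)) ∧ ‖(z - x)⁻¹‖ ≤ 2 / r := fun z hz x hx => by
    have h1 : r ≤ |x - w₀| := not_lt.1 fun h => hx (h0 x h)
    rw [Metric.mem_ball, dist_eq_norm] at hz
    have h2 : |x - w₀| ≤ ‖z - x‖ + ‖z - w₀‖ := by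
      have h3 : ((x - w₀ : ℝ) : ℂ) = (z - w₀) - (z - x) := by push_cast; ring
      rw [← Real.norm_eq_abs, ← Complex.norm_real, h3, add_comm]
      exact norm_sub_le _ _
    have h4 : |x - w₀| / 2 ≤ ‖z - x‖ := by linarith
    have hpos : 0 < |x - w₀| := hr.trans_le h1
    have h5 : 1 + |x| ≤ K * |x - w₀| := by
      have h6 : |x| ≤ |x - w₀| + |w₀| := by
        have := abs_add_le (x - w₀) w₀
        rwa [sub_add_cancel] at this
      have h7 : 1 + |w₀| ≤ (1 + |w₀|) / r * |x - w₀| := by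
        rw [div_mul_eq_mul_div, le_div_iff₀ hr]
        gcongr
      rw [hK, add_mul, one_mul]
      linarith
    have h8 : ‖(z - x)⁻¹‖ ≤ 2 / |x - w₀| := by
      rw [norm_inv, inv_eq_one_div, div_le_div_iff₀ (by linarith) hpos]
      linarith
    refine ⟨norm_pos_iff.1 (by linarith), h8.trans ?_, h8.trans (by gcongr)⟩
    rw [mul_one_div, div_le_div_iff₀ hpos (by positivity)]
    linarith
  have hmeas : ∀ z : ℂ, Measurable fun x : ℝ => (z - x)⁻¹ := fun z =>
    (measurable_const.sub Complex.measurable_ofReal).inv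
  -- The transform extends to a complex disc around `w₀`, where one complex derivative yields all
  -- orders.
  have hdiff : DifferentiableOn ℂ (fun z : ℂ => ∫ x : ℝ, φ x * (z - x)⁻¹) (Metric.ball (w₀ : ℂ) (r / 2)) := by
    intro z hz
    have hbd : ∀ w ∈ Metric.ball (w₀ : ℂ) (r / 2), ∀ x : ℝ,
        ‖φ x * (w - x)⁻¹‖ ≤ 2 * K * ‖φ x * ((1 / (1 + |x|) : ℝ) : ℂ)‖ := fun w hw x => by
      by_cases hx : φ x = 0
      · simp [hx]
      · rw [norm_mul, norm_mul, mul_left_comm, Complex.norm_real, Real.norm_of_nonneg (by positivity)]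
        gcongr
        exact (hden w hw x hx).2.1
    have hm : ∀ w : ℂ, AEStronglyMeasurable fun x : ℝ => φ x * (w - x)⁻¹ := fun w =>
      hφ.aestronglyMeasurable.mul (hmeas w).aestronglyMeasurable
    refine ((hasDerivAt_integral_of_dominated_loc_of_deriv_le (F := fun (z : ℂ) (x : ℝ) => φ x * (z - x)⁻¹)
      (F' := fun z x => φ x * (-((z - x)⁻¹ * (z - x)⁻¹)))
      (bound := fun x => 2 / r * (2 * K * ‖φ x * ((1 / (1 + |x|) : ℝ) : ℂ)‖))
      (Metric.isOpen_ball.mem_nhds hz) (Eventually.of_forall hm)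
      ((hA.norm.const_mul (2 * K)).mono' (hm z) (ae_of_all _ (hbd z hz)))
      (hφ.aestronglyMeasurable.mul ((hmeas z).mul (hmeas z)).neg.aestronglyMeasurable)
      (ae_of_all _ fun x w hw => ?_) ((hA.norm.const_mul _).const_mul _)
      (ae_of_all _ fun x w hw => ?_)).2).differentiableAt.differentiableWithinAt
    · by_cases hx : φ x = 0
      · simp [hx]
      · rw [mul_neg, norm_neg, ← mul_assoc, norm_mul, mul_comm]
        exact mul_le_mul (hden w hw x hx).2.2 (hbd w hw x) (norm_nonneg _) (by positivity)
    · by_cases hx : φ x = 0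
      · simpa [hx] using hasDerivAt_const w (0 : ℂ)
      · have h1 := ((hasDerivAt_id w).sub_const (x : ℂ)).inv (hden w hw x hx).1
        convert! h1.const_mul (φ x) using 1
        simp only [id]
        field_simp
  have hcd : ContDiffAt ℂ ∞ (fun z : ℂ => ∫ x : ℝ, φ x * (z - x)⁻¹) (w₀ : ℂ) :=
    (hdiff.contDiffOn Metric.isOpen_ball).contDiffAt (Metric.ball_mem_nhds _ (by positivity))
  have h1 : ContDiffAt ℝ ∞ (fun w : ℝ => ∫ x : ℝ, φ x * ((w : ℂ) - x)⁻¹) w₀ :=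
    ContDiffAt.comp (g := fun z : ℂ => ∫ x : ℝ, φ x * (z - x)⁻¹) w₀ (hcd.restrict_scalars ℝ)
      Complex.ofRealCLM.contDiff.contDiffAt
  simpa only [one_div, Complex.ofReal_inv, Complex.ofReal_sub] using h1

theorem pvTrunc_eq_integral_of_eq_zero {w ε r w₀ : ℝ} (h0 : ∀ x, |x - w₀| < r → φ x = 0)
    (hw : |w - w₀| < r / 2) (hε : ε < r / 2) :
    pvTrunc (fun y => φ (w - y)) ε = ∫ x, φ x * ((1 / (w - x) : ℝ) : ℂ) := by
  rw [← integral_div_sub_eq_pvTrunc]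
  refine setIntegral_eq_integral_of_forall_compl_eq_zero fun x hx => ?_
  rw [h0 x ?_, zero_mul]
  rw [Set.mem_ofPred_eq, not_lt] at hx
  have := abs_sub_le x w w₀
  rw [abs_sub_comm x w] at this
  linarith

end Weighted

/-! ### Smoothness of the Lamb coefficients -/

section LambSmooth

variable {ι 𝒜 : Type*} [Ring 𝒜] [StarRing 𝒜] [Algebra ℂ 𝒜] (bath : Bath ι 𝒜) (g : ℝ)

theorem Bath.contDiffAt_rate (hbath : bath.Regular g) (α β : ι) {x : ℝ} (hx : x ≠ 0) :
    ContDiffAt ℝ ∞ (bath.rate g α β) x :=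
  (hbath.contDiffOn_rate α β).contDiffAt (isOpen_compl_singleton.mem_nhds hx)

theorem Bath.continuous_rate (hbath : bath.Regular g) (α β : ι) : Continuous (bath.rate g α β) :=
  continuous_integral_exp_mul (hbath.integrable_corr α β)

/-- The coefficients of the Lamb shift are smooth functions of the nonzero frequencies. -/
theorem Bath.contDiffAt_lambCoeff (hbath : bath.Regular g) (α β : ι) {w₀ : ℝ} (h0 : w₀ ≠ 0) :
    ContDiffAt ℝ ∞ (bath.lambCoeff g α β) w₀ := by
  set γ := bath.rate g α β with hγ
  have hγc : Continuous γ := bath.continuous_rate g hbath α β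
  -- Without weighted integrability every truncation with `ε ≤ 1` is zero at every frequency, so the
  -- coefficient is identically zero.
  by_cases hA : Integrable fun x => γ x * ((1 / (1 + |x|) : ℝ) : ℂ)
  swap
  · have h1 : bath.lambCoeff g α β = fun _ => 0 := by
      ext w
      refine tendsto_nhds_unique (bath.tendsto_lambCoeff g hbath α β w) (tendsto_const_nhds.congr' ?_)
      filter_upwards [Ioc_mem_nhdsGT one_pos] with ε hε
      exact (pvTrunc_eq_zero_of_not_integrableOn
        (fun h => hA (weighted_of_integrableOn_div_sub hγc w h)) hε.2).symm
    rw [h1]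
    exact contDiffAt_const
  have hpos : 0 < |w₀| := abs_pos.2 h0
  -- The outer radius `|w₀| / 2` keeps the possibly nonsmooth frequency `0` off the support; the
  -- inner radius makes the complementary part vanish near `w₀`.
  let χ : ContDiffBump w₀ := ⟨|w₀| / 4, |w₀| / 2, by positivity, by linarith⟩
  have hχs : ∀ x, |w₀| / 2 < |x - w₀| → χ x = 0 := fun x hx =>
    χ.zero_of_le_dist (by rw [Real.dist_eq]; exact hx.le)
  set f : ℝ → ℂ := fun x => (χ x : ℂ) * γ x with hf
  set q : ℝ → ℂ := fun x => (1 - (χ x : ℂ)) * γ x with hq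
  have hχc : ContDiff ℝ ∞ fun x => (χ x : ℂ) := Complex.ofRealCLM.contDiff.comp χ.contDiff
  have hfc : ContDiff ℝ ∞ f := contDiff_iff_contDiffAt.2 fun x => by
    rcases eq_or_ne x 0 with rfl | hx
    · have h1 : f =ᶠ[𝓝 0] fun _ => 0 := by
        have h2 : ∀ᶠ x : ℝ in 𝓝 0, |w₀| / 2 < |x - w₀| :=
          (continuous_abs.comp (continuous_sub_right w₀)).tendsto 0 |>.eventually_const_lt (by
            simpa using h0)
        filter_upwards [h2] with x hx
        simp [hf, hχs x hx]
      exact contDiffAt_const.congr_of_eventuallyEq h1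
    · exact hχc.contDiffAt.mul (bath.contDiffAt_rate g hbath α β hx)
  have hfs : HasCompactSupport f := by
    have h1 : HasCompactSupport fun x => (χ x : ℂ) := χ.hasCompactSupport.comp_left Complex.ofReal_zero
    exact h1.mul_right
  have hqc : Continuous q := (continuous_const.sub hχc.continuous).mul hγc
  have hqA : Integrable fun x => q x * ((1 / (1 + |x|) : ℝ) : ℂ) := by
    refine hA.mono (hqc.aestronglyMeasurable.mul
      (Complex.measurable_ofReal.comp (by fun_prop)).aestronglyMeasurable) (ae_of_all _ fun x => ?_)
    rw [norm_mul, norm_mul (γ x)]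
    refine mul_le_mul_of_nonneg_right ?_ (norm_nonneg _)
    simp only [hq, norm_mul]
    refine mul_le_of_le_one_left (norm_nonneg _) ?_
    rw [← Complex.ofReal_one, ← Complex.ofReal_sub, Complex.norm_real,
      Real.norm_of_nonneg (sub_nonneg.2 χ.le_one)]
    linarith [χ.nonneg (x := x)]
  have hq0 : ∀ x, |x - w₀| < |w₀| / 4 → q x = 0 := fun x hx => by
    have h1 : χ x = 1 := χ.one_of_mem_closedBall (by
      rw [Metric.mem_closedBall, Real.dist_eq]; exact hx.le)
    simp [hq, h1]
  have hP := contDiff_integral_log_mul hfc hfs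
  have hQ := contDiffAt_integral_div_sub hqc hqA (by positivity : 0 < |w₀| / 4) hq0
  refine (hP.contDiffAt.add hQ).congr_of_eventuallyEq ?_
  have hnear : ∀ᶠ w : ℝ in 𝓝 w₀, |w - w₀| < |w₀| / 4 / 2 := by
    have := Metric.ball_mem_nhds w₀ (by positivity : 0 < |w₀| / 4 / 2)
    filter_upwards [this] with w hw
    rwa [Metric.mem_ball, Real.dist_eq] at hw
  filter_upwards [hnear] with w hw
  have h1 : ContDiff ℝ 1 fun y => f (w - y) := (hfc.of_le (by exact_mod_cast le_top)).comp (by fun_prop)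
  have h2 : HasCompactSupport fun y => f (w - y) := hfs.comp_homeomorph (Homeomorph.subLeft w)
  have h3 := (tendsto_pvTrunc_of_hasCompactSupport h1 h2).add_const (∫ x, q x * ((1 / (w - x) : ℝ) : ℂ))
  refine tendsto_nhds_unique (bath.tendsto_lambCoeff g hbath α β w) (h3.congr' ?_)
  filter_upwards [Ioo_mem_nhdsGT (by positivity : 0 < |w₀| / 4 / 2)] with ε hε
  rw [← pvTrunc_eq_integral_of_eq_zero hq0 hw hε.2, pvTrunc, pvTrunc, pvTrunc, ← integral_add]
  · refine integral_congr_ae (ae_of_all _ fun y => ?_)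
    simp only [hf, hq]
    ring
  · exact integrableOn_div_of_integrable (h1.continuous.integrable_of_hasCompactSupport h2) hε.1
  · exact integrableOn_lt_abs (hqc.comp (by fun_prop : Continuous fun y : ℝ => w - y))
      (integrableOn_div_sub_of_weighted hqc hqA w) hε.1

end LambSmooth
end Davies

/-! ### Lindblad form of the Davies generator -/

namespace Davies

set_option linter.unusedSectionVars false

section Lindblad

variable {n : Type*} [Fintype n] [DecidableEq n]

theorem isLindblad_of_fintype {κ : Type*} [Fintype κ] {L : Matrix n n ℂ →L[ℂ] Matrix n n ℂ}
    (G : Matrix n n ℂ) (V : κ → Matrix n n ℂ) (hL : ∀ X, L X = G * X + X * Gᴴ + ∑ a, V a * X * (V a)ᴴ)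
    (hG : G + Gᴴ + ∑ a, (V a)ᴴ * V a = 0) : IsLindblad L := by
  refine ⟨Fintype.card κ, G, fun a => V ((Fintype.equivFin κ).symm a), fun X => ?_, ?_⟩
  · rw [hL, Equiv.sum_comp (Fintype.equivFin κ).symm fun a => V a * X * (V a)ᴴ]
  · rw [Equiv.sum_comp (Fintype.equivFin κ).symm fun a => (V a)ᴴ * V a, hG]

variable {ι : Type*} [Fintype ι]

/-- A factorization `Cᴴ C` of the rate matrix, applied to the jumps, replaces the double sum by a
sum of completely positive terms. -/
theorem sum_mul_mul_eq_sum_conj (C : Matrix ι ι ℂ) (J : ι → Matrix n n ℂ) (X : Matrix n n ℂ) :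
    ∑ k, (∑ β, C k β • J β) * X * (∑ β, C k β • J β)ᴴ =
      ∑ α, ∑ β, (Cᴴ * C) α β • (J β * X * (J α)ᴴ) := by
  have h : ∀ k, (∑ β, C k β • J β) * X * (∑ β, C k β • J β)ᴴ =
      ∑ α, ∑ β, (star (C k α) * C k β) • (J β * X * (J α)ᴴ) := fun k => by
    rw [Matrix.conjTranspose_sum, Finset.mul_sum]
    refine Finset.sum_congr rfl fun α _ => ?_
    rw [Finset.sum_mul, Finset.sum_mul]
    refine Finset.sum_congr rfl fun β _ => ?_
    rw [Matrix.conjTranspose_smul, Matrix.smul_mul, Matrix.smul_mul, Matrix.mul_smul, smul_smul, mul_comm (C k β)]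
  simp only [h]
  rw [Finset.sum_comm]
  refine Finset.sum_congr rfl fun α _ => ?_
  rw [Finset.sum_comm]
  refine Finset.sum_congr rfl fun β _ => ?_
  rw [← Finset.sum_smul]
  rfl

theorem sum_conjTranspose_mul_eq (C : Matrix ι ι ℂ) (J : ι → Matrix n n ℂ) :
    ∑ k, (∑ β, C k β • J β)ᴴ * (∑ β, C k β • J β) = ∑ α, ∑ β, (Cᴴ * C) α β • ((J α)ᴴ * J β) := by
  have h : ∀ k, (∑ β, C k β • J β)ᴴ * (∑ β, C k β • J β) =
      ∑ α, ∑ β, (star (C k α) * C k β) • ((J α)ᴴ * J β) := fun k => by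
    rw [Matrix.conjTranspose_sum, Finset.sum_mul]
    refine Finset.sum_congr rfl fun α _ => ?_
    rw [Finset.mul_sum]
    refine Finset.sum_congr rfl fun β _ => ?_
    rw [Matrix.conjTranspose_smul, Matrix.smul_mul, Matrix.mul_smul, smul_smul]
  simp only [h]
  rw [Finset.sum_comm]
  refine Finset.sum_congr rfl fun α _ => ?_
  rw [Finset.sum_comm]
  refine Finset.sum_congr rfl fun β _ => ?_
  rw [← Finset.sum_smul]
  rfl

variable {𝒜 : Type*} [Ring 𝒜] [StarRing 𝒜] [Algebra ℂ 𝒜] [StarModule ℂ 𝒜] {bath : Bath ι 𝒜} {g : ℝ}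

theorem isHermitian_lambShift (hbath : bath.Regular g) (A : ι → Matrix n n ℂ) {K : Matrix n n ℂ}
    (hK : K.IsHermitian) : (lambShift bath g A K hK).IsHermitian := by
  rw [Matrix.IsHermitian, lambShift]
  simp only [Matrix.conjTranspose_sum, Matrix.conjTranspose_smul, Matrix.conjTranspose_mul,
    Matrix.conjTranspose_conjTranspose, bath.star_lambCoeff g hbath]
  rw [Finset.sum_comm]

/-- The Davies generator is of Lindblad form. -/
theorem isLindblad_generator (hbath : bath.Regular g) (A : ι → Matrix n n ℂ) {K : Matrix n n ℂ}
    (hK : K.IsHermitian) : IsLindblad (generator bath g A K hK) := by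
  classical
  have hC : ∀ ω, ∃ C : Matrix ι ι ℂ, (Matrix.of fun α β => bath.rate g α β ω) = Cᴴ * C := fun ω =>
    exists_eq_conjTranspose_mul_self (bath.posSemidef_rate g hbath ω)
  choose C hC using hC
  have hCr : ∀ ω α β, ((C ω)ᴴ * C ω) α β = bath.rate g α β ω := fun ω α β => by rw [← hC]; rfl
  set Λ := K + lambShift bath g A K hK with hΛ
  have hΛh : Λᴴ = Λ := hK.add (isHermitian_lambShift hbath A hK)
  set V : bohrFreqs hK × ι → Matrix n n ℂ := fun p => ∑ β, C p.1 p.2 β • jumpOp K hK (A β) p.1 with hV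
  set W := ∑ p, (V p)ᴴ * V p with hW
  have hWh : Wᴴ = W := by
    simp only [hW, Matrix.conjTranspose_sum, Matrix.conjTranspose_mul, Matrix.conjTranspose_conjTranspose]
  have hWs : W = ∑ α, ∑ β, ∑ ω ∈ bohrFreqs hK,
      bath.rate g α β ω • ((jumpOp K hK (A α) ω)ᴴ * jumpOp K hK (A β) ω) := by
    rw [hW, Fintype.sum_prod_type]
    simp only [hV, sum_conjTranspose_mul_eq, hCr]
    rw [Finset.sum_coe_sort (bohrFreqs hK) fun ω => ∑ α, ∑ β,
      bath.rate g α β ω • ((jumpOp K hK (A α) ω)ᴴ * jumpOp K hK (A β) ω), Finset.sum_comm]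
    exact Finset.sum_congr rfl fun α _ => Finset.sum_comm
  have hVs : ∀ X, ∑ p, V p * X * (V p)ᴴ = ∑ α, ∑ β, ∑ ω ∈ bohrFreqs hK,
      bath.rate g α β ω • (jumpOp K hK (A β) ω * X * (jumpOp K hK (A α) ω)ᴴ) := fun X => by
    rw [Fintype.sum_prod_type]
    simp only [hV, sum_mul_mul_eq_sum_conj, hCr]
    rw [Finset.sum_coe_sort (bohrFreqs hK) fun ω => ∑ α, ∑ β,
      bath.rate g α β ω • (jumpOp K hK (A β) ω * X * (jumpOp K hK (A α) ω)ᴴ), Finset.sum_comm]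
    exact Finset.sum_congr rfl fun α _ => Finset.sum_comm
  have hG : (-Complex.I • Λ - (1 / 2 : ℂ) • W)ᴴ = Complex.I • Λ - (1 / 2 : ℂ) • W := by
    rw [Matrix.conjTranspose_sub, Matrix.conjTranspose_smul, Matrix.conjTranspose_smul, hΛh, hWh]
    simp
  -- The drift is `-i (K + H_LS) - W / 2`: the first term is anti-Hermitian because the Lamb shift
  -- is Hermitian, the second balances the jumps.
  refine isLindblad_of_fintype (-Complex.I • Λ - (1 / 2 : ℂ) • W) V (fun X => ?_) ?_
  · rw [hG, hVs, generator_apply, ← hΛ]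
    have h1 : ∑ α, ∑ β, ∑ ω ∈ bohrFreqs hK, bath.rate g α β ω •
        (jumpOp K hK (A β) ω * (X * (jumpOp K hK (A α) ω)ᴴ) -
          (1 / 2 : ℂ) • ((jumpOp K hK (A α) ω)ᴴ * jumpOp K hK (A β) ω * X +
            X * ((jumpOp K hK (A α) ω)ᴴ * jumpOp K hK (A β) ω))) =
        (∑ α, ∑ β, ∑ ω ∈ bohrFreqs hK,
          bath.rate g α β ω • (jumpOp K hK (A β) ω * X * (jumpOp K hK (A α) ω)ᴴ)) -
          (1 / 2 : ℂ) • (W * X + X * W) := by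
      rw [hWs]
      simp only [Finset.sum_mul, Finset.mul_sum, ← Finset.sum_add_distrib, Finset.smul_sum,
        ← Finset.sum_sub_distrib]
      refine Finset.sum_congr rfl fun α _ => Finset.sum_congr rfl fun β _ => Finset.sum_congr rfl fun ω _ => ?_
      rw [smul_sub, Matrix.smul_mul, Matrix.mul_smul, ← smul_add, smul_comm (1 / 2 : ℂ)]
      simp only [Matrix.mul_assoc]
    rw [h1]
    simp only [Matrix.sub_mul, Matrix.mul_sub, Matrix.smul_mul, Matrix.mul_smul, smul_add, smul_sub, neg_smul,
      Matrix.neg_mul]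
    abel
  · rw [hG]
    have h2 : (1 / 2 : ℂ) • W + (1 / 2 : ℂ) • W = W := by rw [← add_smul]; norm_num
    have h3 : -Complex.I • Λ - (1 / 2 : ℂ) • W + (Complex.I • Λ - (1 / 2 : ℂ) • W) + W =
        W - ((1 / 2 : ℂ) • W + (1 / 2 : ℂ) • W) := by
      rw [neg_smul]
      abel
    rw [← hW, h3, h2, sub_self]

end Lindblad
end Davies

/-! ### The proposition -/

open Davies in
theorem proposition4 {n ι 𝒜 : Type*} [Fintype n] [DecidableEq n] [Fintype ι]
    [Ring 𝒜] [StarRing 𝒜] [Algebra ℂ 𝒜] [StarModule ℂ 𝒜]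
    -- the bath, the coupling constant, the system parts of the interaction
    (bath : Bath ι 𝒜) (g : ℝ) (hbath : bath.Regular g) (A : ι → Matrix n n ℂ)
    -- the system Hamiltonian `H_S(t) = h (t / τ)`, for `t ∈ [0, τ]`
    (h : ℝ → Matrix n n ℂ) (hh : ∀ s, (h s).IsHermitian) (hsmooth : ContDiffOn ℝ (⊤ : ℕ∞) h (Icc 0 1))
    (hlevels : ConstantLevelDegeneracy hh) (hbohr : ConstantBohrDegeneracy hh)
    (k : ℕ) (hvanish : ∀ j : ℕ, 1 ≤ j → j ≤ k → iteratedDerivWithin j h (Icc 0 1) 1 = 0) :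
    -- smoothness and vanishing derivatives of the generator, jump operators and Lamb shift
    (∀ τ : ℝ, 0 < τ →
      (ContDiffOn ℝ (⊤ : ℕ∞) (fun t => generator bath g A (h (t / τ)) (hh _)) (Icc 0 τ) ∧
        ∀ j : ℕ, 1 ≤ j → j ≤ k →
          iteratedDerivWithin j (fun t => generator bath g A (h (t / τ)) (hh _)) (Icc 0 τ) τ = 0) ∧
      (∀ α p q,
        ContDiffOn ℝ (⊤ : ℕ∞) (fun t => jumpOp (h (t / τ)) (hh _) (A α) (bohr (h (t / τ)) (hh _) p q)) (Icc 0 τ) ∧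
        ∀ j : ℕ, 1 ≤ j → j ≤ k →
          iteratedDerivWithin j (fun t => jumpOp (h (t / τ)) (hh _) (A α) (bohr (h (t / τ)) (hh _) p q))
            (Icc 0 τ) τ = 0) ∧
      (ContDiffOn ℝ (⊤ : ℕ∞) (fun t => lambShift bath g A (h (t / τ)) (hh _)) (Icc 0 τ) ∧
        ∀ j : ℕ, 1 ≤ j → j ≤ k →
          iteratedDerivWithin j (fun t => lambShift bath g A (h (t / τ)) (hh _)) (Icc 0 τ) τ = 0)) ∧
    -- the case of a unique steady state
    ((∀ s ∈ Icc (0 : ℝ) 1, ∃! σ, IsSteadyState (generator bath g A (h s) (hh s)) σ) →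
      BoundaryCancellationHypotheses k (fun s => generator bath g A (h s) (hh s)) ∧
      ∃ C : ℝ, ∀ τ : ℝ, 0 < τ → ∀ ρ σ : ℝ → Matrix n n ℂ,
        (∀ t ∈ Icc 0 τ, IsSteadyState (generator bath g A (h (t / τ)) (hh _)) (σ t)) →
        ρ 0 = σ 0 →
        (∀ t ∈ Icc 0 τ,
          HasDerivWithinAt ρ (generator bath g A (h (t / τ)) (hh _) (ρ t)) (Icc 0 τ) t) →
        traceNorm (ρ τ - σ τ) ≤ C / τ ^ (k + 1)) := by
  have hflat : SmoothFlat k h := SmoothFlat.of_iteratedDerivWithin hsmooth hvanish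
  have hγ : ∀ α β, ∀ w ≠ 0, ContDiffAt ℝ (⊤ : ℕ∞) (bath.rate g α β) w := fun α β w hw =>
    bath.contDiffAt_rate g hbath α β hw
  have hS : ∀ α β, ∀ w ≠ 0, ContDiffAt ℝ (⊤ : ℕ∞) (bath.lambCoeff g α β) w := fun α β w hw =>
    bath.contDiffAt_lambCoeff g hbath α β hw
  have hL : SmoothFlat k fun s => generator bath g A (h s) (hh s) :=
    smoothFlat_generator hflat hlevels hbohr A hγ hS
  have hJ := fun α p q => smoothFlat_jumpOp hflat hlevels hbohr (A α) p q
  have hLS : SmoothFlat k fun s => lambShift bath g A (h s) (hh s) :=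
    smoothFlat_lambShift hflat hlevels hbohr A hS
  refine ⟨fun τ hτ => ⟨⟨hL.contDiffOn_div hτ, hL.iteratedDerivWithin_div hτ⟩,
    fun α p q => ⟨(hJ α p q).contDiffOn_div hτ, (hJ α p q).iteratedDerivWithin_div hτ⟩,
    hLS.contDiffOn_div hτ, hLS.iteratedDerivWithin_div hτ⟩, fun hu => ?_⟩
  have hLind : ∀ s ∈ Icc (0 : ℝ) 1, IsLindblad (generator bath g A (h s) (hh s)) := fun s _ =>
    isLindblad_generator hbath A (hh s)
  refine ⟨⟨hL.1.of_le (by exact_mod_cast le_top), fun s hs => (hLind s hs).trace_apply,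
    fun s hs => (hLind s hs).map_conjTranspose, exists_uniform_gap isCompact_Icc hL.1.continuousOn hLind hu,
    fun s hs => ?_, fun s hs r hr X => (hLind s hs).traceNorm_exp_le hr X, hL.iteratedDerivWithin_eq_zero⟩,
    boundary_cancellation hL hLind hu⟩
  obtain ⟨σ, hσ, hσu⟩ := hu s hs
  -- Here positivity is not required of `σ'`: the difference of two solutions is a traceless element
  -- of the kernel.
  refine ⟨σ, ⟨hσ.2.2, hσ.2.1⟩, fun σ' hσ' => sub_eq_zero.1 ?_⟩
  refine eq_zero_of_apply_eq_zero (hLind s hs) hσ hσu ?_ ?_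
  · rw [map_sub, hσ'.1, hσ.2.2, sub_zero]
  · rw [Matrix.trace_sub, hσ'.2, hσ.2.1, sub_self]
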